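/- Let $a=\frac12$. Let $\mathbb B(p,r)\subset\mathbb C^2$ denote the open Euclidean ball, $\mathbb B=\mathbb B(0,1)$, $D(0,r)\subset\mathbb C$ the open disc, $\|G\|_S=\sup_{S}\|G\|$, and write $A\subset\subset B$ if $\overline A$ is compact and contained in $B$. Let $\varepsilon$ be any function assigning to every finite family $(G_1,\dots,G_s)$ of holomorphic automorphisms of $\mathbb C^2$ with $G_j(\mathbb B)\subset\subset\mathbb B$ for all $j$ a number $\varepsilon(G_1,\dots,G_s)>0$. Then there exist automorphisms of $\mathbb C^2$ $$F_k(z,w)=(f_k(z)+aw,\,az),\qquad f_k\in\mathcal O(\mathbb C),\quad f_k(z)=z+O(z^2)\ (z\to0),\qquad k=0,1,2,\dots,$$ points $P_n=(z_n,w_n)\in\mathbb C^2$ $(n\ge 0)$, real numbers $\beta_n>0$ with $\beta_n\to0$, real numbers $R_k>0$ strictly increasing to $\infty$, strictly increasing sequences of non-negative integers $(n_k)_{k\ge0}$ and $(N_k)_{k\ge0}$ with $n_k\le N_k$ for all $k\ge 0$ and $N_{k-1}\le n_k$ for all $k\ge1$, and odd integers $d_k\ge2$ $(k\ge1)$, such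 that: (a) $\|F_k-F_{k-1}\|_{D(0,R_{k-1})\times\mathbb C}\le 2^{-k}$ for all $k\ge1$; (b) $F_k(P_n)=P_{n+1}$ for all $k\ge 0$ and $0\le n<N_k$; (c) $\|P_{n_k}\|\le\frac1k$ for all $k\ge1$; (d) for all $k\ge 0$: $|z_{N_k}|>R_k+3$, and $|z_n|+\beta_n<R_k$ for every $0\le n<N_k$; (e) for all $k\ge1$: $\beta_n=\frac1k$ if $N_{k-1}<n<n_k$; $\beta_n=\frac1{k+1}$ if $n_k<n\le N_k$; and $\beta_{n_k}<\frac1{k+1}$ is of the form $\beta_{n_k}=a^{2q_k}$ for some integer $q_k$; (f) $k\,|\log\beta_{n_k}|\le d_k\cdots d_1$ for all $k\ge1$; (g) for all $0\le s\le k$ and all $1\le j\le N_k-n_s$, $$F_k^j(\mathbb B(P_{n_s},\beta_{n_s}))\subset\subset\mathbb B(P_{n_s+j},\beta_{n_s+j});$$ (h) for all $1\le s\le k$, $$\big\|\Phi_{n_s}^{-1}\circ F_k^{\,n_s-n_{s-1}}\circ\Phi_{n_{s-1}}-H_s\big\|_{\overline{\mathbb B}}<\min\{\varepsilon(H_1,\dots,H_s),\,a^{d_s\cdots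 d_1}\},$$ where $\Phi_n(x)=P_n+\beta_n x$ for $x\in\mathbb C^2$ and $H_j(z,w)=\big((az)^{d_j}+a^{d_j\cdots d_1}w,\ a^{d_j\cdots d_1}z\big)$. -/

import Mathlib

open Filter Topology Asymptotics
open scoped ENNReal

noncomputable section

namespace OscHenon

/-- `ℂ²` with its Euclidean norm; the point `(z, w)` is written `!₂[z, w]`. -/
abbrev C2 : Type := EuclideanSpace ℂ (Fin 2)

/-- The map `(z, w) ↦ (f(z) + a w, a z)`. -/
def henonMap (a : ℝ) (f : ℂ → ℂ) (p : C2) : C2 :=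
  !₂[f (p 0) + (a : ℂ) * p 1, (a : ℂ) * p 0]

/-- Holomorphic automorphisms of `ℂ²`: entire maps with an entire two-sided inverse. -/
def IsHolAut (F : C2 → C2) : Prop :=
  Differentiable ℂ F ∧
    ∃ G : C2 → C2, Differentiable ℂ G ∧ Function.LeftInverse G F ∧ Function.RightInverse G F

/-- `A ⊂⊂ B`: the closure of `A` is compact and contained in `B`. -/
def RelCompactIn (A B : Set C2) : Prop :=
  IsCompact (closure A) ∧ closure A ⊆ B

/-- `‖G‖_S`, the supremum of the Euclidean norm of `G` over `S`, possibly `∞`. -/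
def supNormOn (S : Set C2) (G : C2 → C2) : ℝ≥0∞ :=
  ⨆ p ∈ S, ENNReal.ofReal ‖G p‖

/-- The affine map `Φ(x) = P + β x`. -/
def scaleTo (P : C2) (β : ℝ) (x : C2) : C2 := P + (β : ℂ) • x

/-- The inverse of `scaleTo P β`, for `β ≠ 0`. -/
def scaleFrom (P : C2) (β : ℝ) (y : C2) : C2 := (β : ℂ)⁻¹ • (y - P)

theorem scaleFrom_scaleTo (P : C2) {β : ℝ} (hβ : β ≠ 0) (x : C2) :
    scaleFrom P β (scaleTo P β x) = x := by
  have h : (β : ℂ) ≠ 0 := by exact_mod_cast hβ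
  rw [scaleFrom, scaleTo, add_sub_cancel_left, inv_smul_smul₀ h]

theorem scaleTo_scaleFrom (P : C2) {β : ℝ} (hβ : β ≠ 0) (y : C2) :
    scaleTo P β (scaleFrom P β y) = y := by
  have h : (β : ℂ) ≠ 0 := by exact_mod_cast hβ
  rw [scaleFrom, scaleTo, smul_inv_smul₀ h, add_sub_cancel]

/-- The product `d_s ⋯ d_1`. -/
def degProd (d : ℕ → ℕ) (s : ℕ) : ℕ := ∏ j ∈ Finset.Icc 1 s, d j

/-- The map `H_s(z, w) = ((a z)^{d_s} + a^{d_s ⋯ d_1} w, a^{d_s ⋯ d_1} z)`. -/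
def fornaessMap (a : ℝ) (d : ℕ → ℕ) (s : ℕ) (p : C2) : C2 :=
  !₂[((a : ℂ) * p 0) ^ d s + (a : ℂ) ^ degProd d s * p 1, (a : ℂ) ^ degProd d s * p 0]

end OscHenon

end

open OscHenon

open Filter Topology Asymptotics
open scoped ENNReal

open OscHenon

/-! The maps are built one return at a time. At each stage a small ball around `P n_k` follows an
orbit segment out of the disc of radius `R k`; the entire function is then prescribed freely on
discs outside that disc, so as to bring the ball back near the saddle `0`, where its image is the
required copy of `H`, and to send it out again.

The algebraic reason this works is time reversal (`henonMap_smul_swap_henonMap`): up to swapping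
coordinates and a factor `a ^ 2`, a Hénon map with the same `a` and a rescaled function undoes a
given one. Where the function is constant, displacements are just swapped and multiplied by `a`. If
successive first coordinates lie in disjoint discs, the function can be chosen independently at
every step. So the distortion along the exit segment can be undone, the resulting multiple of the
identity contracted to the right size, one monomial inserted, and the inverse of the coming entry
segment applied in advance; the old map along that entry segment then leaves exactly `β' • H`
(`exists_relChain`, `exists_model`). Counting powers of `a` in this chain gives an equation solvable
only when the product of the degrees is odd, which is why odd degrees are used.

The entry segment is a backward orbit of a point `x` near `0` that leaves a large cylinder, and the
next exit segment is its forward orbit. Forward escape comes from the eigenvalue larger than `1` at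
`0`, backward escape from the constant Jacobian `-a ^ 2` of modulus less than `1`; the identity
theorem separates the two exit coordinates (`exists_two_sided_exit`).

The model function is only piecewise entire, on disjoint closed discs. A Runge theorem for compact
sets with connected complement (`IsFilled.entireApprox_inv`, `EntireApprox.union_closedBall`)
replaces it by an entire one, with interpolation along the orbit of the centre, so that this orbit
is kept exactly, and of the 1-jet at `0`. Continuity over finitely many steps (`exists_shadowing`)
turns all strict estimates into a stability radius `δ`. Later corrections are at most half the
current `δ`, and each new `δ` is at most half the old one, so everything obtained at a stage holds
for all later maps (`Stage.norm_f_sub_lt`). -/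

/-! ### Plane topology: removing closed discs from connected open sets -/

theorem isPreconnected_annulus (c : ℂ) {r r' : ℝ} (hr : 0 < r) :
    IsPreconnected (Metric.ball c r' \ Metric.closedBall c r) := by
  have h : Metric.ball c r' \ Metric.closedBall c r
      = (fun w => c + Complex.exp w) ''
        -- The condition `r < r'` makes the strip empty for negative `r'`, where `Real.log r'` is
        -- the logarithm of `|r'|`.
        {w : ℂ | Real.log r < w.re ∧ r < r' ∧ w.re < Real.log r'} := by
    ext z
    simp only [Set.mem_sdiff, Metric.mem_ball, Metric.mem_closedBall, not_le, Set.mem_image,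
      Set.mem_ofPred_eq, dist_eq_norm]
    constructor
    · rintro ⟨h1, h2⟩
      have hz : z - c ≠ 0 := norm_pos_iff.1 (hr.trans h2)
      refine ⟨Complex.log (z - c), ⟨?_, h2.trans h1, ?_⟩, by rw [Complex.exp_log hz]; ring⟩
      · rw [Complex.log_re]; exact Real.log_lt_log hr h2
      · rw [Complex.log_re]; exact Real.log_lt_log (hr.trans h2) h1
    · rintro ⟨w, ⟨h1, h2, h3⟩, rfl⟩
      rw [add_sub_cancel_left, Complex.norm_exp]
      exact ⟨(Real.lt_log_iff_exp_lt (hr.trans h2)).1 h3, (Real.log_lt_iff_lt_exp hr).1 h1⟩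
  rw [h]
  refine IsPreconnected.image ?_ _ (by fun_prop)
  apply Convex.isPreconnected
  have : {w : ℂ | Real.log r < w.re ∧ r < r' ∧ w.re < Real.log r'}
      = {w : ℂ | Real.log r < w.re} ∩ ({w : ℂ | r < r'} ∩ {w : ℂ | w.re < Real.log r'}) := rfl
  rw [this]
  refine (convex_halfSpace_re_gt _).inter (Convex.inter ?_ (convex_halfSpace_re_lt _))
  by_cases hh : r < r'
  · simp [hh, convex_univ]
  · simp [hh, convex_empty]

/-- In a separation of `U \ D` the preconnected collar `W \ D` lies on one side. Adding `D` back to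
that side, by means of `W`, would separate `U`. -/
theorem IsPreconnected.diff_of_annulus {X : Type*} [TopologicalSpace X] {U D W : Set X}
    (hU : IsPreconnected U) (hUo : IsOpen U) (hD : IsClosed D) (hW : IsOpen W) (hDW : D ⊆ W)
    (hWU : W ⊆ U) (hA : IsPreconnected (W \ D)) : IsPreconnected (U \ D) := by
  have hs : IsOpen (U \ D) := hUo.sdiff hD
  have key : ∀ u v : Set X, IsOpen u → IsOpen v → U \ D ⊆ u ∪ v → (U \ D ∩ v).Nonempty →
      (U \ D ∩ u).Nonempty → (U \ D) ∩ (u ∩ v) = ∅ → ¬ (W \ D ⊆ u) := by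
    intro u v hu hv huv hnv hnu he hWu
    obtain ⟨x, hx, hxu, hxv⟩ := hU (((U \ D) ∩ u) ∪ W) ((U \ D) ∩ v) ((hs.inter hu).union hW)
      (hs.inter hv)
      (by
        intro x hx
        by_cases hxD : x ∈ D
        · exact Or.inl (Or.inr (hDW hxD))
        · rcases huv ⟨hx, hxD⟩ with h | h
          · exact Or.inl (Or.inl ⟨⟨hx, hxD⟩, h⟩)
          · exact Or.inr ⟨⟨hx, hxD⟩, h⟩)
      (by obtain ⟨x, hx, hxu⟩ := hnu; exact ⟨x, hx.1, Or.inl ⟨hx, hxu⟩⟩)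
      (by obtain ⟨x, hx, hxv⟩ := hnv; exact ⟨x, hx.1, ⟨hx, hxv⟩⟩)
    have hmem : x ∈ (U \ D) ∩ (u ∩ v) := by
      refine ⟨hxv.1, ?_, hxv.2⟩
      rcases hxu with h | h
      · exact h.2
      · exact hWu ⟨h, hxv.1.2⟩
    rw [he] at hmem
    exact hmem
  intro u v hu hv huv hnu hnv
  by_contra hne
  have he := Set.not_nonempty_iff_eq_empty.1 hne
  have hWs : W \ D ⊆ U \ D := Set.sdiff_subset_sdiff_left hWU
  rcases (isPreconnected_iff_subset_of_disjoint.1 hA) u v hu hv (hWs.trans huv)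
    (by
      apply Set.eq_empty_of_subset_empty
      rw [← he]
      exact Set.inter_subset_inter_left _ hWs) with h | h
  · exact key u v hu hv huv hnv hnu he h
  · exact key v u hv hu (by rwa [Set.union_comm]) hnu hnv (by rwa [Set.inter_comm v u]) h

/-! ### Runge approximation on filled compact sets, with interpolation -/

/-- Compact plane sets with connected complement. -/
def IsFilled (K : Set ℂ) : Prop := IsCompact K ∧ IsPreconnected Kᶜ

/-- Uniform approximability on `K` by entire functions. -/
def EntireApprox (K : Set ℂ) (φ : ℂ → ℂ) : Prop :=
  ∀ η > 0, ∃ g : ℂ → ℂ, Differentiable ℂ g ∧ ∀ z ∈ K, ‖g z - φ z‖ ≤ η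

theorem exists_ball_disjoint {K : Set ℂ} (hK : IsCompact K) {c : ℂ} {r : ℝ}
    (hd : Disjoint K (Metric.closedBall c r)) : ∃ r' > r, ∀ z ∈ K, r' < ‖z - c‖ := by
  rcases K.eq_empty_or_nonempty with rfl | hne
  · exact ⟨r + 1, by linarith, by simp⟩
  obtain ⟨z₀, hz₀, hmin⟩ := hK.exists_isMinOn hne (f := fun z => ‖z - c‖) (by fun_prop)
  have h0 : r < ‖z₀ - c‖ := by
    by_contra h
    exact Set.disjoint_left.1 hd hz₀ (by simpa [dist_eq_norm] using not_lt.1 h)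
  obtain ⟨r', h1, h2⟩ := exists_between h0
  exact ⟨r', h1, fun z hz => h2.trans_le (hmin hz)⟩

theorem IsFilled.union_closedBall {K : Set ℂ} (hK : IsFilled K) {c : ℂ} {r : ℝ} (hr : 0 < r)
    (hd : Disjoint K (Metric.closedBall c r)) : IsFilled (K ∪ Metric.closedBall c r) := by
  refine ⟨hK.1.union (isCompact_closedBall c r), ?_⟩
  obtain ⟨r', hr', hKr⟩ := exists_ball_disjoint hK.1 hd
  rw [Set.compl_union, ← Set.sdiff_eq]
  refine hK.2.diff_of_annulus hK.1.isClosed.isOpen_compl Metric.isClosed_closedBall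
    (Metric.isOpen_ball (x := c) (ε := r')) (Metric.closedBall_subset_ball hr') ?_
    (isPreconnected_annulus c hr)
  intro z hz hzK
  have := hKr z hzK
  rw [Metric.mem_ball, dist_eq_norm] at hz
  linarith

theorem isFilled_closedBall (c : ℂ) {r : ℝ} (hr : 0 < r) : IsFilled (Metric.closedBall c r) := by
  have h : IsFilled (∅ : Set ℂ) := ⟨isCompact_empty, by simpa using isPreconnected_univ⟩
  simpa using h.union_closedBall hr (c := c) (by simp)

/-- On a filled compact set, the inverse of a zero-free polynomial is approximable. -/
theorem IsFilled.entireApprox_inv {K : Set ℂ} (hK : IsFilled K) (p : Polynomial ℂ)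
    (hp : ∀ z ∈ K, p.eval z ≠ 0) : EntireApprox K (fun z => (p.eval z)⁻¹) := by
  have : CompactSpace K := isCompact_iff_compactSpace.1 hK.1
  let X : C(K, ℂ) := Polynomial.toContinuousMapOn Polynomial.X K
  let S : Subalgebra ℂ C(K, ℂ) := (polynomialFunctions K).topologicalClosure
  have hX : X ∈ S := (polynomialFunctions K).le_topologicalClosure ⟨Polynomial.X, by simp; rfl⟩
  have hS : IsClosed (S : Set C(K, ℂ)) := (polynomialFunctions K).isClosed_topologicalClosure
  let x : S := ⟨X, hX⟩
  have hσA : spectrum ℂ (x : C(K, ℂ)) = K := by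
    rw [ContinuousMap.spectrum_eq_range]
    ext z
    simp [x, X]
  have hσ : spectrum ℂ x = K := by
    -- Passing to a closed subalgebra can only fill holes of the spectrum. Here there are none, so
    -- the coordinate function keeps spectrum `K` in the uniform closure of the polynomials, and `p`
    -- becomes invertible there.
    rw [Subalgebra.spectrum_eq_of_isPreconnected_compl S x (by rw [hσA]; exact hK.2), hσA]
  have hunit : IsUnit (Polynomial.aeval x p) := by
    by_contra h
    have h0 : (0 : ℂ) ∈ spectrum ℂ (Polynomial.aeval x p) := 
      spectrum.zero_mem_iff ℂ |>.2 h
    by_cases hdeg : 0 < p.degree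
    · rw [spectrum.map_polynomial_aeval_of_degree_pos x p hdeg] at h0
      obtain ⟨z, hz, hz0⟩ := h0
      exact hp z (hσ ▸ hz) hz0
    · rw [Polynomial.eq_C_of_degree_le_zero (not_lt.1 hdeg)] at h hp
      rcases K.eq_empty_or_nonempty with rfl | ⟨z, hz⟩
      · have : Subsingleton S := ⟨fun a b => Subtype.ext (ContinuousMap.ext fun y => y.2.elim)⟩
        exact h (isUnit_of_subsingleton _)
      · have := hp z hz
        rw [Polynomial.eval_C] at this
        refine h ?_
        rw [Polynomial.aeval_C]
        exact (IsUnit.mk0 _ this).map _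
  obtain ⟨q, hq⟩ := hunit.exists_right_inv
  have hqv : ∀ z : K, p.eval (z : ℂ) * (q : C(K, ℂ)) z = 1 := by
    intro z
    have h1 := congrArg (fun t : S => (t : C(K, ℂ)) z) hq
    have h2 : ((Polynomial.aeval x p : S) : C(K, ℂ)) z = p.eval (z : ℂ) := by
      have h3 : ((Polynomial.aeval x p : S) : C(K, ℂ)) = Polynomial.aeval X p := by
        rw [← Subalgebra.coe_val, ← Polynomial.aeval_algHom_apply]; rfl
      rw [h3, Polynomial.aeval_continuousMap_apply]
      simp [X]
    simpa [h2] using h1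
  intro η hη
  have hqS : (q : C(K, ℂ)) ∈ closure (polynomialFunctions K : Set C(K, ℂ)) := by
    have := q.2
    rwa [← SetLike.mem_coe, Subalgebra.topologicalClosure_coe] at this
  obtain ⟨g, hg, hgd⟩ := Metric.mem_closure_iff.1 hqS η hη
  obtain ⟨g', -, rfl⟩ := hg
  refine ⟨fun z => g'.eval z, g'.differentiable, fun z hz => ?_⟩
  have h1 := hqv ⟨z, hz⟩
  have h2 : (p.eval z)⁻¹ = (q : C(K, ℂ)) ⟨z, hz⟩ := inv_eq_of_mul_eq_one_right h1
  have h3 := (ContinuousMap.norm_coe_le_norm ((q : C(K, ℂ)) - Polynomial.toContinuousMapOn g' K)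
    ⟨z, hz⟩)
  change ‖g'.eval z - (p.eval z)⁻¹‖ ≤ η
  rw [h2, norm_sub_rev]
  refine le_trans h3 ?_
  rw [← dist_eq_norm]
  exact hgd.le

/-- With `r < s < r'` and `n` large, the polynomial `1 - ((z - c) / s) ^ n` is close to `1` on the
disc and huge on `K`. Its inverse is almost the indicator of the disc, and it is approximable
because the union is filled. -/
theorem IsFilled.exists_indicator {K : Set ℂ} (hK : IsFilled K) {c : ℂ} {r : ℝ} (hr : 0 < r)
    (hd : Disjoint K (Metric.closedBall c r)) {η : ℝ} (hη : 0 < η) :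
    ∃ e : ℂ → ℂ, Differentiable ℂ e ∧ (∀ z ∈ K, ‖e z‖ ≤ η) ∧
      ∀ z ∈ Metric.closedBall c r, ‖e z - 1‖ ≤ η := by
  obtain ⟨r', hr', hKr⟩ := exists_ball_disjoint hK.1 hd
  obtain ⟨s, hs1, hs2⟩ := exists_between hr'
  have hs0 : 0 < s := hr.trans hs1
  have hsc : (s : ℂ) ≠ 0 := by exact_mod_cast hs0.ne'
  set ε₀ : ℝ := min (1 / 2) (η / 4) with hε₀
  have hε₀pos : 0 < ε₀ := by positivity
  have ht0 : Tendsto (fun n : ℕ => (r / s) ^ n) atTop (𝓝 0) :=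
    tendsto_pow_atTop_nhds_zero_of_lt_one (by positivity) ((div_lt_one hs0).2 hs1)
  have ht1 : Tendsto (fun n : ℕ => (r' / s) ^ n) atTop atTop :=
    tendsto_pow_atTop_atTop_of_one_lt ((one_lt_div hs0).2 hs2)
  obtain ⟨n, hn0, hn1⟩ := ((ht0.eventually (ge_mem_nhds hε₀pos)).and
    (ht1.eventually (eventually_ge_atTop (1 + 2 / η)))).exists
  let p : Polynomial ℂ := 1 - (Polynomial.C (s : ℂ)⁻¹ * (Polynomial.X - Polynomial.C c)) ^ n
  have hp : ∀ z, p.eval z = 1 - ((s : ℂ)⁻¹ * (z - c)) ^ n := by intro z; simp [p]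
  have hw : ∀ z, ‖((s : ℂ)⁻¹ * (z - c)) ^ n‖ = (‖z - c‖ / s) ^ n := by
    intro z
    rw [norm_pow, norm_mul, norm_inv, Complex.norm_of_nonneg hs0.le]
    congr 1; field_simp
  have hD : ∀ z ∈ Metric.closedBall c r, ‖((s : ℂ)⁻¹ * (z - c)) ^ n‖ ≤ ε₀ := by
    intro z hz
    rw [hw]
    rw [Metric.mem_closedBall, dist_eq_norm] at hz
    exact le_trans (by gcongr) hn0
  have hK' : ∀ z ∈ K, 1 + 2 / η ≤ ‖((s : ℂ)⁻¹ * (z - c)) ^ n‖ := by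
    intro z hz
    rw [hw]
    refine hn1.trans ?_
    have := (hKr z hz).le
    have hr'0 : 0 ≤ r' / s := div_nonneg (hs0.trans hs2).le hs0.le
    gcongr
  have hDp : ∀ z ∈ Metric.closedBall c r, 1 / 2 ≤ ‖p.eval z‖ := by
    intro z hz
    have h1 := hD z hz
    have h2 : ε₀ ≤ 1 / 2 := min_le_left _ _
    have h3 := norm_sub_norm_le (1 : ℂ) (((s : ℂ)⁻¹ * (z - c)) ^ n)
    rw [norm_one] at h3
    rw [hp]; linarith
  have hKp : ∀ z ∈ K, 2 / η ≤ ‖p.eval z‖ := by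
    intro z hz
    have h1 := hK' z hz
    have h3 := norm_sub_norm_le (((s : ℂ)⁻¹ * (z - c)) ^ n) (1 : ℂ)
    rw [norm_one, norm_sub_rev] at h3
    rw [hp]; linarith
  obtain ⟨e, he, hea⟩ := (hK.union_closedBall hr hd).entireApprox_inv p (by
    rintro z (hz | hz) h0
    · have := hKp z hz
      rw [h0, norm_zero] at this
      have : 0 < 2 / η := by positivity
      linarith
    · have := hDp z hz
      rw [h0, norm_zero] at this
      linarith) (η / 2) (by positivity)
  refine ⟨e, he, fun z hz => ?_, fun z hz => ?_⟩
  · have h1 := hea z (Or.inl hz)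
    have h2 : ‖(p.eval z)⁻¹‖ ≤ η / 2 := by
      rw [norm_inv, ← inv_div]
      exact inv_anti₀ (by positivity) (hKp z hz)
    have h3 := norm_add_le (e z - (p.eval z)⁻¹) (p.eval z)⁻¹
    rw [sub_add_cancel] at h3
    linarith
  · have h1 := hea z (Or.inr hz)
    have hpz := hDp z hz
    have hne : p.eval z ≠ 0 := by intro h0; rw [h0, norm_zero] at hpz; linarith
    have h2 : ‖(p.eval z)⁻¹ - 1‖ ≤ η / 2 := by
      have : (p.eval z)⁻¹ - 1 = ((s : ℂ)⁻¹ * (z - c)) ^ n / p.eval z := by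
        rw [eq_div_iff hne, sub_mul, inv_mul_cancel₀ hne, one_mul, hp]; ring
      rw [this, norm_div, div_le_iff₀ (by linarith)]
      have h5 := hD z hz
      have h6 : ε₀ ≤ η / 4 := min_le_right _ _
      nlinarith
    have h3 := norm_add_le (e z - (p.eval z)⁻¹) ((p.eval z)⁻¹ - 1)
    rw [sub_add_sub_cancel] at h3
    linarith

/-- Two approximants are glued as `g₁ + e (g₂ - g₁)` with `e` an approximate indicator of the disc;
its tolerance is divided by a bound for `g₂ - g₁`. -/
theorem EntireApprox.union_closedBall {K : Set ℂ} {φ : ℂ → ℂ} (hφ : EntireApprox K φ)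
    (hK : IsFilled K) {c : ℂ} {r : ℝ} (hr : 0 < r) (hd : Disjoint K (Metric.closedBall c r))
    (hφ' : EntireApprox (Metric.closedBall c r) φ) :
    EntireApprox (K ∪ Metric.closedBall c r) φ := by
  intro η hη
  obtain ⟨g₁, hg₁, h₁⟩ := hφ (η / 2) (by positivity)
  obtain ⟨g₂, hg₂, h₂⟩ := hφ' (η / 2) (by positivity)
  obtain ⟨B, hB⟩ := (hK.1.union (isCompact_closedBall c r)).exists_bound_of_continuousOn
    (f := fun z => g₂ z - g₁ z) (hg₂.continuous.sub hg₁.continuous).continuousOn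
  obtain ⟨e, he, he₁, he₂⟩ := hK.exists_indicator hr hd
    (η := η / (2 * (|B| + 1))) (by positivity)
  have hprod : ∀ u v : ℂ, ‖u‖ ≤ η / (2 * (|B| + 1)) → ‖v‖ ≤ B → ‖u * v‖ ≤ η / 2 := by
    intro u v hu hv
    rw [norm_mul]
    calc ‖u‖ * ‖v‖ ≤ η / (2 * (|B| + 1)) * (|B| + 1) := by
          gcongr
          linarith [le_abs_self B]
      _ = η / 2 := by field_simp
  refine ⟨fun z => g₁ z + e z * (g₂ z - g₁ z), by fun_prop, ?_⟩
  rintro z (hz | hz)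
  · have h3 := hprod _ _ (he₁ z hz) (hB z (Or.inl hz))
    have h4 := norm_add_le (g₁ z - φ z) (e z * (g₂ z - g₁ z))
    have h5 := h₁ z hz
    rw [show g₁ z + e z * (g₂ z - g₁ z) - φ z = (g₁ z - φ z) + e z * (g₂ z - g₁ z) by ring]
    linarith
  · have h3 := hprod _ _ (he₂ z hz) (hB z (Or.inr hz))
    have h4 := norm_add_le (g₂ z - φ z) ((e z - 1) * (g₂ z - g₁ z))
    have h5 := h₂ z hz
    rw [show g₁ z + e z * (g₂ z - g₁ z) - φ z = (g₂ z - φ z) + (e z - 1) * (g₂ z - g₁ z) by ring]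
    linarith

theorem EntireApprox.of_eqOn {K : Set ℂ} {φ g : ℂ → ℂ} (hg : Differentiable ℂ g)
    (h : ∀ z ∈ K, φ z = g z) : EntireApprox K φ :=
  fun η hη => ⟨g, hg, fun z hz => by rw [h z hz, sub_self, norm_zero]; exact hη.le⟩

/-- Approximation with interpolation at finitely many points, and of the 1-jet at `0`. -/
theorem EntireApprox.exists_interpolating {K : Set ℂ} {φ f : ℂ → ℂ} (hφ : EntireApprox K φ)
    (hK : IsCompact K) (E : Finset ℂ) (hE : ↑E ⊆ K) {r : ℝ} (hr : 0 < r)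
    (hball : Metric.closedBall 0 r ⊆ K) (hf : Differentiable ℂ f)
    (hφf : ∀ z ∈ Metric.closedBall (0 : ℂ) r, φ z = f z) {η : ℝ} (hη : 0 < η) :
    ∃ g : ℂ → ℂ, Differentiable ℂ g ∧ (∀ z ∈ K, ‖g z - φ z‖ ≤ η) ∧ (∀ z ∈ E, g z = φ z) ∧
      g 0 = φ 0 ∧ deriv g 0 = deriv f 0 := by
  classical
  set E' : Finset ℂ := insert 0 E with hE'
  have h0E : (0 : ℂ) ∈ E' := Finset.mem_insert_self _ _
  have hE'K : ∀ z ∈ E', z ∈ K := by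
    intro z hz
    rcases Finset.mem_insert.1 hz with rfl | hz
    · exact hball (by simpa using hr.le)
    · exact hE hz
  let L : ℂ → ℂ → ℂ := fun e z => (Lagrange.basis E' id e).eval z
  have hLd : ∀ e, Differentiable ℂ (L e) := fun e => (Lagrange.basis E' id e).differentiable
  have hL1 : ∀ e ∈ E', L e e = 1 := fun e he =>
    Lagrange.eval_basis_self (v := id) Function.injective_id.injOn he
  have hL0 : ∀ e ∈ E', ∀ e' ∈ E', e ≠ e' → L e e' = 0 := fun e _ e' he' h =>
    Lagrange.eval_basis_of_ne (v := id) h he'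
  obtain ⟨M₁, hM₁⟩ := hK.exists_bound_of_continuousOn
    (f := fun z => ((∑ e ∈ E', ‖L e z‖ : ℝ) : ℂ))
    (Complex.continuous_ofReal.comp
      (continuous_finsetSum _ fun e _ => (hLd e).continuous.norm)).continuousOn
  -- `B` vanishes on all the nodes and has a simple zero at `0`, so a multiple of it adjusts the
  -- derivative at `0` without disturbing the values.
  let B : ℂ → ℂ := fun z => z * ∏ e ∈ E'.erase 0, (z - e)
  have hBd : Differentiable ℂ B := by
    have : Differentiable ℂ fun z : ℂ => ∏ e ∈ E'.erase 0, (z - e) := by fun_prop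
    exact differentiable_id.mul this
  have hB0 : ∀ e ∈ E', B e = 0 := by
    intro e he
    by_cases h : e = 0
    · simp [B, h]
    · simp only [B]
      rw [Finset.prod_eq_zero (Finset.mem_erase.2 ⟨h, he⟩) (sub_self e), mul_zero]
  set b : ℂ := ∏ e ∈ E'.erase 0, (0 - e) with hb
  have hb0 : b ≠ 0 := Finset.prod_ne_zero_iff.2 fun e he => by
    simpa using Finset.ne_of_mem_erase he
  have hBderiv : deriv B 0 = b := by
    have hd : DifferentiableAt ℂ (fun z : ℂ => ∏ e ∈ E'.erase 0, (z - e)) 0 := by fun_prop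
    have := (hasDerivAt_id (0 : ℂ)).mul hd.hasDerivAt
    have h' : HasDerivAt B _ 0 := this
    rw [h'.deriv, hb]
    simp
  obtain ⟨M₂, hM₂⟩ := hK.exists_bound_of_continuousOn hBd.continuous.continuousOn
  -- The first factor is the loss from the Lagrange correction. The second is the loss from the
  -- derivative correction, whose size the Cauchy estimate on the circle of radius `r` controls.
  set C : ℝ := (1 + |M₁|) * (1 + |M₂| / (r * ‖b‖)) with hC
  have hbpos : 0 < ‖b‖ := norm_pos_iff.2 hb0
  have hCpos : 0 < C := by positivity
  obtain ⟨g₀, hg₀, hg₀φ⟩ := hφ (η / C) (by positivity)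
  set η₀ := η / C
  have hη₀ : 0 < η₀ := by positivity
  let g₁ : ℂ → ℂ := fun z => g₀ z - ∑ e ∈ E', (g₀ e - φ e) * L e z
  have hg₁ : Differentiable ℂ g₁ := by
    have : Differentiable ℂ fun z => ∑ e ∈ E', (g₀ e - φ e) * L e z :=
      Differentiable.fun_sum fun e _ => (hLd e).const_mul _
    exact hg₀.sub this
  have hg₁φ : ∀ z ∈ K, ‖g₁ z - φ z‖ ≤ η₀ * (1 + |M₁|) := by
    intro z hz
    have h1 : ‖∑ e ∈ E', (g₀ e - φ e) * L e z‖ ≤ η₀ * |M₁| := by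
      refine (norm_sum_le _ _).trans ?_
      calc ∑ e ∈ E', ‖(g₀ e - φ e) * L e z‖ ≤ ∑ e ∈ E', η₀ * ‖L e z‖ := by
            refine Finset.sum_le_sum fun e he => ?_
            rw [norm_mul]
            exact mul_le_mul_of_nonneg_right (hg₀φ e (hE'K e he)) (norm_nonneg _)
        _ = η₀ * ∑ e ∈ E', ‖L e z‖ := by rw [Finset.mul_sum]
        _ ≤ η₀ * |M₁| := by
            have := hM₁ z hz
            rw [Complex.norm_real, Real.norm_eq_abs] at this
            have h2 := le_abs_self (∑ e ∈ E', ‖L e z‖)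
            have h3 := le_abs_self M₁
            gcongr
            linarith
    have h2 := norm_sub_le (g₀ z - φ z) (∑ e ∈ E', (g₀ e - φ e) * L e z)
    have h3 := hg₀φ z hz
    rw [show g₁ z - φ z = g₀ z - φ z - ∑ e ∈ E', (g₀ e - φ e) * L e z by simp only [g₁]; ring]
    linarith
  have hg₁E : ∀ e ∈ E', g₁ e = φ e := by
    intro e he
    simp only [g₁]
    rw [Finset.sum_eq_single e (fun e' he' h => by rw [hL0 e' he' e he h, mul_zero])
      (fun h => absurd he h), hL1 e he]
    ring
  have hder : ‖deriv (fun z => g₁ z - f z) 0‖ ≤ η₀ * (1 + |M₁|) / r := by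
    refine Complex.norm_deriv_le_of_forall_mem_sphere_norm_le hr
      (hg₁.sub hf).diffContOnCl fun z hz => ?_
    have hz' := Metric.sphere_subset_closedBall hz
    rw [← hφf z hz']
    exact hg₁φ z (hball hz')
  have hder' : deriv (fun z => g₁ z - f z) 0 = deriv g₁ 0 - deriv f 0 :=
    deriv_fun_sub (hg₁ 0) (hf 0)
  rw [hder'] at hder
  set t := deriv g₁ 0 - deriv f 0 with ht
  refine ⟨fun z => g₁ z - t / b * B z, hg₁.sub (hBd.const_mul _), fun z hz => ?_, fun e he => ?_,
    ?_, ?_⟩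
  · have h1 := hg₁φ z hz
    have h2 : ‖t / b * B z‖ ≤ η₀ * (1 + |M₁|) / r / ‖b‖ * |M₂| := by
      rw [norm_mul, norm_div]
      gcongr
      exact (hM₂ z hz).trans (le_abs_self _)
    have h3 := norm_sub_le (g₁ z - φ z) (t / b * B z)
    rw [show g₁ z - t / b * B z - φ z = g₁ z - φ z - t / b * B z by ring]
    have h4 : η₀ * (1 + |M₁|) + η₀ * (1 + |M₁|) / r / ‖b‖ * |M₂| = η₀ * C := by
      rw [hC]; field_simp
    have h5 : η₀ * C = η := by simp only [η₀]; field_simp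
    linarith
  · have he' : e ∈ E' := Finset.mem_insert_of_mem he
    simp only
    rw [hB0 e he', hg₁E e he']; ring
  · simp only
    rw [hB0 0 h0E, hg₁E 0 h0E]; ring
  · rw [deriv_fun_sub (hg₁ 0) ((hBd 0).const_mul _), deriv_const_mul _ (hBd 0), hBderiv, ht]
    field_simp
    ring

/-! ### Coordinates on `ℂ²`, Hénon maps and the maps `H_s` -/

theorem C2.ext {p q : C2} (h0 : p 0 = q 0) (h1 : p 1 = q 1) : p = q := by
  ext i; fin_cases i <;> assumption

theorem C2.norm_sq (p : C2) : ‖p‖ ^ 2 = ‖p 0‖ ^ 2 + ‖p 1‖ ^ 2 := by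
  rw [EuclideanSpace.norm_sq_eq, Fin.sum_univ_two]

theorem C2.norm_apply_le (p : C2) (i : Fin 2) : ‖p i‖ ≤ ‖p‖ := PiLp.norm_apply_le p i

theorem C2.norm_le_add (p : C2) : ‖p‖ ≤ ‖p 0‖ + ‖p 1‖ := by
  have h := C2.norm_sq p
  nlinarith [norm_nonneg p, norm_nonneg (p 0), norm_nonneg (p 1)]

theorem C2.differentiable_mk {E : Type*} [NormedAddCommGroup E] [NormedSpace ℂ E] {g h : E → ℂ}
    (hg : Differentiable ℂ g) (hh : Differentiable ℂ h) :
    Differentiable ℂ fun x => (!₂[g x, h x] : C2) := by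
  rw [differentiable_euclidean]
  intro i; fin_cases i <;> assumption

theorem C2.differentiable_apply (i : Fin 2) : Differentiable ℂ fun p : C2 => p i := by
  fun_prop

theorem Differentiable.div_complex_const {E : Type*} [NormedAddCommGroup E] [NormedSpace ℂ E]
    {g : E → ℂ} (hg : Differentiable ℂ g) (c : ℂ) : Differentiable ℂ fun x => g x / c := by
  simpa only [div_eq_mul_inv] using hg.mul_const _

/-- The coordinate swap `(z, w) ↦ (w, z)`. -/
def swap (p : C2) : C2 := !₂[p 1, p 0]

theorem swap_apply_zero (p : C2) : swap p 0 = p 1 := rfl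
theorem swap_apply_one (p : C2) : swap p 1 = p 0 := rfl

theorem norm_swap (p : C2) : ‖swap p‖ = ‖p‖ := by
  have h1 := C2.norm_sq p
  have h2 := C2.norm_sq (swap p)
  rw [swap_apply_zero, swap_apply_one] at h2
  exact (sq_eq_sq₀ (norm_nonneg _) (norm_nonneg _)).1 (by rw [h1, h2]; ring)

theorem henonMap_apply_zero (a : ℝ) (f : ℂ → ℂ) (p : C2) :
    henonMap a f p 0 = f (p 0) + a * p 1 := rfl

theorem henonMap_apply_one (a : ℝ) (f : ℂ → ℂ) (p : C2) : henonMap a f p 1 = a * p 0 := rfl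

/-- The inverse of `henonMap a f`. -/
noncomputable def henonInv (a : ℝ) (f : ℂ → ℂ) (p : C2) : C2 :=
  !₂[p 1 / a, (p 0 - f (p 1 / a)) / a]

theorem henonInv_apply_zero (a : ℝ) (f : ℂ → ℂ) (p : C2) : henonInv a f p 0 = p 1 / a := rfl

theorem henonInv_apply_one (a : ℝ) (f : ℂ → ℂ) (p : C2) :
    henonInv a f p 1 = (p 0 - f (p 1 / a)) / a := rfl

theorem henonInv_henonMap {a : ℝ} (ha : a ≠ 0) (f : ℂ → ℂ) (p : C2) :
    henonInv a f (henonMap a f p) = p := by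
  have ha' : (a : ℂ) ≠ 0 := by exact_mod_cast ha
  have h : (a : ℂ) * p 0 / a = p 0 := by field_simp
  apply C2.ext
  · rw [henonInv_apply_zero, henonMap_apply_one, h]
  · rw [henonInv_apply_one, henonMap_apply_one, henonMap_apply_zero, h]; field_simp; ring

theorem henonMap_henonInv {a : ℝ} (ha : a ≠ 0) (f : ℂ → ℂ) (p : C2) :
    henonMap a f (henonInv a f p) = p := by
  have ha' : (a : ℂ) ≠ 0 := by exact_mod_cast ha
  apply C2.ext
  · rw [henonMap_apply_zero, henonInv_apply_one, henonInv_apply_zero]; field_simp; ring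
  · rw [henonMap_apply_one, henonInv_apply_zero]; field_simp

theorem differentiable_henonMap (a : ℝ) {f : ℂ → ℂ} (hf : Differentiable ℂ f) :
    Differentiable ℂ (henonMap a f) :=
  C2.differentiable_mk
    ((hf.comp (C2.differentiable_apply 0)).add ((C2.differentiable_apply 1).const_mul _))
    ((C2.differentiable_apply 0).const_mul _)

theorem differentiable_henonInv (a : ℝ) {f : ℂ → ℂ} (hf : Differentiable ℂ f) :
    Differentiable ℂ (henonInv a f) := by
  have h : Differentiable ℂ fun p : C2 => p 1 / (a : ℂ) := 
    (C2.differentiable_apply 1).div_complex_const _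
  exact C2.differentiable_mk h
    (((C2.differentiable_apply 0).sub (hf.comp h)).div_complex_const _)

theorem isHolAut_henonMap {a : ℝ} (ha : a ≠ 0) {f : ℂ → ℂ} (hf : Differentiable ℂ f) :
    IsHolAut (henonMap a f) :=
  ⟨differentiable_henonMap a hf, henonInv a f, differentiable_henonInv a hf,
    henonInv_henonMap ha f, henonMap_henonInv ha f⟩

theorem norm_henonMap_sub (a : ℝ) (f g : ℂ → ℂ) (p : C2) :
    ‖henonMap a f p - henonMap a g p‖ = ‖f (p 0) - g (p 0)‖ := by
  have h := C2.norm_sq (henonMap a f p - henonMap a g p)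
  rw [PiLp.sub_apply, PiLp.sub_apply, henonMap_apply_zero, henonMap_apply_zero, henonMap_apply_one,
    henonMap_apply_one, add_sub_add_right_eq_sub, sub_self, norm_zero] at h
  exact (sq_eq_sq₀ (norm_nonneg _) (norm_nonneg _)).1 (by rw [h]; ring)

theorem relCompactIn_image_ball {G : C2 → C2} (hG : Continuous G) {P Q : C2} {r s : ℝ}
    (h : ∀ x ∈ Metric.closedBall P r, G x ∈ Metric.ball Q s) :
    RelCompactIn (G '' Metric.ball P r) (Metric.ball Q s) := by
  have hc : IsCompact (G '' Metric.closedBall P r) := (isCompact_closedBall P r).image hG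
  have hsub : closure (G '' Metric.ball P r) ⊆ G '' Metric.closedBall P r :=
    closure_minimal (Set.image_mono Metric.ball_subset_closedBall) hc.isClosed
  exact ⟨hc.of_isClosed_subset isClosed_closure hsub,
    hsub.trans (Set.image_subset_iff.2 h)⟩

theorem isHolAut_fornaessMap {a : ℝ} (ha : a ≠ 0) (d : ℕ → ℕ) (s : ℕ) :
    IsHolAut (fornaessMap a d s) := by
  have ha' : (a : ℂ) ≠ 0 := by exact_mod_cast ha
  have hA : (a : ℂ) ^ degProd d s ≠ 0 := pow_ne_zero _ ha'
  set A := (a : ℂ) ^ degProd d s with hAdef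
  have hz : Differentiable ℂ fun p : C2 => p 1 / A := 
    (C2.differentiable_apply 1).div_complex_const _
  refine ⟨C2.differentiable_mk ((((C2.differentiable_apply 0).const_mul _).pow _).add
    ((C2.differentiable_apply 1).const_mul _)) ((C2.differentiable_apply 0).const_mul _),
    fun p => !₂[p 1 / A, (p 0 - ((a : ℂ) * (p 1 / A)) ^ d s) / A],
    C2.differentiable_mk hz
      (((C2.differentiable_apply 0).sub ((hz.const_mul _).pow _)).div_complex_const _), ?_, ?_⟩
  · intro p
    have h0 : fornaessMap a d s p 0 = ((a : ℂ) * p 0) ^ d s + A * p 1 := rfl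
    have h1 : fornaessMap a d s p 1 = A * p 0 := rfl
    have h : A * p 0 / A = p 0 := by field_simp
    apply C2.ext
    · change fornaessMap a d s p 1 / A = p 0
      rw [h1, h]
    · change (fornaessMap a d s p 0 - ((a : ℂ) * (fornaessMap a d s p 1 / A)) ^ d s) / A = p 1
      rw [h0, h1, h]; field_simp; ring
  · intro p
    apply C2.ext
    · change ((a : ℂ) * (p 1 / A)) ^ d s + A * ((p 0 - ((a : ℂ) * (p 1 / A)) ^ d s) / A) = p 0
      rw [mul_div_cancel₀ _ hA]; ring
    · change A * (p 1 / A) = p 1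
      rw [mul_div_cancel₀ _ hA]

/-- Each of the three terms carries a power of `a` with exponent at least `3`, hence is at most `1 /
8`. The margin below `1` later absorbs the approximation error. -/
theorem norm_fornaessMap_le {a : ℝ} (ha0 : 0 < a) (ha : a ≤ 1 / 2) {d : ℕ → ℕ} {s : ℕ}
    (hd : 3 ≤ d s) (hD : 3 ≤ degProd d s) {x : C2} (hx : ‖x‖ ≤ 1) :
    ‖fornaessMap a d s x‖ ≤ 3 / 8 := by
  have hx0 := (C2.norm_apply_le x 0).trans hx
  have hx1 := (C2.norm_apply_le x 1).trans hx
  have hpow : ∀ m : ℕ, 3 ≤ m → a ^ m ≤ 1 / 8 := fun m hm => by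
    calc a ^ m ≤ (1 / 2) ^ m := by gcongr
      _ ≤ (1 / 2) ^ 3 := pow_le_pow_of_le_one (by norm_num) (by norm_num) hm
      _ = 1 / 8 := by norm_num
  have hn : ∀ m : ℕ, ‖(a : ℂ) ^ m‖ = a ^ m := fun m => by
    rw [norm_pow, Complex.norm_of_nonneg ha0.le]
  have h1 : ‖fornaessMap a d s x 1‖ ≤ 1 / 8 := by
    change ‖(a : ℂ) ^ degProd d s * x 0‖ ≤ 1 / 8
    rw [norm_mul, hn]
    have := hpow _ hD
    have := pow_pos ha0 (degProd d s)
    nlinarith [norm_nonneg (x 0)]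
  have h0 : ‖fornaessMap a d s x 0‖ ≤ 1 / 4 := by
    change ‖((a : ℂ) * x 0) ^ d s + (a : ℂ) ^ degProd d s * x 1‖ ≤ 1 / 4
    refine (norm_add_le _ _).trans ?_
    rw [mul_pow, norm_mul, norm_mul, hn, hn, norm_pow]
    have e1 := hpow _ hD
    have e2 := hpow _ hd
    have e3 := pow_pos ha0 (degProd d s)
    have e4 := pow_pos ha0 (d s)
    have e5 : ‖x 0‖ ^ d s ≤ 1 := pow_le_one₀ (norm_nonneg _) hx0
    have e6 : 0 ≤ ‖x 0‖ ^ d s := by positivity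
    nlinarith [norm_nonneg (x 1)]
  linarith [C2.norm_le_add (fornaessMap a d s x)]

theorem isBigO_sub_id_sq {f : ℂ → ℂ} (hf : Differentiable ℂ f) (h0 : f 0 = 0)
    (h1 : deriv f 0 = 1) : (fun z : ℂ => f z - z) =O[𝓝 0] (fun z : ℂ => z ^ 2) := by
  obtain ⟨p, hp⟩ := hf.analyticAt 0
  have h := hp.isBigO_sub_partialSum_pow 2
  have hps : ∀ y : ℂ, p.partialSum 2 y = y := by
    intro y
    have hc0 : p.coeff 0 = 0 := by rw [← h0]; exact hp.coeff_zero _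
    have hc1 : p.coeff 1 = 1 := by rw [← h1]; exact hp.deriv.symm
    rw [FormalMultilinearSeries.partialSum]
    simp [Finset.sum_range_succ, hc0, hc1]
  refine (h.congr (fun y => ?_) (fun y => rfl)).trans ?_
  · rw [zero_add, hps]
  · refine IsBigO.of_bound 1 (Eventually.of_forall fun y => ?_)
    simp

/-- Compactness keeps the inequality strict: the supremum is attained. -/
theorem supNormOn_lt_of_forall {S : Set C2} (hS : IsCompact S) {G : C2 → C2} (hG : Continuous G)
    {c : ℝ} (hc : 0 < c) (h : ∀ p ∈ S, ‖G p‖ < c) : supNormOn S G < ENNReal.ofReal c := by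
  rcases S.eq_empty_or_nonempty with rfl | hne
  · simpa [supNormOn] using hc
  obtain ⟨p₀, hp₀, hmax⟩ := hS.exists_isMaxOn hne (f := fun p => ‖G p‖) hG.norm.continuousOn
  refine lt_of_le_of_lt (iSup₂_le fun p hp => ENNReal.ofReal_le_ofReal (hmax hp)) ?_
  exact (ENNReal.ofReal_lt_ofReal_iff hc).2 (h p₀ hp₀)

/-! ### Derivatives of Hénon iterates and escape from the saddle -/

theorem exists_hasFDerivAt_henonMap (a : ℝ) {f : ℂ → ℂ} (hf : Differentiable ℂ f) (p : C2) :
    ∃ A : C2 →L[ℂ] C2, HasFDerivAt (henonMap a f) A p ∧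
      ∀ u, A u 0 = deriv f (p 0) * u 0 + a * u 1 ∧ A u 1 = a * u 0 := by
  have hA := (differentiable_henonMap a hf p).hasFDerivAt
  set A := fderiv ℂ (henonMap a f) p
  refine ⟨A, hA, fun u => ?_⟩
  have hline : HasDerivAt (fun t : ℂ => p + t • u) u 0 := by
    simpa using ((hasDerivAt_id (0 : ℂ)).smul_const u).const_add p
  have h1 : HasDerivAt (fun t : ℂ => henonMap a f (p + t • u)) (A u) 0 := by
    have h : HasFDerivAt (henonMap a f) A (p + (0 : ℂ) • u) := by simpa using hA
    exact h.comp_hasDerivAt 0 hline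
  have hc : ∀ i, HasDerivAt (fun t : ℂ => henonMap a f (p + t • u) i) (A u i) 0 := fun i =>
    (EuclideanSpace.proj (𝕜 := ℂ) i : C2 →L[ℂ] ℂ).hasFDerivAt.comp_hasDerivAt 0 h1
  have hl : ∀ i, HasDerivAt (fun t : ℂ => (p + t • u) i) (u i) 0 := fun i =>
    (EuclideanSpace.proj (𝕜 := ℂ) i : C2 →L[ℂ] ℂ).hasFDerivAt.comp_hasDerivAt 0 hline
  constructor
  · have hfd : HasDerivAt f (deriv f (p 0)) ((p + (0 : ℂ) • u) 0) := by
      simpa using (hf (p 0)).hasDerivAt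
    exact (hc 0).unique ((HasDerivAt.comp (h₂ := f) (h := fun t : ℂ => (p + t • u) 0) 0 hfd
      (hl 0)).add ((hl 1).const_mul (a : ℂ)))
  · exact (hc 1).unique ((hl 0).const_mul (a : ℂ))

/-- The expanding eigenvalue at the saddle `0`. -/
noncomputable def unstableEigenvalue (a : ℝ) : ℝ := (1 + Real.sqrt (1 + 4 * a ^ 2)) / 2

theorem one_lt_unstableEigenvalue {a : ℝ} (ha : 0 < a) : 1 < unstableEigenvalue a := by
  have : 1 < Real.sqrt (1 + 4 * a ^ 2) := Real.lt_sqrt_of_sq_lt (by nlinarith)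
  unfold unstableEigenvalue; linarith

theorem unstableEigenvalue_sq (a : ℝ) :
    unstableEigenvalue a ^ 2 = unstableEigenvalue a + a ^ 2 := by
  have := Real.sq_sqrt (show 0 ≤ 1 + 4 * a ^ 2 by positivity)
  unfold unstableEigenvalue; linear_combination this / 4

/-- The unstable direction at the saddle `0`. -/
noncomputable def unstableVector (a : ℝ) : C2 := !₂[(unstableEigenvalue a : ℂ), (a : ℂ)]

theorem unstableVector_apply_zero (a : ℝ) : unstableVector a 0 = unstableEigenvalue a := rfl

theorem henonMap_zero (a : ℝ) {f : ℂ → ℂ} (h0 : f 0 = 0) : henonMap a f 0 = 0 := by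
  apply C2.ext
  · rw [henonMap_apply_zero]; simp [h0]
  · rw [henonMap_apply_one]; simp

/-- The unstable vector is an eigenvector of the differential at `0`, because `λ ^ 2 = λ + a ^ 2`.
The exponent is `j + 1` since its own first coordinate is `λ`. -/
theorem hasDerivAt_iterate_henonMap (a : ℝ) {f : ℂ → ℂ} (hf : Differentiable ℂ f) (h0 : f 0 = 0)
    (h1 : deriv f 0 = 1) (j : ℕ) :
    HasDerivAt (fun t : ℂ => ((henonMap a f)^[j] (t • unstableVector a)) 0)
      ((unstableEigenvalue a : ℂ) ^ (j + 1)) 0 := by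
  obtain ⟨A, hA, hA'⟩ := exists_hasFDerivAt_henonMap a hf 0
  have hAv : A (unstableVector a) = (unstableEigenvalue a : ℂ) • unstableVector a := by
    apply C2.ext
    · rw [(hA' _).1]
      have : (unstableEigenvalue a : ℂ) ^ 2 = unstableEigenvalue a + a ^ 2 := by
        exact_mod_cast unstableEigenvalue_sq a
      simp only [PiLp.zero_apply, h1, PiLp.smul_apply, smul_eq_mul, unstableVector_apply_zero]
      change 1 * (unstableEigenvalue a : ℂ) + a * (a : ℂ) = _
      linear_combination -this
    · rw [(hA' _).2]
      change (a : ℂ) * unstableEigenvalue a = unstableEigenvalue a * (a : ℂ)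
      ring
  have hpow : (A ^ j) (unstableVector a) = (unstableEigenvalue a : ℂ) ^ j • unstableVector a := by
    induction j with
    | zero => simp
    | succ j ih =>
      rw [pow_succ', mul_apply_eq_comp, ih, map_smul, hAv, smul_smul, pow_succ]
  have hit : HasFDerivAt (henonMap a f)^[j] (A ^ j) 0 := hA.iterate (henonMap_zero a h0) j
  have hline : HasDerivAt (fun t : ℂ => t • unstableVector a) (unstableVector a) 0 := by
    simpa using (hasDerivAt_id (0 : ℂ)).smul_const (unstableVector a)
  have h2 : HasDerivAt (fun t : ℂ => (henonMap a f)^[j] (t • unstableVector a))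
      ((A ^ j) (unstableVector a)) 0 := by
    have h : HasFDerivAt (henonMap a f)^[j] (A ^ j) ((0 : ℂ) • unstableVector a) := by
      simpa using hit
    exact h.comp_hasDerivAt 0 hline
  have h3 := (EuclideanSpace.proj (𝕜 := ℂ) (0 : Fin 2) :
    C2 →L[ℂ] ℂ).hasFDerivAt.comp_hasDerivAt 0 h2
  convert! h3 using 1
  rw [hpow]
  change _ = (unstableEigenvalue a : ℂ) ^ j * (unstableEigenvalue a : ℂ)
  rw [pow_succ]

/-- If all iterates of the ball stayed in the cylinder, Cauchy's estimate along the unstable line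
would bound `λ ^ (j + 1)` uniformly in `j`, although `λ > 1`. -/
theorem exists_forward_exit {a : ℝ} (ha : 0 < a) {f : ℂ → ℂ} (hf : Differentiable ℂ f)
    (h0 : f 0 = 0) (h1 : deriv f 0 = 1) {r : ℝ} (hr : 0 < r) (ρ : ℝ) :
    ∃ j, ∃ x ∈ Metric.ball (0 : C2) r, ρ < ‖(henonMap a f)^[j] x 0‖ := by
  by_contra hcon
  push Not at hcon
  set v := unstableVector a
  set s : ℝ := r / (2 * (‖v‖ + 1)) with hs
  have hs0 : 0 < s := by positivity
  have hsv : s * ‖v‖ < r := by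
    rw [hs, div_mul_eq_mul_div, div_lt_iff₀ (by positivity)]
    nlinarith [norm_nonneg v]
  have hl := one_lt_unstableEigenvalue ha
  have hbound : ∀ j : ℕ, unstableEigenvalue a ^ (j + 1) ≤ ρ / s := by
    intro j
    have hd := hasDerivAt_iterate_henonMap a hf h0 h1 j
    have hdiff : Differentiable ℂ (fun t : ℂ => ((henonMap a f)^[j] (t • v)) 0) :=
      (C2.differentiable_apply 0).comp
        (((differentiable_henonMap a hf).iterate j).comp (differentiable_id.smul_const v))
    have hb := Complex.norm_deriv_le_of_forall_mem_sphere_norm_le (c := 0) (C := ρ) hs0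
      hdiff.diffContOnCl (by
        intro t ht
        refine hcon j _ ?_
        rw [mem_ball_zero_iff, norm_smul]
        rw [mem_sphere_zero_iff_norm] at ht
        rwa [ht])
    rw [hd.deriv, norm_pow, Complex.norm_of_nonneg (by linarith)] at hb
    exact hb
  obtain ⟨n, hn⟩ := pow_unbounded_of_one_lt (ρ / s) hl
  have h2 := hbound n
  have h3 : unstableEigenvalue a ^ n ≤ unstableEigenvalue a ^ (n + 1) :=
    pow_le_pow_right₀ hl.le (Nat.le_succ n)
  linarith

/-- The complex area form on `ℂ²`. -/
def areaForm (u v : C2) : ℂ := u 0 * v 1 - u 1 * v 0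

theorem norm_areaForm_le (u v : C2) : ‖areaForm u v‖ ≤ 2 * (‖u‖ * ‖v‖) := by
  unfold areaForm
  refine (norm_sub_le _ _).trans ?_
  rw [norm_mul, norm_mul, two_mul]
  gcongr <;> exact C2.norm_apply_le _ _

/-- Each Hénon map has constant Jacobian `-a ^ 2`, whatever `f` is. -/
theorem exists_hasFDerivAt_iterate_henonInv {a : ℝ} (ha : a ≠ 0) {f : ℂ → ℂ}
    (hf : Differentiable ℂ f) (i : ℕ) (x : C2) :
    ∃ B : C2 →L[ℂ] C2, HasFDerivAt (henonInv a f)^[i] B x ∧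
      ∀ u v, areaForm u v = (-(a : ℂ) ^ 2) ^ i * areaForm (B u) (B v) := by
  induction i generalizing x with
  | zero => exact ⟨ContinuousLinearMap.id ℂ C2, hasFDerivAt_id x, by simp⟩
  | succ i ih =>
    obtain ⟨B, hB, hBω⟩ := ih (henonInv a f x)
    have hC := (differentiable_henonInv a hf x).hasFDerivAt
    set C := fderiv ℂ (henonInv a f) x
    obtain ⟨A, hA, hA'⟩ := exists_hasFDerivAt_henonMap a hf (henonInv a f x)
    have hid : A.comp C = ContinuousLinearMap.id ℂ C2 := by
      have h := hA.comp x hC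
      have he : henonMap a f ∘ henonInv a f = id := funext (henonMap_henonInv ha f)
      rw [he] at h
      exact h.unique (hasFDerivAt_id x)
    have hAω : ∀ u v, areaForm (A u) (A v) = -(a : ℂ) ^ 2 * areaForm u v := by
      intro u v
      unfold areaForm
      rw [(hA' u).1, (hA' u).2, (hA' v).1, (hA' v).2]; ring
    refine ⟨B.comp C, by rw [Function.iterate_succ]; exact hB.comp x hC, fun u v => ?_⟩
    have hu : ∀ u, A (C u) = u := fun u => by
      rw [← ContinuousLinearMap.comp_apply, hid]; rfl
    rw [ContinuousLinearMap.comp_apply, ContinuousLinearMap.comp_apply, pow_succ', mul_assoc,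
      ← hBω, ← hAω, hu, hu]

/-- If the backward iterates of `U` stayed in the cylinder, Cauchy's estimates would bound their
differentials, hence their Jacobians. These have modulus `a ^ (-2 i)`, which is unbounded. -/
theorem exists_backward_exit {a : ℝ} (ha : 0 < a) (ha1 : a < 1) {f : ℂ → ℂ}
    (hf : Differentiable ℂ f) {U : Set C2} (hU : IsOpen U) (hne : U.Nonempty) (ρ : ℝ) :
    ∃ i, ∃ x ∈ U, ρ < ‖(henonInv a f)^[i] x 0‖ := by
  by_contra hcon
  push Not at hcon
  obtain ⟨x₀, hx₀⟩ := hne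
  obtain ⟨r, hr, hball⟩ := Metric.isOpen_iff.1 hU x₀ hx₀
  have hρ : 0 ≤ ρ := (norm_nonneg _).trans (hcon 0 x₀ hx₀)
  have hbd : ∀ i, ∀ x ∈ U, ‖(henonInv a f)^[i] x‖ ≤ 2 * ρ := by
    intro i x hx
    have h1 := hcon i x hx
    have h2 := hcon (i + 1) x hx
    -- The second coordinate is `a` times the first coordinate one step further back, so a bound on
    -- first coordinates bounds both.
    have h3 : (henonInv a f)^[i] x 1 = a * (henonInv a f)^[i + 1] x 0 := by
      rw [Function.iterate_succ_apply', ← henonMap_apply_one a f, henonMap_henonInv ha.ne']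
    have h4 := C2.norm_le_add ((henonInv a f)^[i] x)
    rw [h3, norm_mul, Complex.norm_of_nonneg ha.le] at h4
    nlinarith
  have hder : ∀ i (B : C2 →L[ℂ] C2), HasFDerivAt (henonInv a f)^[i] B x₀ → ∀ u, ‖u‖ ≤ 1 →
      ‖B u‖ ≤ 2 * ρ / (r / 2) := by
    intro i B hB u hu
    have hline : HasDerivAt (fun t : ℂ => x₀ + t • u) u 0 := by
      simpa using ((hasDerivAt_id (0 : ℂ)).smul_const u).const_add x₀
    have h2 : HasDerivAt (fun t : ℂ => (henonInv a f)^[i] (x₀ + t • u)) (B u) 0 := by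
      have h : HasFDerivAt (henonInv a f)^[i] B (x₀ + (0 : ℂ) • u) := by simpa using hB
      exact h.comp_hasDerivAt 0 hline
    rw [← h2.deriv]
    have hdiff : Differentiable ℂ (fun t : ℂ => (henonInv a f)^[i] (x₀ + t • u)) :=
      ((differentiable_henonInv a hf).iterate i).comp
        ((differentiable_id.smul_const u).const_add x₀)
    refine Complex.norm_deriv_le_of_forall_mem_sphere_norm_le (by positivity)
      hdiff.diffContOnCl fun t ht => hbd i _ (hball ?_)
    rw [mem_sphere_zero_iff_norm] at ht
    rw [Metric.mem_ball, dist_eq_norm, add_sub_cancel_left, norm_smul, ht]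
    nlinarith [norm_nonneg u]
  set M := 2 * ρ / (r / 2) with hM
  have hM0 : 0 ≤ M := by positivity
  let e₀ : C2 := !₂[1, 0]
  let e₁ : C2 := !₂[0, 1]
  have hn0 : ‖e₀‖ ≤ 1 := by
    have := C2.norm_le_add e₀
    simpa [e₀] using this
  have hn1 : ‖e₁‖ ≤ 1 := by
    have := C2.norm_le_add e₁
    simpa [e₁] using this
  have he : areaForm e₀ e₁ = 1 := by simp [areaForm, e₀, e₁]
  have hle : ∀ i : ℕ, 1 ≤ (a ^ 2) ^ i * (2 * (M * M)) := by
    intro i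
    obtain ⟨B, hB, hω⟩ := exists_hasFDerivAt_iterate_henonInv ha.ne' hf i x₀
    have h1 := hω e₀ e₁
    rw [he] at h1
    have h2 := congrArg norm h1
    rw [norm_one, norm_mul, norm_pow, norm_neg, norm_pow, Complex.norm_of_nonneg ha.le] at h2
    rw [h2]
    have h3 := norm_areaForm_le (B e₀) (B e₁)
    have h4 := hder i B hB e₀ hn0
    have h5 := hder i B hB e₁ hn1
    have h6 : ‖B e₀‖ * ‖B e₁‖ ≤ M * M := by gcongr
    have h7 : 0 ≤ (a ^ 2) ^ i := by positivity
    exact mul_le_mul_of_nonneg_left (by linarith) h7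
  have ht : Tendsto (fun i : ℕ => (a ^ 2) ^ i * (2 * (M * M))) atTop (𝓝 0) := by
    have := (tendsto_pow_atTop_nhds_zero_of_lt_one (r := a ^ 2) (by positivity)
      (by nlinarith)).mul_const (2 * (M * M))
    simpa using this
  have := ge_of_tendsto' ht hle
  linarith

/-- Arbitrarily close to the saddle there is a point whose forward and backward orbits both leave
the cylinder of radius `ρ`, at different first coordinates. -/
theorem exists_two_sided_exit {a : ℝ} (ha : 0 < a) (ha1 : a < 1) {f : ℂ → ℂ}
    (hf : Differentiable ℂ f) (h0 : f 0 = 0) (h1 : deriv f 0 = 1) {r ρ : ℝ} (hr : 0 < r)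
    (hrρ : r ≤ ρ) :
    ∃ (x : C2) (l l' : ℕ), ‖x‖ < r ∧ 0 < l ∧ 0 < l' ∧
      (∀ i < l', ‖(henonMap a f)^[i] x 0‖ ≤ ρ) ∧
      ρ < ‖(henonMap a f)^[l'] x 0‖ ∧ ‖(henonMap a f)^[l'] x 0‖ < ρ + 1 ∧
      (∀ i < l, ‖(henonInv a f)^[i] x 0‖ ≤ ρ) ∧ ρ < ‖(henonInv a f)^[l] x 0‖ ∧
      (henonInv a f)^[l] x 0 ≠ (henonMap a f)^[l'] x 0 := by
  classical
  have hF := differentiable_henonMap a hf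
  have hG := differentiable_henonInv a hf
  have hcF : ∀ j, Continuous fun x => ‖(henonMap a f)^[j] x 0‖ := fun j =>
    ((C2.differentiable_apply 0).comp (hF.iterate j)).continuous.norm
  have hcG : ∀ j, Continuous fun x => ‖(henonInv a f)^[j] x 0‖ := fun j =>
    ((C2.differentiable_apply 0).comp (hG.iterate j)).continuous.norm
  have hex := exists_forward_exit ha hf h0 h1 hr ρ
  -- `j` is the first time at which any point of the ball escapes, so all points of the ball stay
  -- inside before it. The same minimality is used backward for the open set `U`.
  set j := Nat.find hex with hj
  obtain ⟨x₁, hx₁, hx₁ρ⟩ := Nat.find_spec hex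
  have hjmin : ∀ i < j, ∀ x ∈ Metric.ball (0 : C2) r, ‖(henonMap a f)^[i] x 0‖ ≤ ρ := by
    intro i hi x hx
    have := Nat.find_min hex hi
    push Not at this
    exact this x hx
  let U : Set C2 := Metric.ball 0 r ∩ {x | ρ < ‖(henonMap a f)^[j] x 0‖ ∧
    ‖(henonMap a f)^[j] x 0‖ < ρ + 1}
  have hUo : IsOpen U := Metric.isOpen_ball.inter
    ((isOpen_lt continuous_const (hcF j)).inter (isOpen_lt (hcF j) continuous_const))
  have hUne : U.Nonempty := by
    have hpre : IsPreconnected (Metric.ball (0 : C2) r) :=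
      ((convex_ball (0 : C2) r).isPreconnected)
    -- Since `0` is fixed, the intermediate value theorem yields points that have just escaped, with
    -- exit modulus below `ρ + 1`.
    have hz : ‖(henonMap a f)^[j] (0 : C2) 0‖ = 0 := by
      rw [Function.iterate_fixed (henonMap_zero a h0)]; simp
    obtain ⟨t, ht1, ht2⟩ := exists_between (lt_min hx₁ρ (lt_add_one ρ))
    obtain ⟨x, hx, hxt⟩ := hpre.intermediate_value (Metric.mem_ball_self hr) hx₁
      (hcF j).continuousOn (show t ∈ Set.Icc _ _ from
        ⟨by rw [hz]; linarith, (ht2.trans_le (min_le_left _ _)).le⟩)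
    have hxt' : ‖(henonMap a f)^[j] x 0‖ = t := hxt
    exact ⟨x, hx, by rw [Set.mem_ofPred_eq, hxt']; exact ⟨ht1, ht2.trans_le (min_le_right _ _)⟩⟩
  have hex' := exists_backward_exit ha ha1 hf hUo hUne ρ
  set i := Nat.find hex' with hi
  obtain ⟨x₂, hx₂, hx₂ρ⟩ := Nat.find_spec hex'
  have himin : ∀ i' < i, ∀ x ∈ U, ‖(henonInv a f)^[i'] x 0‖ ≤ ρ := by
    intro i' hi' x hx
    have := Nat.find_min hex' hi'
    push Not at this
    exact this x hx
  let V : Set C2 := U ∩ {x | ρ < ‖(henonInv a f)^[i] x 0‖}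
  have hVo : IsOpen V := hUo.inter (isOpen_lt continuous_const (hcG i))
  have hx₂V : x₂ ∈ V := ⟨hx₂, hx₂ρ⟩
  have hball : ∀ x ∈ Metric.ball (0 : C2) r, ‖x 0‖ < ρ := fun x hx =>
    ((C2.norm_apply_le x 0).trans_lt (mem_ball_zero_iff.1 hx)).trans_le hrρ
  have hjpos : 0 < j := by
    rcases Nat.eq_zero_or_pos j with h | h
    · have h2 := hx₂.2.1
      rw [h] at h2
      exact absurd (hball x₂ hx₂.1) (not_lt.2 h2.le)
    · exact h
  have hipos : 0 < i := by
    rcases Nat.eq_zero_or_pos i with h | h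
    · have h2 : ρ < ‖(henonInv a f)^[i] x₂ 0‖ := hx₂ρ
      rw [h] at h2
      exact absurd (hball x₂ hx₂.1) (not_lt.2 h2.le)
    · exact h
  have hdist : ∃ x ∈ V, (henonInv a f)^[i] x 0 ≠ (henonMap a f)^[j] x 0 := by
    by_contra hcon
    push Not at hcon
    -- Equality on the open set `V` spreads to every `y` by the identity theorem on the complex line
    -- through `x₂` and `y`. Then `j + i > 0` forward steps would preserve first coordinates,
    -- against the expansion at `0`.
    have hall : ∀ y, (henonInv a f)^[i] y 0 = (henonMap a f)^[j] y 0 := by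
      intro y
      let g : ℂ → ℂ := fun t => (henonInv a f)^[i] (x₂ + t • (y - x₂)) 0
        - (henonMap a f)^[j] (x₂ + t • (y - x₂)) 0
      have hline : Differentiable ℂ fun t : ℂ => x₂ + t • (y - x₂) :=
        (differentiable_id.smul_const _).const_add _
      have hg : Differentiable ℂ g :=
        ((C2.differentiable_apply 0).comp ((hG.iterate i).comp hline)).sub
          ((C2.differentiable_apply 0).comp ((hF.iterate j).comp hline))
      have hev : g =ᶠ[𝓝 0] 0 := by
        have : ∀ᶠ t : ℂ in 𝓝 0, x₂ + t • (y - x₂) ∈ V :=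
          hline.continuous.continuousAt.eventually (hVo.mem_nhds (by simpa using hx₂V))
        filter_upwards [this] with t ht
        simp only [g, Pi.zero_apply]
        rw [hcon _ ht, sub_self]
      have han : AnalyticOnNhd ℂ g Set.univ := fun t _ => hg.analyticAt t
      have := han.eqOn_zero_of_preconnected_of_eventuallyEq_zero isPreconnected_univ
        (Set.mem_univ 0) hev (Set.mem_univ 1)
      simp only [g, Pi.zero_apply, one_smul, add_sub_cancel] at this
      exact sub_eq_zero.1 this
    have hid : ∀ y, (henonMap a f)^[j + i] y 0 = y 0 := by
      intro y
      rw [Function.iterate_add_apply, ← hall,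
        Function.LeftInverse.iterate (henonInv_henonMap ha.ne' f) i y]
    have hd1 := hasDerivAt_iterate_henonMap a hf h0 h1 (j + i)
    have hd0 := hasDerivAt_iterate_henonMap a hf h0 h1 0
    have he : (fun t : ℂ => ((henonMap a f)^[j + i] (t • unstableVector a)) 0)
        = fun t : ℂ => ((henonMap a f)^[0] (t • unstableVector a)) 0 :=
      funext fun t => hid _
    rw [he] at hd1
    have h5 := hd1.unique hd0
    have h6 : unstableEigenvalue a ^ (j + i + 1) = unstableEigenvalue a ^ (0 + 1) := 
      Complex.ofReal_injective (by push_cast; exact h5)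
    have h7 : unstableEigenvalue a ^ (0 + 1) < unstableEigenvalue a ^ (j + i + 1) :=
      pow_lt_pow_right₀ (one_lt_unstableEigenvalue ha) (by omega)
    linarith
  obtain ⟨x, hxV, hxne⟩ := hdist
  exact ⟨x, i, j, mem_ball_zero_iff.1 hxV.1.1, hipos, hjpos, fun i' hi' => hjmin i' hi' x hxV.1.1,
    hxV.1.2.1, hxV.1.2.2, fun i' hi' => himin i' hi' x hxV.1, hxV.2, hxne⟩

/-! ### Chains of Hénon maps acting on displacements -/

theorem norm_ofReal_smul {c : ℝ} (hc : 0 ≤ c) (p : C2) : ‖(c : ℂ) • p‖ = c * ‖p‖ := by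
  rw [norm_smul, Complex.norm_of_nonneg hc]

theorem henonMap_const_zero (a : ℝ) (p : C2) : henonMap a (fun _ => 0) p = (a : ℂ) • swap p := by
  apply C2.ext
  · rw [henonMap_apply_zero, zero_add]; rfl
  · rfl

theorem swap_smul (c : ℂ) (p : C2) : swap (c • p) = c • swap p := by
  apply C2.ext <;> rfl

theorem swap_swap (p : C2) : swap (swap p) = p := by
  apply C2.ext <;> rfl

/-- Time reversal: up to swapping coordinates and scaling, a Hénon map undoes another one. -/
theorem henonMap_smul_swap_henonMap {a c : ℝ} (ha : a ≠ 0) (hc : c ≠ 0) (f : ℂ → ℂ) (p : C2) :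
    henonMap a (fun t => -(c * a : ℂ) * f (t / (c * a))) ((c : ℂ) • swap (henonMap a f p))
      = ((a ^ 2 * c : ℝ) : ℂ) • swap p := by
  have ha' : (a : ℂ) ≠ 0 := by exact_mod_cast ha
  have hc' : (c : ℂ) ≠ 0 := by exact_mod_cast hc
  apply C2.ext
  · rw [henonMap_apply_zero]
    simp only [PiLp.smul_apply, swap_apply_zero, swap_apply_one, henonMap_apply_zero,
      henonMap_apply_one, smul_eq_mul]
    rw [show (c : ℂ) * (a * p 0) / (c * a) = p 0 by field_simp]
    push_cast
    ring
  · rw [henonMap_apply_one]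
    simp only [PiLp.smul_apply, swap_apply_zero, swap_apply_one, henonMap_apply_one, smul_eq_mul]
    push_cast
    ring

/-- The map `A` is taken to `B` by `J` successive Hénon maps fixing `0`, with all intermediate
maps of norm less than `κ` on the closed unit ball. -/
def RelChain (a κ : ℝ) (J : ℕ) (A B : C2 → C2) : Prop :=
  ∃ (g : ℕ → ℂ → ℂ) (Y : ℕ → C2 → C2), (∀ j, Differentiable ℂ (g j) ∧ g j 0 = 0) ∧ Y 0 = A ∧
    Y J = B ∧ (∀ j < J, ∀ x, Y (j + 1) x = henonMap a (g j) (Y j x)) ∧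
    ∀ j ≤ J, ∀ x, ‖x‖ ≤ 1 → ‖Y j x‖ < κ

theorem RelChain.refl {a κ : ℝ} {A : C2 → C2} (hA : ∀ x, ‖x‖ ≤ 1 → ‖A x‖ < κ) :
    RelChain a κ 0 A A :=
  ⟨fun _ _ => 0, fun _ => A, fun _ => ⟨differentiable_const _, rfl⟩, rfl, rfl,
    fun j hj => absurd hj (Nat.not_lt_zero j), fun _ _ => hA⟩

theorem RelChain.single {a κ : ℝ} {A B : C2 → C2} {g : ℂ → ℂ} (hg : Differentiable ℂ g)
    (hg0 : g 0 = 0) (hAB : ∀ x, B x = henonMap a g (A x)) (hA : ∀ x, ‖x‖ ≤ 1 → ‖A x‖ < κ)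
    (hB : ∀ x, ‖x‖ ≤ 1 → ‖B x‖ < κ) : RelChain a κ 1 A B := by
  refine ⟨fun _ => g, fun j => if j = 0 then A else B, fun _ => ⟨hg, hg0⟩, rfl, rfl,
    fun j hj x => ?_, fun j _ x hx => ?_⟩
  · obtain rfl : j = 0 := by omega
    exact hAB x
  · by_cases h : j = 0
    · simpa [h] using hA x hx
    · simpa [h] using hB x hx

theorem RelChain.trans {a κ : ℝ} {J J' : ℕ} {A B C : C2 → C2} (h : RelChain a κ J A B)
    (h' : RelChain a κ J' B C) : RelChain a κ (J + J') A C := by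
  obtain ⟨g, Y, hg, hY0, hYJ, hY, hκ⟩ := h
  obtain ⟨g', Y', hg', hY0', hYJ', hY', hκ'⟩ := h'
  refine ⟨fun j => if j < J then g j else g' (j - J), fun j => if j < J then Y j else Y' (j - J),
    fun j => ?_, ?_, ?_, fun j hj x => ?_, fun j hj x hx => ?_⟩
  · by_cases hj : j < J
    · simpa [hj] using hg j
    · simpa [hj] using hg' (j - J)
  · by_cases hj : 0 < J
    · simpa [hj] using hY0
    · obtain rfl : J = 0 := by omega
      simp only [lt_irrefl, if_false, Nat.sub_self, hY0', ← hYJ, hY0]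
  · simpa using hYJ'
  · by_cases h1 : j + 1 < J
    · have h2 : j < J := by omega
      simp only [h1, h2, if_true]
      exact hY j h2 x
    · by_cases h2 : j < J
      · have h3 : j + 1 = J := by omega
        simp only [h2, if_true, h3, lt_irrefl, if_false, Nat.sub_self]
        rw [← hY j h2, h3, hYJ, hY0']
      · simp only [h1, h2, if_false]
        rw [show j + 1 - J = (j - J) + 1 by omega]
        exact hY' (j - J) (by omega) x
  · by_cases h1 : j < J
    · simpa only [h1, if_true] using hκ j h1.le x hx
    · simpa only [h1, if_false] using hκ' (j - J) (by omega) x hx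

theorem RelChain.zero_step {a κ : ℝ} (ha : 0 < a) (ha1 : a < 1) {A : C2 → C2}
    (hA : ∀ x, ‖x‖ ≤ 1 → ‖A x‖ < κ) : RelChain a κ 1 A (fun x => (a : ℂ) • swap (A x)) := by
  refine RelChain.single (differentiable_const 0) rfl
    (fun x => (henonMap_const_zero a _).symm) hA fun x hx => ?_
  rw [norm_ofReal_smul ha.le, norm_swap]
  have := hA x hx
  nlinarith [norm_nonneg (A x)]

/-- Two steps with the zero function swap twice and multiply by `a ^ 2`. These idle pairs adjust the
scale freely, but only by even powers of `a`. -/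
theorem RelChain.contract {a κ : ℝ} (ha : 0 < a) (ha1 : a < 1) (i : ℕ) {c : ℝ} (hc : 0 ≤ c)
    (hcκ : c < κ) :
    RelChain a κ (2 * i) (fun x => (c : ℂ) • x) (fun x => ((a ^ (2 * i) * c : ℝ) : ℂ) • x) := by
  have hbd : ∀ c' : ℝ, 0 ≤ c' → c' < κ → ∀ x : C2, ‖x‖ ≤ 1 → ‖(c' : ℂ) • x‖ < κ := by
    intro c' hc' hc'κ x hx
    rw [norm_ofReal_smul hc']
    nlinarith [norm_nonneg x]
  induction i with
  | zero =>
    have h := RelChain.refl (a := a) (A := fun x => (c : ℂ) • x) (hbd c hc hcκ)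
    simpa only [mul_zero, pow_zero, one_mul] using h
  | succ i ih =>
    have hp : a ^ (2 * i) * c < κ := by
      have : a ^ (2 * i) ≤ 1 := pow_le_one₀ ha.le ha1.le
      nlinarith
    have h1 := RelChain.zero_step ha ha1 (hbd _ (by positivity) hp)
    have h2 := h1.trans (RelChain.zero_step ha ha1 (A := fun x =>
      (a : ℂ) • swap (((a ^ (2 * i) * c : ℝ) : ℂ) • x)) fun x hx => by
        rw [norm_ofReal_smul ha.le, norm_swap]
        have := hbd _ (by positivity) hp x hx
        nlinarith [norm_nonneg (((a ^ (2 * i) * c : ℝ) : ℂ) • x)])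
    convert ih.trans h2 using 1
    · ring
    · funext x
      rw [swap_smul, swap_smul, swap_smul, swap_swap, smul_smul, smul_smul]
      congr 1
      push_cast
      ring

/-- The maps of the chain `W` are undone from the last to the first by time reversal, each at the
cost of a factor `a ^ 2`. -/
theorem RelChain.reverse {a κ : ℝ} (ha : 0 < a) (ha1 : a < 1) (T : ℕ) (W : ℕ → C2 → C2)
    (f : ℕ → ℂ → ℂ) (hf : ∀ i, Differentiable ℂ (f i) ∧ f i 0 = 0)
    (hW : ∀ i < T, ∀ x, W (i + 1) x = henonMap a (f i) (W i x)) {c : ℝ} (hc : 0 < c)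
    (hκ : ∀ i ≤ T, ∀ x, ‖x‖ ≤ 1 → c * ‖W i x‖ < κ) :
    RelChain a κ T (fun x => (c : ℂ) • swap (W T x))
      (fun x => ((a ^ (2 * T) * c : ℝ) : ℂ) • swap (W 0 x)) := by
  induction T generalizing c with
  | zero =>
    have h := RelChain.refl (a := a) (κ := κ) (A := fun x => (c : ℂ) • swap (W 0 x))
      fun x hx => by
        rw [norm_ofReal_smul hc.le, norm_swap]; exact hκ 0 le_rfl x hx
    simpa using h
  | succ T ih =>
    have hκ' : ∀ i ≤ T + 1, ∀ x, ‖x‖ ≤ 1 → a ^ 2 * c * ‖W i x‖ < κ := by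
      intro i hi x hx
      have h1 := hκ i hi x hx
      have h2 : a ^ 2 ≤ 1 := pow_le_one₀ ha.le ha1.le
      have h3 : 0 ≤ c * ‖W i x‖ := by positivity
      nlinarith
    have h1 : RelChain a κ 1 (fun x => (c : ℂ) • swap (W (T + 1) x))
        (fun x => ((a ^ 2 * c : ℝ) : ℂ) • swap (W T x)) := by
      refine RelChain.single (g := fun t => -(c * a : ℂ) * f T (t / (c * a))) ?_ ?_
        (fun x => ?_) (fun x hx => ?_) (fun x hx => ?_)
      · exact ((hf T).1.comp (differentiable_id.div_complex_const _)).const_mul _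
      · rw [zero_div, (hf T).2, mul_zero]
      · rw [hW T (Nat.lt_succ_self T), henonMap_smul_swap_henonMap ha.ne' hc.ne']
      · rw [norm_ofReal_smul hc.le, norm_swap]; exact hκ _ le_rfl x hx
      · rw [norm_ofReal_smul (by positivity), norm_swap]; exact hκ' _ (Nat.le_succ T) x hx
    have h2 := ih (fun i hi => hW i (by omega)) (c := a ^ 2 * c) (by positivity)
      fun i hi => hκ' i (by omega)
    convert h1.trans h2 using 1
    · ring
    · funext x; congr 2; ring

/-- From the image of a small ball along a given orbit segment, a chain of Hénon maps reaches the
preimage, along another orbit segment, of a prescribed map of `H` type. -/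
theorem exists_relChain {a κ β β' : ℝ} (ha : 0 < a) (ha1 : a < 1) {T l i₀ q q' D d : ℕ}
    (hβ : β = a ^ (2 * q)) (hβ' : β' = a ^ (2 * q'))
    (W : ℕ → C2 → C2) (fW : ℕ → ℂ → ℂ) (hfW : ∀ i, Differentiable ℂ (fW i) ∧ fW i 0 = 0)
    (hW0 : ∀ x, W 0 x = (β : ℂ) • x)
    (hW : ∀ i < T, ∀ x, W (i + 1) x = henonMap a (fW i) (W i x))
    (hWκ : ∀ i ≤ T, ∀ x, ‖x‖ ≤ 1 → ‖W i x‖ < κ) (hβκ : β < κ)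
    (V : ℕ → C2 → C2) (fV : ℕ → ℂ → ℂ) (hfV : ∀ i, Differentiable ℂ (fV i) ∧ fV i 0 = 0)
    (hl : 0 < l) (hV0 : ∀ y, V 0 y = (β' : ℂ) • y)
    (hV : ∀ i, i + 1 < l → ∀ y, V i y = henonMap a (fV i) (V (i + 1) y))
    (hVκ : ∀ i < l, ∀ y, ‖y‖ ≤ 1 → ‖V i y‖ < a ^ (2 * l) * κ)
    (hd : 0 < d) (hcount : 2 * T + 2 + 2 * i₀ + 2 * q + 2 * l + 1 = D + 2 * q')
    (H : C2 → C2) (hH : ∀ x, H x = !₂[((a : ℂ) * x 0) ^ d + (a : ℂ) ^ D * x 1, (a : ℂ) ^ D * x 0])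
    (hH1 : ∀ x, ‖x‖ ≤ 1 → ‖H x‖ ≤ 1) :
    RelChain a κ (T + 1 + 2 * i₀ + 1 + 1 + (l - 1)) (fun x => (a : ℂ) • swap (W T x))
      (fun x => ((a⁻¹ : ℝ) : ℂ) • swap (V (l - 1) (H x))) := by
  have ha' : (a : ℂ) ≠ 0 := by exact_mod_cast ha.ne'
  have hβ0 : 0 < β := by rw [hβ]; positivity
  have hβ0' : 0 < β' := by rw [hβ']; positivity
  have hball : ∀ c : ℝ, 0 ≤ c → c ≤ β → ∀ x : C2, ‖x‖ ≤ 1 → ‖(c : ℂ) • x‖ < κ := by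
    intro c hc hcβ x hx
    rw [norm_ofReal_smul hc]
    nlinarith [norm_nonneg x]
  have hpow1 : ∀ m, a ^ m ≤ 1 := fun m => pow_le_one₀ ha.le ha1.le
  -- undo the first orbit segment
  have h1 : RelChain a κ T (fun x => (a : ℂ) • swap (W T x))
      (fun x => ((a ^ (2 * T) * a : ℝ) : ℂ) • swap (W 0 x)) :=
    RelChain.reverse ha ha1 T W fW hfW hW ha fun i hi x hx => by
      have := hWκ i hi x hx
      nlinarith [norm_nonneg (W i x)]
  have h2 := RelChain.zero_step ha ha1
    (A := fun x => ((a ^ (2 * T) * a : ℝ) : ℂ) • swap (W 0 x)) (κ := κ) fun x hx => by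
      rw [norm_ofReal_smul (by positivity), norm_swap]
      have e1 := hWκ 0 (Nat.zero_le T) x hx
      have e2 := hpow1 (2 * T + 1)
      rw [pow_succ] at e2
      nlinarith [norm_nonneg (W 0 x)]
  have e2 : (fun x => (a : ℂ) • swap (((a ^ (2 * T) * a : ℝ) : ℂ) • swap (W 0 x)))
      = fun x : C2 => ((a ^ (2 * T + 2) * β : ℝ) : ℂ) • x := by
    funext x
    rw [swap_smul, swap_swap, hW0, smul_smul, smul_smul]
    congr 1; push_cast; ring
  rw [e2] at h2
  have h3 := RelChain.contract ha ha1 i₀ (c := a ^ (2 * T + 2) * β) (κ := κ) (by positivity)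
    (by have := hpow1 (2 * T + 2); nlinarith)
  -- insert the monomial
  set b : ℝ := β' / a ^ (2 * l) with hb
  have hb0 : 0 < b := by positivity
  set s : ℝ := a ^ (2 * i₀) * (a ^ (2 * T + 2) * β) with hs
  have hs0 : 0 < s := by positivity
  have hsc : (s : ℂ) ≠ 0 := by exact_mod_cast hs0.ne'
  have hsβ : s ≤ β := by
    have e1 := hpow1 (2 * i₀ + (2 * T + 2))
    rw [pow_add] at e1
    rw [hs, ← mul_assoc]; nlinarith
  -- The linear part of the inserted Hénon map contributes `a * s`, whereas `b • H` requires `b * a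
  -- ^ D`. Comparing exponents of `a` is exactly `hcount`.
  have hasb : a * s = b * a ^ D := by
    rw [hs, hb, hβ, hβ', div_mul_eq_mul_div, eq_div_iff (by positivity), ← pow_add, ← pow_add,
      ← pow_add, ← pow_succ', ← pow_add]
    congr 1; omega
  have hasb' : (a : ℂ) * s = b * (a : ℂ) ^ D := by exact_mod_cast hasb
  have hbH : ∀ x, ‖x‖ ≤ 1 → ‖(b : ℂ) • H x‖ < κ := by
    intro x hx
    rw [norm_ofReal_smul hb0.le]
    have e1 := hVκ 0 hl (H x) (hH1 x hx)
    rw [hV0, norm_ofReal_smul hβ0'.le] at e1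
    rw [hb, div_mul_eq_mul_div, div_lt_iff₀ (by positivity)]
    linarith
  have h4 : RelChain a κ 1 (fun x => (s : ℂ) • x) (fun x => (b : ℂ) • H x) := by
    refine RelChain.single (g := fun t => b * ((a : ℂ) * (t / s)) ^ d) ?_ ?_ (fun x => ?_)
      (hball s hs0.le hsβ) hbH
    · exact ((((differentiable_id.div_complex_const _).const_mul _).pow d).const_mul _)
    · rw [zero_div, mul_zero, zero_pow hd.ne', mul_zero]
    · apply C2.ext
      · rw [henonMap_apply_zero, hH]
        change (b : ℂ) * (((a : ℂ) * x 0) ^ d + (a : ℂ) ^ D * x 1) =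
          b * ((a : ℂ) * (s * x 0 / s)) ^ d + a * (s * x 1)
        rw [mul_div_cancel_left₀ _ hsc]
        linear_combination -(x 1) * hasb'
      · rw [henonMap_apply_one, hH]
        change (b : ℂ) * ((a : ℂ) ^ D * x 0) = a * (s * x 0)
        linear_combination -(x 0) * hasb'
  have h5 := RelChain.zero_step ha ha1 hbH
  -- run backwards along the second segment
  set c : ℝ := a / a ^ (2 * l) with hc
  have hc0 : 0 < c := by positivity
  have h6 := RelChain.reverse (κ := κ) ha ha1 (l - 1) (fun i x => V (l - 1 - i) (H x))
    (fun i => fV (l - 1 - (i + 1))) (fun i => hfV _) (fun i hi x => by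
      have e := hV (l - 1 - (i + 1)) (by omega) (H x)
      rwa [show l - 1 - (i + 1) + 1 = l - 1 - i by omega] at e) hc0 (fun i hi x hx => by
      have e1 := hVκ (l - 1 - i) (by omega) (H x) (hH1 x hx)
      rw [hc, div_mul_eq_mul_div, div_lt_iff₀ (by positivity)]
      nlinarith [norm_nonneg (V (l - 1 - i) (H x))])
  have e6 : (fun x => (a : ℂ) • swap ((b : ℂ) • H x))
      = fun x => (c : ℂ) • swap (V (l - 1 - (l - 1)) (H x)) := by
    funext x
    rw [Nat.sub_self, hV0, swap_smul, swap_smul, smul_smul, smul_smul]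
    congr 1
    rw [hb, hc]; push_cast; ring
  rw [← e6] at h6
  have e7 : a ^ (2 * (l - 1)) * c = a⁻¹ := by
    rw [hc, show 2 * l = 2 * (l - 1) + 2 by omega, pow_add]
    field_simp
  rw [e7, Nat.sub_zero] at h6
  exact ((((h1.trans h2).trans h3).trans h4).trans h5).trans h6

/-! ### Placement of the discs on which the function is prescribed -/

/-- Far away, mutually far apart points with prescribed relations at both ends. -/
theorem exists_outer_points {a : ℝ} (ha : 0 < a) {J : ℕ} (hJ : 2 ≤ J) (B : ℝ) (u v : ℂ) :
    ∃ (c : ℂ) (y : ℕ → ℂ), y 0 = c + u ∧ c + (a : ℂ) ^ 2 * y (J - 1) = v ∧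
      (∀ j < J, B < ‖y j‖) ∧ ∀ i j, i < j → j < J → 3 < ‖y i - y j‖ := by
  have ha' : (a : ℂ) ≠ 0 := by exact_mod_cast ha.ne'
  set s : ℝ := (a ^ 2)⁻¹ with hs
  have hs0 : 0 < s := by positivity
  set Q : ℝ := |B| + 1 + 4 * J with hQ
  have hQ0 : 0 < Q := by positivity
  -- The constant `c` is this large positive `t`: one end point lies near `t`, the other near `-t /
  -- a ^ 2`, and the intermediate ones lie on the imaginary axis, at spacing `4` and modulus at most
  -- `Q`.
  set t : ℝ := ‖u‖ + ‖v‖ + (1 + a ^ 2) * (Q + 4) with ht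
  have ht0 : 0 < t := by positivity
  have hend : ((t : ℂ) : ℂ) + (a : ℂ) ^ 2 * ((v - t) * s) = v := by
    rw [hs]; push_cast; field_simp; ring
  have hy0 : Q + 4 ≤ ‖(t : ℂ) + u‖ := by
    have h1 := norm_sub_le ((t : ℂ) + u) u
    rw [add_sub_cancel_right, Complex.norm_of_nonneg ht0.le] at h1
    nlinarith [norm_nonneg v, sq_nonneg a]
  have hyJ : Q + 4 ≤ ‖(v - t) * (s : ℂ)‖ := by
    have h1 := norm_sub_le (v : ℂ) (v - t)
    rw [sub_sub_cancel, Complex.norm_of_nonneg ht0.le] at h1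
    rw [norm_mul, Complex.norm_of_nonneg hs0.le, hs, ← div_eq_mul_inv, le_div_iff₀ (by positivity)]
    nlinarith [norm_nonneg u]
  have hy0J : 3 < ‖(t : ℂ) + u - (v - t) * s‖ := by
    have h1 := norm_sub_le ((t : ℂ) + u - (v - t) * s) (u - v * s)
    rw [show (t : ℂ) + u - (v - t) * s - (u - v * s) = ((t * (1 + s) : ℝ) : ℂ) by push_cast; ring,
      Complex.norm_of_nonneg (by positivity)] at h1
    have h2 := norm_sub_le u (v * s)
    rw [norm_mul, Complex.norm_of_nonneg hs0.le] at h2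
    have h3 : t * (1 + s) = t + t * s := by ring
    have h4 : ‖v‖ * s ≤ t * s := by
      have : ‖v‖ ≤ t := by nlinarith [norm_nonneg u, sq_nonneg a]
      gcongr
    have h5 : ‖u‖ + 4 ≤ t := by nlinarith [norm_nonneg v, sq_nonneg a]
    linarith
  let m : ℕ → ℂ := fun j => ((|B| + 1 + 4 * j : ℝ) : ℂ) * Complex.I
  have hm : ∀ j, ‖m j‖ = |B| + 1 + 4 * j := fun j => by
    simp only [m]
    rw [norm_mul, Complex.norm_I, mul_one, Complex.norm_of_nonneg (by positivity)]
  have hmQ : ∀ j, j < J → ‖m j‖ ≤ Q := fun j hj => by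
    have : (j : ℝ) ≤ J := by exact_mod_cast hj.le
    rw [hm]; linarith
  let y : ℕ → ℂ := fun j => if j = 0 then (t : ℂ) + u else if j = J - 1 then (v - t) * s else m j
  have e0 : y 0 = (t : ℂ) + u := by simp [y]
  have eJ : y (J - 1) = (v - t) * s := by
    have : J - 1 ≠ 0 := by omega
    simp [y, this]
  have em : ∀ j, j ≠ 0 → j ≠ J - 1 → y j = m j := fun j h1 h2 => by simp [y, h1, h2]
  refine ⟨t, y, e0, by rw [eJ]; exact hend, fun j hj => ?_, fun i j hij hj => ?_⟩
  · have hBQ : B < Q := by linarith [le_abs_self B, (Nat.cast_nonneg J : (0 : ℝ) ≤ J)]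
    by_cases h1 : j = 0
    · rw [h1, e0]; linarith
    by_cases h2 : j = J - 1
    · rw [h2, eJ]; linarith
    rw [em j h1 h2, hm]
    linarith [le_abs_self B, (Nat.cast_nonneg j : (0 : ℝ) ≤ j)]
  · have hj0 : j ≠ 0 := by omega
    have hiJ : i ≠ J - 1 := by omega
    by_cases h1 : i = 0
    · by_cases h2 : j = J - 1
      · rw [h1, h2, e0, eJ]; exact hy0J
      · rw [h1, e0, em j hj0 h2]
        have := norm_sub_norm_le ((t : ℂ) + u) (m j)
        linarith [hmQ j hj]
    · by_cases h2 : j = J - 1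
      · rw [h2, eJ, em i h1 hiJ]
        have := norm_sub_norm_le ((v - t) * (s : ℂ)) (m i)
        rw [norm_sub_rev] at this
        linarith [hmQ i (by omega)]
      · rw [em i h1 hiJ, em j hj0 h2]
        have := norm_sub_norm_le (m j) (m i)
        rw [norm_sub_rev, hm, hm] at this
        have hc : (i : ℝ) + 1 ≤ j := by exact_mod_cast hij
        linarith

theorem IsFilled.exists_union_closedBalls {K : Set ℂ} (hK : IsFilled K) (y : ℕ → ℂ) (J : ℕ)
    (hKy : ∀ j < J, Disjoint K (Metric.closedBall (y j) 1))
    (hy : ∀ i j, i < j → j < J →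
      Disjoint (Metric.closedBall (y i) 1) (Metric.closedBall (y j) 1)) :
    ∃ K', K ⊆ K' ∧ (∀ j < J, Metric.closedBall (y j) 1 ⊆ K') ∧
      (∀ z ∈ K', z ∈ K ∨ ∃ j < J, z ∈ Metric.closedBall (y j) 1) ∧ IsFilled K' ∧
      ∀ φ, EntireApprox K φ → (∀ j < J, EntireApprox (Metric.closedBall (y j) 1) φ) →
        EntireApprox K' φ := by
  induction J with
  | zero => exact ⟨K, subset_rfl, by simp, by simp, hK, fun φ h _ => h⟩
  | succ J ih =>
    obtain ⟨K', h1, h2, h3, h4, h5⟩ := ih (fun j hj => hKy j (by omega))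
      (fun i j hij hj => hy i j hij (by omega))
    have hd : Disjoint K' (Metric.closedBall (y J) 1) := by
      rw [Set.disjoint_left]
      intro z hz hzJ
      rcases h3 z hz with h | ⟨j, hj, hjz⟩
      · exact Set.disjoint_left.1 (hKy J (Nat.lt_succ_self J)) h hzJ
      · exact Set.disjoint_left.1 (hy j J hj (Nat.lt_succ_self J)) hjz hzJ
    refine ⟨K' ∪ Metric.closedBall (y J) 1, h1.trans Set.subset_union_left, fun j hj => ?_,
      fun z hz => ?_, h4.union_closedBall one_pos hd, fun φ hφ hφ' => ?_⟩
    · rcases Nat.lt_succ_iff_lt_or_eq.1 hj with h | rfl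
      · exact (h2 j h).trans Set.subset_union_left
      · exact Set.subset_union_right
    · rcases hz with hz | hz
      · rcases h3 z hz with h | ⟨j, hj, hjz⟩
        · exact Or.inl h
        · exact Or.inr ⟨j, by omega, hjz⟩
      · exact Or.inr ⟨J, Nat.lt_succ_self J, hz⟩
    · exact (h5 φ hφ fun j hj => hφ' j (by omega)).union_closedBall h4 one_pos hd
        (hφ' J (Nat.lt_succ_self J))

theorem exists_closedBall_disjoint {K : Set ℂ} (hK : IsClosed K) {z : ℂ} (hz : z ∉ K) {r : ℝ}
    (hr : 0 < r) : ∃ δ > 0, δ < r ∧ Disjoint K (Metric.closedBall z δ) := by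
  obtain ⟨δ, hδ, h⟩ := Metric.nhds_basis_closedBall.mem_iff.1 (hK.isOpen_compl.mem_nhds hz)
  refine ⟨min δ (r / 2), by positivity, (min_le_right _ _).trans_lt (by linarith), ?_⟩
  rw [Set.disjoint_left]
  intro w hw hw'
  exact h (Metric.closedBall_subset_closedBall (min_le_left _ _) hw') hw

/-- A central disc, a given disc `closedBall zN rN`, a small disc around `zo` and, unless it is
already covered, a small disc around `ze`. -/
theorem exists_filled_configuration {ρ rN κ : ℝ} (hρ : 0 < ρ) (hrN : 0 < rN) (hκ : 0 < κ)
    {zN zo ze : ℂ} (hN : Disjoint (Metric.closedBall 0 ρ) (Metric.closedBall zN rN))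
    (hoρ : ρ < ‖zo‖) (hoN : rN < ‖zo - zN‖) (heρ : ρ < ‖ze‖) (heN : ‖ze - zN‖ ≠ rN)
    (heo : ze ≠ zo) :
    ∃ (K : Set ℂ) (δo δe : ℝ), IsFilled K ∧ 0 < δo ∧ δo < κ ∧ 0 < δe ∧ δe < κ ∧
      Metric.closedBall 0 ρ ⊆ K ∧
      Metric.closedBall zN rN ⊆ K ∧ Metric.closedBall zo δo ⊆ K ∧ Metric.closedBall ze δe ⊆ K ∧
      Disjoint (Metric.closedBall 0 ρ) (Metric.closedBall zo δo) ∧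
      Disjoint (Metric.closedBall 0 ρ ∪ Metric.closedBall zo δo) (Metric.closedBall zN rN) ∧
      Disjoint (Metric.closedBall 0 ρ ∪ Metric.closedBall zo δo) (Metric.closedBall ze δe) ∧
      ∀ (φ : ℂ → ℂ) (c : ℂ), EntireApprox (Metric.closedBall 0 ρ) φ →
        EntireApprox (Metric.closedBall zo δo) φ →
        (∀ z ∈ K, z ∉ Metric.closedBall 0 ρ ∪ Metric.closedBall zo δo → φ z = c) →
        EntireApprox K φ := by
  have h0o : zo ∉ Metric.closedBall 0 ρ ∪ Metric.closedBall zN rN ∪ {ze} := by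
    rintro ((h | h) | h)
    · exact absurd (mem_closedBall_zero_iff.1 h) (not_le.2 hoρ)
    · rw [Metric.mem_closedBall, dist_eq_norm] at h; linarith
    · exact heo h.symm
  obtain ⟨δo, hδo, hδoκ, hdo⟩ := exists_closedBall_disjoint
    ((Metric.isClosed_closedBall.union Metric.isClosed_closedBall).union isClosed_singleton) h0o hκ
  have hF1 := (isFilled_closedBall 0 hρ).union_closedBall hrN hN
  have hdo' := hdo.mono_left (Set.subset_union_left (t := {ze}))
  have hF2 := hF1.union_closedBall hδo hdo'
  have h0d : Disjoint (Metric.closedBall 0 ρ) (Metric.closedBall zo δo) :=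
    hdo'.mono_left Set.subset_union_left
  have hNd : Disjoint (Metric.closedBall zN rN) (Metric.closedBall zo δo) :=
    hdo'.mono_left Set.subset_union_right
  have hoNd : Disjoint (Metric.closedBall 0 ρ ∪ Metric.closedBall zo δo)
      (Metric.closedBall zN rN) := by
    rw [Set.disjoint_union_left]; exact ⟨hN, hNd.symm⟩
  have hze0 : ze ∉ Metric.closedBall 0 ρ ∪ Metric.closedBall zo δo := by
    rintro (h | h)
    · exact absurd (mem_closedBall_zero_iff.1 h) (not_le.2 heρ)
    · exact Set.disjoint_left.1 hdo (Or.inr rfl) h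
  set K₂ := Metric.closedBall 0 ρ ∪ Metric.closedBall zN rN ∪ Metric.closedBall zo δo with hK₂
  have happrox : ∀ (φ : ℂ → ℂ) (c : ℂ), EntireApprox (Metric.closedBall 0 ρ) φ →
        EntireApprox (Metric.closedBall zo δo) φ →
        (∀ z ∈ K₂, z ∉ Metric.closedBall 0 ρ ∪ Metric.closedBall zo δo → φ z = c) →
        EntireApprox K₂ φ := by
    intro φ c h1 h2 h3
    refine (h1.union_closedBall (isFilled_closedBall 0 hρ) hrN hN ?_).union_closedBall hF1 hδo
      hdo' h2
    refine EntireApprox.of_eqOn (differentiable_const c) fun z hz =>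
      h3 z (Or.inl (Or.inr hz)) fun hz' => Set.disjoint_left.1 hoNd hz' hz
  -- If `ze` is interior to the disc around `zN`, no new disc is needed: the same constant `c` is
  -- prescribed near both points. Otherwise `ze` gets its own disc.
  rcases lt_or_gt_of_ne heN with hlt | hgt
  · obtain ⟨δe, hδe, hδeκ, hde⟩ := exists_closedBall_disjoint
      (Metric.isClosed_closedBall.union Metric.isClosed_closedBall) hze0
      (lt_min hκ (sub_pos.2 hlt))
    refine ⟨K₂, δo, δe, hF2, hδo, hδoκ, hδe, hδeκ.trans_le (min_le_left _ _),
      fun z hz => Or.inl (Or.inl hz), fun z hz => Or.inl (Or.inr hz), fun z hz => Or.inr hz,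
      fun z hz => Or.inl (Or.inr ?_), h0d, hoNd, hde, happrox⟩
    have h1 := hδeκ.trans_le (min_le_right _ _)
    refine Metric.closedBall_subset_closedBall' ?_ hz
    rw [dist_eq_norm]; linarith
  · have hze2 : ze ∉ K₂ := by
      rintro ((h | h) | h)
      · exact hze0 (Or.inl h)
      · rw [Metric.mem_closedBall, dist_eq_norm] at h; linarith
      · exact hze0 (Or.inr h)
    obtain ⟨δe, hδe, hδeκ, hde⟩ := exists_closedBall_disjoint hF2.1.isClosed hze2 hκ
    have hde' : Disjoint (Metric.closedBall 0 ρ ∪ Metric.closedBall zo δo)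
        (Metric.closedBall ze δe) := by
      refine hde.mono_left ?_
      rintro z (hz | hz)
      · exact Or.inl (Or.inl hz)
      · exact Or.inr hz
    refine ⟨K₂ ∪ Metric.closedBall ze δe, δo, δe, hF2.union_closedBall hδe hde, hδo, hδoκ, hδe,
      hδeκ, fun z hz => Or.inl (Or.inl (Or.inl hz)), fun z hz => Or.inl (Or.inl (Or.inr hz)),
      fun z hz => Or.inl (Or.inr hz), fun z hz => Or.inr hz, h0d, hoNd, hde', ?_⟩
    intro φ c h1 h2 h3
    refine (happrox φ c h1 h2 fun z hz => h3 z (Or.inl hz)).union_closedBall hF2 hδe hde ?_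
    exact EntireApprox.of_eqOn (differentiable_const c) fun z hz =>
      h3 z (Or.inr hz) fun hz' => Set.disjoint_left.1 hde' hz' hz

/-! ### Shadowing: finitely many steps depend continuously on the function -/

theorem EntireApprox.continuousOn {K : Set ℂ} {φ : ℂ → ℂ} (h : EntireApprox K φ) :
    ContinuousOn φ K := by
  rw [Metric.continuousOn_iff]
  intro z hz ε hε
  obtain ⟨g, hg, hgφ⟩ := h (ε / 4) (by positivity)
  obtain ⟨δ, hδ, hgδ⟩ := Metric.continuous_iff.1 hg.continuous z (ε / 4) (by positivity)
  refine ⟨δ, hδ, fun w hw hwz => ?_⟩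
  have h1 := hgδ w hwz
  have h2 := hgφ w hw
  have h3 := hgφ z hz
  rw [← dist_eq_norm] at h2 h3
  have h4 := dist_triangle4 (φ w) (g w) (g z) (φ z)
  rw [dist_comm] at h2
  linarith

theorem continuousOn_henonMap {a : ℝ} {φ : ℂ → ℂ} {U : Set ℂ} (hφ : ContinuousOn φ U) :
    ContinuousOn (henonMap a φ) {p | p 0 ∈ U} := by
  refine (PiLp.continuous_toLp 2 _).comp_continuousOn (continuousOn_pi.2 fun i => ?_)
  have h0 : Continuous fun p : C2 => p 0 := (C2.differentiable_apply 0).continuous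
  have h1 : Continuous fun p : C2 => p 1 := (C2.differentiable_apply 1).continuous
  fin_cases i
  · exact (hφ.comp h0.continuousOn fun p hp => hp).add (continuous_const.mul h1).continuousOn
  · exact (continuous_const.mul h0).continuousOn

/-- Induction on the number of steps. The image of `X` is a compact set over the open set `U`, so a
nearby orbit is still over `U`, and uniform continuity near this compact set carries the error one
step further. -/
theorem exists_shadowing (a : ℝ) {K U : Set ℂ} (hU : IsOpen U) (hUK : U ⊆ K) {φ : ℂ → ℂ}
    (hφ : ContinuousOn φ U) {X : Set C2} (hX : IsCompact X) {A : C2 → C2} (hA : Continuous A)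
    (J : ℕ) (hJ : ∀ j < J, ∀ x ∈ X, (henonMap a φ)^[j] (A x) 0 ∈ U) :
    ContinuousOn (fun x => (henonMap a φ)^[J] (A x)) X ∧
    ∀ η > 0, ∃ δ > 0, ∀ f : ℂ → ℂ, (∀ z ∈ K, ‖f z - φ z‖ ≤ δ) → ∀ x ∈ X, ∀ j ≤ J,
      ‖(henonMap a f)^[j] (A x) - (henonMap a φ)^[j] (A x)‖ < η := by
  induction J with
  | zero =>
    refine ⟨hA.continuousOn, fun η hη => ⟨1, one_pos, fun f _ x _ j hj => ?_⟩⟩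
    obtain rfl : j = 0 := by omega
    simpa using hη
  | succ J ih =>
    obtain ⟨hc, hsh⟩ := ih fun j hj => hJ j (by omega)
    have hV : IsOpen {p : C2 | p 0 ∈ U} :=
      hU.preimage (C2.differentiable_apply 0).continuous
    have hmaps : ∀ x ∈ X, (henonMap a φ)^[J] (A x) ∈ {p : C2 | p 0 ∈ U} :=
      fun x hx => hJ J (Nat.lt_succ_self J) x hx
    refine ⟨?_, fun η hη => ?_⟩
    · simp only [Function.iterate_succ_apply']
      exact (continuousOn_henonMap hφ).comp hc hmaps
    have hC := hX.image_of_continuousOn hc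
    have hCV : (fun x => (henonMap a φ)^[J] (A x)) '' X ⊆ {p : C2 | p 0 ∈ U} :=
      Set.image_subset_iff.2 hmaps
    obtain ⟨η₁, hη₁, hthick⟩ := hC.exists_thickening_subset_open hV hCV
    have huc := hC.uniformContinuousAt_of_continuousAt (henonMap a φ)
      (fun p hp => (continuousOn_henonMap hφ).continuousAt (hV.mem_nhds (hCV hp)))
      (Metric.dist_mem_uniformity (half_pos hη))
    obtain ⟨η₂, hη₂, huc⟩ := Metric.mem_uniformity_dist.1 huc
    obtain ⟨δ, hδ, hδf⟩ := hsh (min η (min η₁ η₂)) (by positivity)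
    refine ⟨min δ (η / 2), by positivity, fun f hf x hx j hj => ?_⟩
    have hprev := hδf f (fun z hz => (hf z hz).trans (min_le_left _ _)) x hx
    rcases Nat.lt_succ_iff_lt_or_eq.1 (Nat.lt_succ_of_le hj) with hj' | rfl
    · exact (hprev j (by omega)).trans_le (min_le_left _ _)
    have h1 := hprev J le_rfl
    set y := (henonMap a φ)^[J] (A x) with hy
    set w := (henonMap a f)^[J] (A x) with hw
    have hyC : y ∈ (fun x => (henonMap a φ)^[J] (A x)) '' X := ⟨x, hx, rfl⟩
    have hwU : w 0 ∈ U := hthick (Metric.mem_thickening_iff.2 ⟨y, hyC, by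
      rw [dist_eq_norm]
      exact h1.trans_le ((min_le_right _ _).trans (min_le_left _ _))⟩)
    have h2 : dist (henonMap a φ y) (henonMap a φ w) < η / 2 :=
      huc (show dist y w < η₂ by
        rw [dist_comm, dist_eq_norm]
        exact h1.trans_le ((min_le_right _ _).trans (min_le_right _ _))) hyC
    have h3 := norm_henonMap_sub a f φ w
    have h4 := (hf _ (hUK hwU)).trans (min_le_right _ _)
    rw [Function.iterate_succ_apply', Function.iterate_succ_apply', ← hy, ← hw]
    have h5 := norm_add_le (henonMap a f w - henonMap a φ w) (henonMap a φ w - henonMap a φ y)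
    rw [sub_add_sub_cancel, h3] at h5
    rw [dist_comm, dist_eq_norm] at h2
    linarith

theorem exists_small_perturbation (G : ℕ → C2 → C2) (hG : ∀ i, Continuous (G i)) (L : ℕ) (x : C2)
    {η : ℝ} (hη : 0 < η) :
    ∃ δ > 0, ∀ i < L, ∀ u, ‖u‖ < δ → ‖G i (x + u) - G i x‖ < η := by
  have h : ∀ i ∈ Finset.range L, ∀ᶠ u in 𝓝 (0 : C2), ‖G i (x + u) - G i x‖ < η := by
    intro i _
    have hc : ContinuousAt (fun u => ‖G i (x + u) - G i x‖) 0 := by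
      have := hG i
      fun_prop
    exact hc.eventually_lt continuousAt_const (by simpa using hη)
  obtain ⟨δ, hδ, h'⟩ := Metric.eventually_nhds_iff.1 ((Finset.eventually_all _).2 h)
  exact ⟨δ, hδ, fun i hi u hu => h' (by simpa using hu) i (Finset.mem_range.2 hi)⟩

/-! ### Orbit segments with their families of displacements -/

/-- Under the Hénon map of `φ`, the point `p` goes to `q` in `J` steps, the family `p + A x` goes
to `q + B x`, staying over `U` and at distance less than `κ` from the orbit of `p` before that. -/
def Seg (a : ℝ) (φ : ℂ → ℂ) (U : Set ℂ) (κ : ℝ) (p : C2) (A : C2 → C2) (J : ℕ) (q : C2)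
    (B : C2 → C2) : Prop :=
  (henonMap a φ)^[J] p = q ∧ (∀ x, ‖x‖ ≤ 1 → (henonMap a φ)^[J] (p + A x) = q + B x) ∧
    ∀ j < J, ∀ x, ‖x‖ ≤ 1 → (henonMap a φ)^[j] (p + A x) 0 ∈ U ∧
      ‖(henonMap a φ)^[j] (p + A x) - (henonMap a φ)^[j] p‖ < κ

theorem Seg.trans {a : ℝ} {φ : ℂ → ℂ} {U : Set ℂ} {κ : ℝ} {p q r : C2} {A B C : C2 → C2}
    {J J' : ℕ} (h : Seg a φ U κ p A J q B) (h' : Seg a φ U κ q B J' r C) :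
    Seg a φ U κ p A (J + J') r C := by
  obtain ⟨h1, h2, h3⟩ := h
  obtain ⟨h1', h2', h3'⟩ := h'
  refine ⟨?_, fun x hx => ?_, fun j hj x hx => ?_⟩
  · rw [add_comm, Function.iterate_add_apply, h1, h1']
  · rw [add_comm, Function.iterate_add_apply, h2 x hx, h2' x hx]
  · rcases lt_or_ge j J with hjJ | hjJ
    · exact h3 j hjJ x hx
    · obtain ⟨i, rfl⟩ := Nat.exists_eq_add_of_le hjJ
      rw [add_comm, Function.iterate_add_apply, Function.iterate_add_apply, h1, h2 x hx]
      exact h3' i (by omega) x hx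

/-- Where `φ` is constant the Hénon map is affine with linear part `a • swap`, so the constant
steers the centre without distorting the family. -/
theorem Seg.const_step {a : ℝ} {φ : ℂ → ℂ} {U : Set ℂ} {κ r : ℝ} {p q : C2} {A : C2 → C2} {c : ℂ}
    (hU : Metric.ball (p 0) r ⊆ U) (hφ : ∀ z ∈ Metric.ball (p 0) r, φ z = c) (hr : 0 < r)
    (hA : ∀ x, ‖x‖ ≤ 1 → ‖A x‖ < r) (hκ : ∀ x, ‖x‖ ≤ 1 → ‖A x‖ < κ)
    (hq0 : q 0 = c + a * p 1) (hq1 : q 1 = a * p 0) :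
    Seg a φ U κ p A 1 q (fun x => (a : ℂ) • swap (A x)) := by
  have hmem : ∀ x, ‖x‖ ≤ 1 → (p + A x) 0 ∈ Metric.ball (p 0) r := by
    intro x hx
    rw [Metric.mem_ball, dist_eq_norm, PiLp.add_apply, add_sub_cancel_left]
    exact (C2.norm_apply_le _ _).trans_lt (hA x hx)
  refine ⟨?_, fun x hx => ?_, fun j hj x hx => ?_⟩
  · apply C2.ext
    · rw [Function.iterate_one, henonMap_apply_zero, hφ _ (Metric.mem_ball_self hr), hq0]
    · rw [Function.iterate_one, henonMap_apply_one, hq1]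
  · apply C2.ext
    · rw [Function.iterate_one, henonMap_apply_zero, hφ _ (hmem x hx), PiLp.add_apply,
        PiLp.add_apply, hq0]
      change _ = c + a * p 1 + a * A x 1
      ring
    · rw [Function.iterate_one, henonMap_apply_one, PiLp.add_apply, PiLp.add_apply, hq1]
      change _ = a * p 0 + a * A x 0
      ring
  · obtain rfl : j = 0 := by omega
    refine ⟨hU (hmem x hx), ?_⟩
    simpa using hκ x hx

theorem iterate_henonMap_congr {a : ℝ} {φ f : ℂ → ℂ} {S : Set ℂ} (hφ : ∀ z ∈ S, φ z = f z)
    {p : C2} {J : ℕ} (h : ∀ j < J, (henonMap a f)^[j] p 0 ∈ S) :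
    ∀ j ≤ J, (henonMap a φ)^[j] p = (henonMap a f)^[j] p := by
  intro j
  induction j with
  | zero => intro _; rfl
  | succ j ih =>
    intro hj
    rw [Function.iterate_succ_apply', Function.iterate_succ_apply', ih (by omega)]
    apply C2.ext
    · rw [henonMap_apply_zero, henonMap_apply_zero, hφ _ (h j (by omega))]
    · rfl

theorem Seg.of_iterate {a : ℝ} {φ f : ℂ → ℂ} {U S : Set ℂ} {κ : ℝ} {p : C2} {A : C2 → C2} {J : ℕ}
    (hSU : S ⊆ U) (hφ : ∀ z ∈ S, φ z = f z) (hp : ∀ j < J, (henonMap a f)^[j] p 0 ∈ S)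
    (hA : ∀ j < J, ∀ x, ‖x‖ ≤ 1 → (henonMap a f)^[j] (p + A x) 0 ∈ S ∧
      ‖(henonMap a f)^[j] (p + A x) - (henonMap a f)^[j] p‖ < κ) :
    Seg a φ U κ p A J ((henonMap a f)^[J] p)
      (fun x => (henonMap a f)^[J] (p + A x) - (henonMap a f)^[J] p) := by
  have e1 := iterate_henonMap_congr hφ hp
  have e2 : ∀ x, ‖x‖ ≤ 1 → ∀ j ≤ J, (henonMap a φ)^[j] (p + A x) = (henonMap a f)^[j] (p + A x) :=
    fun x hx => iterate_henonMap_congr hφ fun j hj => (hA j hj x hx).1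
  refine ⟨e1 J le_rfl, fun x hx => ?_, fun j hj x hx => ?_⟩
  · rw [e2 x hx J le_rfl, add_sub_cancel]
  · rw [e2 x hx j hj.le, e1 j hj.le]
    exact ⟨hSU (hA j hj x hx).1, (hA j hj x hx).2⟩

/-- This realizes an abstract chain along an orbit with prescribed first coordinates `u`: the
constant in `φ` moves the centre to the next node, and `g j` acts on the displacement alone. -/
theorem Seg.of_chain {a : ℝ} {φ : ℂ → ℂ} {U : Set ℂ} {κ : ℝ} (hκ1 : κ ≤ 1) {J : ℕ}
    {g : ℕ → ℂ → ℂ} {Y : ℕ → C2 → C2} (hg : ∀ j, g j 0 = 0)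
    (hY : ∀ j < J, ∀ x, Y (j + 1) x = henonMap a (g j) (Y j x))
    (hκ : ∀ j ≤ J, ∀ x, ‖x‖ ≤ 1 → ‖Y j x‖ < κ) {u : ℕ → ℂ}
    (hU : ∀ j < J, Metric.ball (u (j + 1)) 1 ⊆ U)
    (hφ : ∀ j < J, ∀ z ∈ Metric.ball (u (j + 1)) 1,
      φ z = g j (z - u (j + 1)) + (u (j + 2) - (a : ℂ) ^ 2 * u j)) :
    Seg a φ U κ !₂[u 1, (a : ℂ) * u 0] (Y 0) J !₂[u (J + 1), (a : ℂ) * u J] (Y J) := by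
  have hmem : ∀ j < J, ∀ x, ‖x‖ ≤ 1 → ((!₂[u (j + 1), (a : ℂ) * u j] : C2) + Y j x) 0
      ∈ Metric.ball (u (j + 1)) 1 := by
    intro j hj x hx
    rw [Metric.mem_ball, dist_eq_norm, PiLp.add_apply]
    change ‖u (j + 1) + Y j x 0 - u (j + 1)‖ < 1
    rw [add_sub_cancel_left]
    exact ((C2.norm_apply_le _ _).trans_lt (hκ j hj.le x hx)).trans_le hκ1
  have hp : ∀ j ≤ J, (henonMap a φ)^[j] !₂[u 1, (a : ℂ) * u 0] = !₂[u (j + 1), (a : ℂ) * u j] := by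
    intro j
    induction j with
    | zero => intro _; rfl
    | succ j ih =>
      intro hj
      rw [Function.iterate_succ_apply', ih (by omega)]
      apply C2.ext
      · rw [henonMap_apply_zero]
        change φ (u (j + 1)) + a * (a * u j) = u (j + 2)
        rw [hφ j (by omega) _ (Metric.mem_ball_self one_pos), sub_self, hg]
        ring
      · rfl
  have hx : ∀ x, ‖x‖ ≤ 1 → ∀ j ≤ J, (henonMap a φ)^[j] (!₂[u 1, (a : ℂ) * u 0] + Y 0 x)
      = !₂[u (j + 1), (a : ℂ) * u j] + Y j x := by
    intro x hx j
    induction j with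
    | zero => intro _; rfl
    | succ j ih =>
      intro hj
      rw [Function.iterate_succ_apply', ih (by omega), hY j (by omega)]
      apply C2.ext
      · rw [henonMap_apply_zero, hφ j (by omega) _ (hmem j (by omega) x hx)]
        change g j (u (j + 1) + Y j x 0 - u (j + 1)) + (u (j + 2) - (a : ℂ) ^ 2 * u j)
          + a * (a * u j + Y j x 1) = u (j + 2) + (g j (Y j x 0) + a * Y j x 1)
        rw [add_sub_cancel_left]
        ring
      · change a * (u (j + 1) + Y j x 0) = a * u (j + 1) + a * Y j x 0
        ring
  refine ⟨hp J le_rfl, fun x hx' => hx x hx' J le_rfl, fun j hj x hx' => ?_⟩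
  rw [hx x hx' j hj.le, hp j hj.le, add_sub_cancel_left]
  exact ⟨hU j hj (hmem j hj x hx'), hκ j hj.le x hx'⟩

theorem Seg.congr {a : ℝ} {φ : ℂ → ℂ} {U : Set ℂ} {κ : ℝ} {p q : C2} {A A' B B' : C2 → C2}
    {J : ℕ} (h : Seg a φ U κ p A J q B) (hA : ∀ x, ‖x‖ ≤ 1 → A' x = A x)
    (hB : ∀ x, ‖x‖ ≤ 1 → B' x = B x) : Seg a φ U κ p A' J q B' := by
  refine ⟨h.1, fun x hx => ?_, fun j hj x hx => ?_⟩
  · rw [hA x hx, hB x hx]; exact h.2.1 x hx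
  · rw [hA x hx]; exact h.2.2 j hj x hx

/-- Displacements from a fixed orbit evolve by Hénon maps with recentred functions vanishing at `0`,
so orbit segments can be fed into `exists_relChain`. -/
theorem henonMap_add_sub (a : ℝ) (f : ℂ → ℂ) (p p' : C2) :
    henonMap a f p' - henonMap a f p
      = henonMap a (fun t => f (p 0 + t) - f (p 0)) (p' - p) := by
  apply C2.ext
  · rw [PiLp.sub_apply, henonMap_apply_zero, henonMap_apply_zero, henonMap_apply_zero,
      PiLp.sub_apply, PiLp.sub_apply, add_sub_cancel]
    ring
  · rw [PiLp.sub_apply, henonMap_apply_one, henonMap_apply_one, henonMap_apply_one,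
      PiLp.sub_apply]
    ring

theorem norm_swap_smul_lt {c s : ℝ} (hc : 0 ≤ c) {p : C2} (h : c * ‖p‖ < s) :
    ‖(c : ℂ) • swap p‖ < s := by
  rwa [norm_ofReal_smul hc, norm_swap]

/-! ### The model of one return -/

set_option maxHeartbeats 1600000 in
/-- The model map of one return: a piecewise entire function whose Hénon map carries a small ball
around `p₀` onto the image of `H` near `x`, and then out again. -/
theorem exists_model {a : ℝ} (ha : 0 < a) (ha1 : a ≤ 1 / 2) {f : ℂ → ℂ} (hf : Differentiable ℂ f)
    (h0 : f 0 = 0) (h1 : deriv f 0 = 1) {R κ κ' : ℝ} (hR : 0 < R) (hκ : 0 < κ) (hκ1 : κ ≤ 1)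
    (hκ' : 0 < κ') {p₀ : C2} {T q : ℕ} (hβκ : a ^ (2 * q) < κ)
    (hN : R + 3 < ‖(henonMap a f)^[T] p₀ 0‖)
    (hin : ∀ j < T, ∀ x : C2, ‖x‖ ≤ 1 →
      ‖(henonMap a f)^[j] (p₀ + ((a ^ (2 * q) : ℝ) : ℂ) • x) 0‖ < R)
    (hW : ∀ j ≤ T, ∀ x : C2, ‖x‖ ≤ 1 →
      ‖(henonMap a f)^[j] (p₀ + ((a ^ (2 * q) : ℝ) : ℂ) • x) - (henonMap a f)^[j] p₀‖ < κ)
    {Dp : ℕ} (hDp : Odd Dp) (C : ℝ) :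
    ∃ (K : Set ℂ) (φ : ℂ → ℂ) (d q' M T' : ℕ) (R' : ℝ) (x pT : C2) (B : C2 → C2),
      Odd d ∧ 3 ≤ d ∧ T < M ∧ 0 < T' ∧ R + 1 ≤ R' ∧ ‖x‖ < κ ∧ a ^ (2 * q') < κ' ∧
      C * |Real.log (a ^ (2 * q'))| ≤ (d * Dp : ℕ) ∧ IsCompact K ∧
      Metric.closedBall 0 (R + 1) ⊆ K ∧ (∀ z ∈ K, ‖z‖ + 1 < R') ∧ EntireApprox K φ ∧
      (∀ z ∈ Metric.closedBall (0 : ℂ) (R + 1), φ z = f z) ∧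
      Seg a φ (interior K) κ p₀ (fun y => ((a ^ (2 * q) : ℝ) : ℂ) • y) M x
        (fun y => ((a ^ (2 * q') : ℝ) : ℂ) •
          (!₂[((a : ℂ) * y 0) ^ d + (a : ℂ) ^ (d * Dp) * y 1, (a : ℂ) ^ (d * Dp) * y 0] : C2)) ∧
      Seg a φ (interior K) κ' x (fun y => ((a ^ (2 * q') : ℝ) : ℂ) • y) T' pT B ∧
      (∀ y, ‖y‖ ≤ 1 → ‖B y‖ < κ') ∧ R' + 3 < ‖pT 0‖ := by
  classical
  have ha' : (a : ℂ) ≠ 0 := by exact_mod_cast ha.ne'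
  have ha1' : a < 1 := by linarith
  set F := henonMap a f with hF
  set G := henonInv a f with hG
  have hFG : ∀ p, F (G p) = p := henonMap_henonInv ha.ne' f
  have hFd : Differentiable ℂ F := differentiable_henonMap a hf
  have hGd : Differentiable ℂ G := differentiable_henonInv a hf
  obtain ⟨x, l, l', hx, hl, hl', hxF, hxo, hxo', hxG, hxe, hne⟩ :=
    exists_two_sided_exit ha ha1' hf h0 h1 hκ (show κ ≤ R + 1 by linarith)
  rw [← hF] at hxF hxo hxo' hne
  rw [← hG] at hxG hxe hne
  set β := a ^ (2 * q) with hβ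
  have hβ0 : 0 < β := by positivity
  set zN := F^[T] p₀ 0 with hzN
  set ze := G^[l] x 0 with hze
  set zo := F^[l'] x 0 with hzo
  -- the discs around `0`, `zN`, `zo` and `ze`
  obtain ⟨r₁, hr₁, hr₁κ, hWr⟩ : ∃ r₁, 0 ≤ r₁ ∧ r₁ < κ ∧ ∀ y : C2, ‖y‖ ≤ 1 →
      ‖F^[T] (p₀ + (β : ℂ) • y) - F^[T] p₀‖ ≤ r₁ := by
    have hc : Continuous fun y : C2 => ‖F^[T] (p₀ + (β : ℂ) • y) - F^[T] p₀‖ := by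
      have := (hFd.iterate T).continuous
      fun_prop
    obtain ⟨y, hy, hmax⟩ := (isCompact_closedBall (0 : C2) 1).exists_isMaxOn
      ⟨0, Metric.mem_closedBall_self zero_le_one⟩ hc.continuousOn
    exact ⟨_, norm_nonneg _, hW T le_rfl y (mem_closedBall_zero_iff.1 hy),
      fun w hw => hmax (mem_closedBall_zero_iff.2 hw)⟩
  -- The disc around `zN` must contain the first coordinates of the whole exiting ball. Its radius
  -- avoids one value, so that `ze` is not on its boundary.
  obtain ⟨rN, hrN₁, hrNκ, hrNe⟩ : ∃ rN, r₁ < rN ∧ rN < κ ∧ ‖ze - zN‖ ≠ rN := by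
    obtain ⟨s, hs1, hs2⟩ := exists_between hr₁κ
    obtain ⟨s', hs1', hs2'⟩ := exists_between hs2
    by_cases h : ‖ze - zN‖ = s
    · exact ⟨s', hs1.trans hs1', hs2', by rw [h]; exact hs1'.ne⟩
    · exact ⟨s, hs1, hs2, h⟩
  have hrN0 : 0 < rN := hr₁.trans_lt hrN₁
  obtain ⟨ρ, hRρ, hρ⟩ := exists_between (lt_min hxo hxe)
  have hρo : ρ < ‖zo‖ := hρ.trans_le (min_le_left _ _)
  have hρe : ρ < ‖ze‖ := hρ.trans_le (min_le_right _ _)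
  -- Here the margin `3` is used: `ρ < ‖zo‖ < R + 2` and `rN < κ ≤ 1`, while `‖zN‖ > R + 3`.
  have hdN : Disjoint (Metric.closedBall 0 ρ) (Metric.closedBall zN rN) := by
    rw [Set.disjoint_left]
    intro z hz hz'
    rw [mem_closedBall_zero_iff] at hz
    rw [Metric.mem_closedBall, dist_eq_norm] at hz'
    have := norm_sub_norm_le zN z
    rw [norm_sub_rev] at this
    linarith
  have hoN : rN < ‖zo - zN‖ := by
    have := norm_sub_norm_le zN zo
    rw [norm_sub_rev] at this
    linarith
  obtain ⟨K₃, δo, δe, hK₃, hδo, hδoκ, hδe, hδeκ, h0K, hNK, hoK, heK, hd0o, hdN', hde, happ⟩ :=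
    exists_filled_configuration (show 0 < ρ by linarith) hrN0 hκ' hdN hρo hoN hρe hrNe hne
  -- the scale at the return point
  obtain ⟨δ₁, hδ₁, hsmallG⟩ := exists_small_perturbation (fun i => G^[i])
    (fun i => (hGd.iterate i).continuous) l x
    (η := min (a ^ (2 * l) * κ) (min (a * δe) (ρ - (R + 1))))
    (lt_min (by positivity) (lt_min (by positivity) (by linarith)))
  obtain ⟨δ₂, hδ₂, hsmallF⟩ := exists_small_perturbation (fun i => F^[i])
    (fun i => (hFd.iterate i).continuous) (l' + 1) x
    (η := min κ' (min δo (ρ - (R + 1))))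
    (lt_min hκ' (lt_min hδo (by linarith)))
  obtain ⟨q', hq'⟩ := exists_pow_lt_of_lt_one (lt_min hκ' (lt_min hδ₁ hδ₂))
    (show a ^ 2 < 1 by nlinarith)
  rw [← pow_mul] at hq'
  set β' := a ^ (2 * q') with hβ'
  have hβ0' : 0 < β' := by positivity
  have hsm : ∀ y : C2, ‖y‖ ≤ 1 → ‖(β' : ℂ) • y‖ ≤ β' := fun y hy => by
    rw [norm_ofReal_smul hβ0'.le]; nlinarith
  have hβκ' : β' < κ' := hq'.trans_le (min_le_left _ _)
  have hVs : ∀ i < l, ∀ y : C2, ‖y‖ ≤ 1 → ‖G^[i] (x + (β' : ℂ) • y) - G^[i] x‖ <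
      min (a ^ (2 * l) * κ) (min (a * δe) (ρ - (R + 1))) := fun i hi y hy =>
    hsmallG i hi _ ((hsm y hy).trans_lt
      (hq'.trans_le ((min_le_right _ _).trans (min_le_left _ _))))
  have hFs : ∀ i ≤ l', ∀ y : C2, ‖y‖ ≤ 1 → ‖F^[i] (x + (β' : ℂ) • y) - F^[i] x‖ <
      min κ' (min δo (ρ - (R + 1))) := fun i hi y hy =>
    hsmallF i (by omega) _ ((hsm y hy).trans_lt
      (hq'.trans_le ((min_le_right _ _).trans (min_le_right _ _))))
  -- the degree
  obtain ⟨m, hm⟩ := exists_nat_ge (C * |Real.log β'|)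
  -- The degree is chosen after the scale `β'`: it dominates the logarithm through `m`, is odd, and
  -- is large enough for the number `i₀` of idle pairs to be nonnegative. Oddness of `d * Dp` makes
  -- the exponent equation solvable.
  set d := 2 * (m + T + q + l) + 3 with hd
  have hdodd : Odd d := ⟨m + T + q + l + 1, by omega⟩
  obtain ⟨w, hw⟩ := hdodd.mul hDp
  have hdD : d ≤ d * Dp := Nat.le_mul_of_pos_right d hDp.pos
  obtain ⟨i₀, hi₀⟩ : ∃ i₀, 2 * T + 2 + 2 * i₀ + 2 * q + 2 * l + 1 = d * Dp + 2 * q' :=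
    ⟨w + q' - T - 1 - q - l, by omega⟩
  set H : C2 → C2 := fun y =>
    !₂[((a : ℂ) * y 0) ^ d + (a : ℂ) ^ (d * Dp) * y 1, (a : ℂ) ^ (d * Dp) * y 0] with hH
  have hH1 : ∀ y, ‖y‖ ≤ 1 → ‖H y‖ ≤ 1 := by
    intro y hy
    -- An auxiliary two-term degree sequence with product `d * Dp` presents `H` as a map of the
    -- required type.
    have := norm_fornaessMap_le ha ha1 (d := fun j => if j = 1 then Dp else d) (s := 2)
      (x := y) (by simp; omega) (by
        simp [degProd, Finset.prod_Icc_succ_top]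
        rw [mul_comm]; omega) hy
    have he : fornaessMap a (fun j => if j = 1 then Dp else d) 2 y = H y := by
      simp [fornaessMap, degProd, Finset.prod_Icc_succ_top, hH, mul_comm Dp d]
    rw [he] at this
    linarith
  -- the outer chain
  set J := T + 1 + 2 * i₀ + 1 + 1 + (l - 1) with hJ
  obtain ⟨g, Y, hg, hY0, hYJ, hY, hYκ⟩ := exists_relChain (κ := κ) (D := d * Dp) ha ha1' hβ hβ'
    (fun i y => F^[i] (p₀ + (β : ℂ) • y) - F^[i] p₀)
    (fun i t => f (F^[i] p₀ 0 + t) - f (F^[i] p₀ 0))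
    (fun i => ⟨(hf.comp (differentiable_id.const_add _)).sub_const _, by simp⟩)
    (fun y => by simp)
    (fun i _ y => by
      rw [Function.iterate_succ_apply', Function.iterate_succ_apply', hF, henonMap_add_sub])
    hW hβκ
    (fun i y => G^[i] (x + (β' : ℂ) • y) - G^[i] x)
    (fun i t => f (G^[i + 1] x 0 + t) - f (G^[i + 1] x 0))
    (fun i => ⟨(hf.comp (differentiable_id.const_add _)).sub_const _, by simp⟩)
    hl (fun y => by simp)
    (fun i _ y => by
      rw [← henonMap_add_sub, ← hF, Function.iterate_succ_apply' G i,
        Function.iterate_succ_apply' G i, hFG, hFG])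
    (fun i hi y hy => (hVs i hi y hy).trans_le (min_le_left _ _))
    (show 0 < d by omega) hi₀ H (fun _ => rfl) hH1
  obtain ⟨B₀, hB₀⟩ := hK₃.1.isBounded.subset_closedBall 0
  -- One constant `c` serves both for leaving `zN` towards `y 0` and for entering the segment at
  -- `G^[l - 1] x` from `ze`.
  obtain ⟨c, y, hy0, hyJ, hyB, hyy⟩ := exists_outer_points ha (show 2 ≤ J by omega) (B₀ + 2)
    (a * F^[T] p₀ 1) (G^[l - 1] x 0)
  have hKy : ∀ j < J, Disjoint K₃ (Metric.closedBall (y j) 1) := by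
    intro j hj
    rw [Set.disjoint_left]
    intro z hz hz'
    have e1 := mem_closedBall_zero_iff.1 (hB₀ hz)
    rw [Metric.mem_closedBall, dist_eq_norm] at hz'
    have e2 := norm_sub_norm_le (y j) z
    rw [norm_sub_rev] at e2
    linarith [hyB j hj]
  have hyd : ∀ i j, i < j → j < J →
      Disjoint (Metric.closedBall (y i) 1) (Metric.closedBall (y j) 1) := by
    intro i j hij hj
    refine Metric.closedBall_disjoint_closedBall ?_
    rw [dist_eq_norm]
    linarith [hyy i j hij hj]
  obtain ⟨K, hK₃K, hyK, hKcases, hKfilled, hKapp⟩ := hK₃.exists_union_closedBalls y J hKy hyd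
  obtain ⟨B₁, hB₁⟩ := hKfilled.1.isBounded.subset_closedBall 0
  set R' := max (R + 1) (B₁ + 2) with hR'
  -- The value near `zo` throws the next point beyond `R' + 3`. It may be fixed this late because
  -- `K`, and hence `R'`, does not depend on it.
  set co : ℂ := ((R' + 4 + ‖(a : ℂ) * F^[l'] x 1‖ : ℝ) : ℂ) with hco
  have hR'0 : 0 < R' := lt_of_lt_of_le (by linarith) (le_max_left _ _)
  let u : ℕ → ℂ := fun j => if j = 0 then zN else if j - 1 < J then y (j - 1) else ze
  have hu0 : u 0 = zN := rfl
  have huj : ∀ j < J, u (j + 1) = y j := fun j hj => by simp [u, hj]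
  have huJ : u (J + 1) = ze := by simp [u]
  have huJ' : u J = y (J - 1) := by
    have := huj (J - 1) (by omega)
    rwa [show J - 1 + 1 = J by omega] at this
  let Φ : ℕ → ℂ → ℂ := fun j z => g j (z - u (j + 1)) + (u (j + 2) - (a : ℂ) ^ 2 * u j)
  have hΦ : ∀ j, Differentiable ℂ (Φ j) := fun j =>
    ((hg j).1.comp (differentiable_id.sub_const _)).add_const _
  let φ : ℂ → ℂ := fun z =>
    if z ∈ Metric.closedBall (0 : ℂ) ρ then f z
    else if z ∈ Metric.closedBall zo δo then co
    else if h : ∃ j, j < J ∧ z ∈ Metric.closedBall (y j) 1 then Φ (Nat.find h) z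
    else c
  have hφ0 : ∀ z ∈ Metric.closedBall (0 : ℂ) ρ, φ z = f z := fun z hz => if_pos hz
  have hφo : ∀ z ∈ Metric.closedBall zo δo, φ z = co := fun z hz => by
    have : z ∉ Metric.closedBall (0 : ℂ) ρ := fun h => Set.disjoint_left.1 hd0o h hz
    simp only [φ]
    rw [if_neg this, if_pos hz]
  have hφy : ∀ j < J, ∀ z ∈ Metric.closedBall (y j) 1, φ z = Φ j z := fun j hj z hz => by
    have hz3 : z ∉ K₃ := fun h => Set.disjoint_left.1 (hKy j hj) h hz
    have hex : ∃ j, j < J ∧ z ∈ Metric.closedBall (y j) 1 := ⟨j, hj, hz⟩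
    have hfind : Nat.find hex = j := by
      obtain ⟨e1, e2⟩ := Nat.find_spec hex
      rcases lt_trichotomy (Nat.find hex) j with h | h | h
      · exact absurd hz (Set.disjoint_left.1 (hyd _ _ h hj) e2)
      · exact h
      · exact absurd e2 (Set.disjoint_left.1 (hyd _ _ h e1) hz)
    simp only [φ]
    rw [if_neg fun h => hz3 (h0K h), if_neg fun h => hz3 (hoK h), dif_pos hex, hfind]
  have hφc : ∀ z ∈ K₃, z ∉ Metric.closedBall 0 ρ ∪ Metric.closedBall zo δo → φ z = c := by
    intro z hz hz'
    have hex : ¬ ∃ j, j < J ∧ z ∈ Metric.closedBall (y j) 1 := by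
      rintro ⟨j, hj, hzj⟩
      exact Set.disjoint_left.1 (hKy j hj) hz hzj
    simp only [φ]
    rw [if_neg fun h => hz' (Or.inl h), if_neg fun h => hz' (Or.inr h), dif_neg hex]
  have hKφ : EntireApprox K φ := by
    refine hKapp φ (happ φ c (.of_eqOn hf hφ0) (.of_eqOn (differentiable_const co) hφo) hφc)
      fun j hj => .of_eqOn (hΦ j) (hφy j hj)
  have hint : ∀ (z : ℂ) (r : ℝ), Metric.closedBall z r ⊆ K → Metric.ball z r ⊆ interior K :=
    fun z r h => Metric.isOpen_ball.subset_interior_iff.2 (Metric.ball_subset_closedBall.trans h)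
  have hGone : ∀ i p, G^[i] p 1 = a * G^[i + 1] p 0 := fun i p => by
    rw [Function.iterate_succ_apply', ← henonMap_apply_one a f, ← hF, hFG]
  have hFGit : ∀ j i p, j ≤ i → F^[j] (G^[i] p) = G^[i - j] p := by
    intro j i p hji
    obtain ⟨k, rfl⟩ := Nat.exists_eq_add_of_le hji
    rw [Nat.add_sub_cancel_left, Function.iterate_add_apply]
    exact Function.RightInverse.iterate (hFG : Function.RightInverse G F) j _
  -- the block
  have hin0 : ∀ j < T, ‖F^[j] p₀ 0‖ < R := fun j hj => by
    simpa using hin j hj 0 (by simp)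
  have s₁ : Seg a φ (interior K) κ p₀ (fun y => (β : ℂ) • y) T (F^[T] p₀)
      (fun y => F^[T] (p₀ + (β : ℂ) • y) - F^[T] p₀) := by
    refine Seg.of_iterate (S := Metric.ball 0 ρ) (hint _ _ (h0K.trans hK₃K))
      (fun z hz => hφ0 z (Metric.ball_subset_closedBall hz)) (fun j hj => ?_) fun j hj v hv => ?_
    · rw [mem_ball_zero_iff]; linarith [hin0 j hj]
    · rw [mem_ball_zero_iff]
      exact ⟨by linarith [hin j hj v hv], hW j hj.le v hv⟩
  have s₂ : Seg a φ (interior K) κ (F^[T] p₀)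
      (fun y => F^[T] (p₀ + (β : ℂ) • y) - F^[T] p₀) 1 !₂[u 1, (a : ℂ) * u 0] (Y 0) := by
    rw [hY0]
    refine Seg.const_step (r := rN) (c := c) (hint _ _ (hNK.trans hK₃K)) (fun z hz => ?_) hrN0
      (fun v hv => (hWr v hv).trans_lt hrN₁) (fun v hv => hW T le_rfl v hv) ?_ ?_
    · have hz' := Metric.ball_subset_closedBall hz
      exact hφc z (hNK hz') fun h => Set.disjoint_left.1 hdN' h hz'
    · change u 1 = _
      rw [huj 0 (by omega), hy0]
    · rfl
  have s₃ : Seg a φ (interior K) κ !₂[u 1, (a : ℂ) * u 0] (Y 0) J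
      !₂[u (J + 1), (a : ℂ) * u J] (Y J) := by
    refine Seg.of_chain hκ1 (fun j => (hg j).2) hY hYκ (fun j hj => ?_) fun j hj z hz => ?_
    · rw [huj j hj]; exact hint _ _ (hyK j hj)
    · rw [huj j hj] at hz
      exact hφy j hj z (Metric.ball_subset_closedBall hz)
  have s₄ : Seg a φ (interior K) κ !₂[u (J + 1), (a : ℂ) * u J] (Y J) 1 (G^[l - 1] x)
      (fun v => G^[l - 1] (x + (β' : ℂ) • H v) - G^[l - 1] x) := by
    have hnorm : ∀ v : C2, ‖v‖ ≤ 1 → ‖Y J v‖ < δe := by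
      intro v hv
      rw [hYJ]
      refine norm_swap_smul_lt (by positivity) ?_
      rw [inv_mul_lt_iff₀ ha]
      exact (hVs (l - 1) (by omega) (H v) (hH1 v hv)).trans_le
        ((min_le_right _ _).trans (min_le_left _ _))
    have h := Seg.const_step (a := a) (φ := φ) (U := interior K) (κ := κ) (r := δe)
      (p := !₂[u (J + 1), (a : ℂ) * u J]) (q := G^[l - 1] x) (A := Y J) (c := c)
      (by change Metric.ball (u (J + 1)) δe ⊆ _
          rw [huJ]; exact hint _ _ (heK.trans hK₃K))
      (by
        change ∀ z ∈ Metric.ball (u (J + 1)) δe, φ z = c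
        rw [huJ]
        intro z hz
        have hz' := Metric.ball_subset_closedBall hz
        exact hφc z (heK hz') fun h => Set.disjoint_left.1 hde h hz')
      hδe hnorm (fun v hv => hYκ J le_rfl v hv)
      (by
        change _ = c + (a : ℂ) * (a * u J)
        rw [huJ', ← hyJ]; ring)
      (by
        change _ = (a : ℂ) * u (J + 1)
        rw [huJ, hGone, show l - 1 + 1 = l by omega])
    refine h.congr (fun _ _ => rfl) fun v hv => ?_
    -- The factor `a⁻¹` and the swap at the end of the chain cancel against this last constant step.
    rw [hYJ, swap_smul, swap_swap, smul_smul, ← Complex.ofReal_mul, mul_inv_cancel₀ ha.ne',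
      Complex.ofReal_one, one_smul]
  have s₅ : Seg a φ (interior K) κ (G^[l - 1] x)
      (fun v => G^[l - 1] (x + (β' : ℂ) • H v) - G^[l - 1] x) (l - 1) x
      (fun v => (β' : ℂ) • H v) := by
    have h := Seg.of_iterate (a := a) (φ := φ) (f := f) (U := interior K) (S := Metric.ball 0 ρ)
      (κ := κ) (p := G^[l - 1] x) (J := l - 1)
      (A := fun v => G^[l - 1] (x + (β' : ℂ) • H v) - G^[l - 1] x)
      (hint _ _ (h0K.trans hK₃K)) (fun z hz => hφ0 z (Metric.ball_subset_closedBall hz))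
      (fun j hj => by
        rw [← hF, hFGit j _ _ (by omega), mem_ball_zero_iff]
        linarith [hxG (l - 1 - j) (by omega)])
      (fun j hj v hv => by
        have e1 := hVs (l - 1 - j) (by omega) (H v) (hH1 v hv)
        rw [← hF, add_sub_cancel, hFGit j _ _ (by omega), hFGit j _ _ (by omega),
          mem_ball_zero_iff]
        constructor
        · have e2 := C2.norm_apply_le
            (G^[l - 1 - j] (x + (β' : ℂ) • H v) - G^[l - 1 - j] x) 0
          rw [PiLp.sub_apply] at e2
          have e3 := norm_sub_norm_le (G^[l - 1 - j] (x + (β' : ℂ) • H v) 0) (G^[l - 1 - j] x 0)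
          have e4 := e1.trans_le ((min_le_right _ _).trans (min_le_right _ _))
          linarith [hxG (l - 1 - j) (by omega)]
        · have e5 := e1.trans_le (min_le_left _ _)
          exact e5.trans_le (mul_le_of_le_one_left hκ.le (pow_le_one₀ ha.le ha1'.le)))
    simp only [← hF, add_sub_cancel, hFGit _ _ _ le_rfl, Nat.sub_self, Function.iterate_zero,
      id_eq] at h
    exact h.congr (fun _ _ => rfl) fun v _ => by rw [add_sub_cancel_left]
  -- the exit
  have s₆ : Seg a φ (interior K) κ' x (fun v => (β' : ℂ) • v) l' (F^[l'] x)
      (fun v => F^[l'] (x + (β' : ℂ) • v) - F^[l'] x) := by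
    refine Seg.of_iterate (S := Metric.ball 0 ρ) (hint _ _ (h0K.trans hK₃K))
      (fun z hz => hφ0 z (Metric.ball_subset_closedBall hz)) (fun j hj => ?_) fun j hj v hv => ?_
    · rw [mem_ball_zero_iff, ← hF]; linarith [hxF j hj]
    · rw [mem_ball_zero_iff, ← hF]
      have e1 := hFs j hj.le v hv
      refine ⟨?_, e1.trans_le (min_le_left _ _)⟩
      have e2 := C2.norm_apply_le (F^[j] (x + (β' : ℂ) • v) - F^[j] x) 0
      rw [PiLp.sub_apply] at e2
      have e3 := norm_sub_norm_le (F^[j] (x + (β' : ℂ) • v) 0) (F^[j] x 0)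
      have e4 := e1.trans_le ((min_le_right _ _).trans (min_le_right _ _))
      linarith [hxF j hj]
  have s₇ : Seg a φ (interior K) κ' (F^[l'] x)
      (fun v => F^[l'] (x + (β' : ℂ) • v) - F^[l'] x) 1
      !₂[co + (a : ℂ) * F^[l'] x 1, (a : ℂ) * zo]
      (fun v => (a : ℂ) • swap (F^[l'] (x + (β' : ℂ) • v) - F^[l'] x)) := by
    refine Seg.const_step (r := δo) (c := co) (hint _ _ (hoK.trans hK₃K))
      (fun z hz => hφo z (Metric.ball_subset_closedBall hz)) hδo
      (fun v hv => (hFs l' le_rfl v hv).trans_le ((min_le_right _ _).trans (min_le_left _ _)))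
      (fun v hv => (hFs l' le_rfl v hv).trans_le (min_le_left _ _)) rfl rfl
  refine ⟨K, φ, d, q', T + 1 + J + 1 + (l - 1), l' + 1, R', x, _, _, hdodd, by omega, by omega,
    by omega, le_max_left _ _, hx, hβκ', ?_, hKfilled.1, ?_, ?_, hKφ, ?_,
    (((s₁.trans s₂).trans s₃).trans s₄).trans s₅, s₆.trans s₇, ?_, ?_⟩
  · refine hm.trans ?_
    exact_mod_cast (show m ≤ d * Dp by omega)
  · exact (Metric.closedBall_subset_closedBall hRρ.le).trans (h0K.trans hK₃K)
  · intro z hz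
    have e1 := mem_closedBall_zero_iff.1 (hB₁ hz)
    have e2 : B₁ + 2 ≤ R' := le_max_right _ _
    linarith
  · exact fun z hz => hφ0 z (Metric.closedBall_subset_closedBall hRρ.le hz)
  · intro v hv
    refine norm_swap_smul_lt ha.le ?_
    have e1 := (hFs l' le_rfl v hv).trans_le (min_le_left _ _)
    nlinarith [norm_nonneg (F^[l'] (x + (β' : ℂ) • v) - F^[l'] x)]
  · change R' + 3 < ‖co + (a : ℂ) * F^[l'] x 1‖
    have e1 := norm_sub_le (co + (a : ℂ) * F^[l'] x 1) ((a : ℂ) * F^[l'] x 1)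
    rw [add_sub_cancel_right, hco, Complex.norm_of_nonneg (by positivity)] at e1
    rw [hco]
    linarith

/-! ### From the model to an entire function -/

theorem exists_shadowing_lt (a : ℝ) {K U : Set ℂ} (hU : IsOpen U) (hUK : U ⊆ K) {φ : ℂ → ℂ}
    (hφ : ContinuousOn φ U) {X : Set C2} (hX : IsCompact X) {A : C2 → C2} (hA : Continuous A)
    (J : ℕ) (hJ : ∀ j < J, ∀ x ∈ X, (henonMap a φ)^[j] (A x) 0 ∈ U) (c : ℕ → C2) (κ : ℝ)
    (hκ : ∀ j ≤ J, ∀ x ∈ X, ‖(henonMap a φ)^[j] (A x) - c j‖ < κ) :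
    ∃ δ > 0, ∀ f : ℂ → ℂ, (∀ z ∈ K, ‖f z - φ z‖ ≤ δ) → ∀ j ≤ J, ∀ x ∈ X,
      ‖(henonMap a f)^[j] (A x) - c j‖ < κ := by
  have h : ∀ j ∈ Finset.range (J + 1), ∀ᶠ δ : ℝ in 𝓝[>] 0, ∀ f : ℂ → ℂ,
      (∀ z ∈ K, ‖f z - φ z‖ ≤ δ) → ∀ x ∈ X, ‖(henonMap a f)^[j] (A x) - c j‖ < κ := by
    intro j hj
    have hjJ : j ≤ J := Nat.lt_succ_iff.1 (Finset.mem_range.1 hj)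
    obtain ⟨hc, hsh⟩ := exists_shadowing a hU hUK hφ hX hA j fun i hi => hJ i (by omega)
    rcases X.eq_empty_or_nonempty with rfl | hne
    · exact Eventually.of_forall fun δ f _ x hx => hx.elim
    obtain ⟨x₀, hx₀, hmax⟩ := hX.exists_isMaxOn hne
      (f := fun x => ‖(henonMap a φ)^[j] (A x) - c j‖) (hc.sub continuousOn_const).norm
    obtain ⟨δ, hδ, hδf⟩ := hsh _ (sub_pos.2 (hκ j hjJ x₀ hx₀))
    filter_upwards [Ioc_mem_nhdsGT hδ] with δ' hδ' f hf x hx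
    have e1 := hδf f (fun z hz => (hf z hz).trans hδ'.2) x hx j le_rfl
    have e2 : ‖(henonMap a φ)^[j] (A x) - c j‖ ≤ ‖(henonMap a φ)^[j] (A x₀) - c j‖ := hmax hx
    have e3 := norm_add_le ((henonMap a f)^[j] (A x) - (henonMap a φ)^[j] (A x))
      ((henonMap a φ)^[j] (A x) - c j)
    rw [sub_add_sub_cancel] at e3
    linarith
  obtain ⟨δ, hδ, hδ0⟩ := (((Finset.eventually_all _).2 h).and self_mem_nhdsWithin).exists
  exact ⟨δ, hδ0, fun f hf j hj x hx => hδ j (Finset.mem_range.2 (by omega)) f hf x hx⟩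

set_option maxHeartbeats 1000000 in
/-- One step of the construction: a new entire function, close to the old one on a large disc,
together with a stability radius `δ` for all its new properties. -/
theorem exists_return {a : ℝ} (ha : 0 < a) (ha1 : a ≤ 1 / 2) {f : ℂ → ℂ} (hf : Differentiable ℂ f)
    (h0 : f 0 = 0) (h1 : deriv f 0 = 1) {R κ κ' : ℝ} (hR : 0 < R) (hκ : 0 < κ) (hκ1 : κ ≤ 1)
    (hκ' : 0 < κ') {p₀ : C2} {T q : ℕ} (hβκ : a ^ (2 * q) < κ)
    (hN : R + 3 < ‖(henonMap a f)^[T] p₀ 0‖)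
    (hin : ∀ j < T, ∀ x : C2, ‖x‖ ≤ 1 →
      ‖(henonMap a f)^[j] (p₀ + ((a ^ (2 * q) : ℝ) : ℂ) • x) 0‖ < R)
    (hW : ∀ j ≤ T, ∀ x : C2, ‖x‖ ≤ 1 →
      ‖(henonMap a f)^[j] (p₀ + ((a ^ (2 * q) : ℝ) : ℂ) • x) - (henonMap a f)^[j] p₀‖ < κ)
    {Dp : ℕ} (hDp : Odd Dp) (C : ℝ) (E : Finset ℂ) (hE : ∀ z ∈ E, ‖z‖ ≤ R) {δ₀ : ℝ} (hδ₀ : 0 < δ₀)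
    (e : ℕ → ℝ) (he : ∀ d, Odd d → 3 ≤ d → 0 < e d) :
    ∃ (g : ℂ → ℂ) (d q' M T' : ℕ) (R' δ : ℝ),
      Odd d ∧ 3 ≤ d ∧ T < M ∧ 0 < T' ∧ R + 1 ≤ R' ∧ 0 < δ ∧ a ^ (2 * q') < κ' ∧
      C * |Real.log (a ^ (2 * q'))| ≤ (d * Dp : ℕ) ∧
      Differentiable ℂ g ∧ g 0 = 0 ∧ deriv g 0 = 1 ∧ (∀ z, ‖z‖ ≤ R → ‖g z - f z‖ ≤ δ₀) ∧
      (∀ z ∈ E, g z = f z) ∧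
      (∀ j ≤ T, (henonMap a g)^[j] p₀ = (henonMap a f)^[j] p₀) ∧
      ‖(henonMap a g)^[M] p₀‖ < κ ∧ R' + 3 < ‖(henonMap a g)^[M + T'] p₀ 0‖ ∧
      (∀ j < M + T', ‖(henonMap a g)^[j] p₀ 0‖ + 1 < R') ∧
      ∀ h : ℂ → ℂ, (∀ z, ‖z‖ ≤ R' → ‖h z - g z‖ < δ) →
        (∀ j < M, ∀ y : C2, ‖y‖ ≤ 1 →
          ‖(henonMap a h)^[j] (p₀ + ((a ^ (2 * q) : ℝ) : ℂ) • y) - (henonMap a g)^[j] p₀‖ < κ) ∧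
        (∀ y : C2, ‖y‖ ≤ 1 → ‖(henonMap a h)^[M] (p₀ + ((a ^ (2 * q) : ℝ) : ℂ) • y)
          - ((henonMap a g)^[M] p₀ + ((a ^ (2 * q') : ℝ) : ℂ) •
            (!₂[((a : ℂ) * y 0) ^ d + (a : ℂ) ^ (d * Dp) * y 1, (a : ℂ) ^ (d * Dp) * y 0] : C2))‖
            < a ^ (2 * q') * e d) ∧
        (∀ j ≤ T', ∀ y : C2, ‖y‖ ≤ 1 →
          ‖(henonMap a h)^[j] ((henonMap a g)^[M] p₀ + ((a ^ (2 * q') : ℝ) : ℂ) • y)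
            - (henonMap a g)^[M + j] p₀‖ < κ') := by
  classical
  obtain ⟨K, φ, d, q', M, T', R', x, pT, B, hd, hd3, hTM, hT', hRR', hx, hq', hC, hK, hRK, hKR,
    hφ, hφf, hseg, hseg', hB, hpT⟩ :=
    exists_model ha ha1 hf h0 h1 hR hκ hκ1 hκ' hβκ hN hin hW hDp C
  obtain ⟨s1, s2, s3⟩ := hseg
  obtain ⟨t1, t2, t3⟩ := hseg'
  have hφc : ContinuousOn φ (interior K) := hφ.continuousOn.mono interior_subset
  have hX := isCompact_closedBall (0 : C2) 1
  set A : C2 → C2 := fun y => p₀ + ((a ^ (2 * q) : ℝ) : ℂ) • y with hA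
  set A' : C2 → C2 := fun y => x + ((a ^ (2 * q') : ℝ) : ℂ) • y with hA'
  have hAc : Continuous A := by fun_prop
  have hAc' : Continuous A' := by fun_prop
  have hmem : ∀ {y : C2}, y ∈ Metric.closedBall (0 : C2) 1 ↔ ‖y‖ ≤ 1 :=
    fun {y} => mem_closedBall_zero_iff
  obtain ⟨-, hsh⟩ := exists_shadowing a isOpen_interior interior_subset hφc hX hAc M
    fun j hj y hy => (s3 j hj y (hmem.1 hy)).1
  obtain ⟨δ₁, hδ₁, hsh₁⟩ := hsh (a ^ (2 * q') * e d) (mul_pos (by positivity) (he d hd hd3))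
  -- Only times before `M` are needed here; the return at time `M` obeys the finer estimate from
  -- `δ₁`.
  obtain ⟨δ₂, hδ₂, hsh₂⟩ := exists_shadowing_lt a isOpen_interior interior_subset hφc hX hAc (M - 1)
    (fun j hj y hy => (s3 j (by omega) y (hmem.1 hy)).1) (fun j => (henonMap a φ)^[j] p₀) κ
    fun j hj y hy => (s3 j (by omega) y (hmem.1 hy)).2
  obtain ⟨δ₃, hδ₃, hsh₃⟩ := exists_shadowing_lt a isOpen_interior interior_subset hφc hX hAc' T'
    (fun j hj y hy => (t3 j (by omega) y (hmem.1 hy)).1) (fun j => (henonMap a φ)^[j] x) κ'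
    fun j hj y hy => by
      rcases hj.lt_or_eq with h | rfl
      · exact (t3 j h y (hmem.1 hy)).2
      · have := t2 y (hmem.1 hy)
        simp only [A']
        rw [this, t1, add_sub_cancel_left]
        exact hB y (hmem.1 hy)
  set δ : ℝ := min δ₁ (min δ₂ δ₃) with hδ
  have hδ0 : 0 < δ := by positivity
  -- the orbit of the centre stays over `K`
  have hnode : ∀ j < M + T', (henonMap a φ)^[j] p₀ 0 ∈ K := by
    intro j hj
    rcases lt_or_ge j M with h | h
    · have := (s3 j h 0 (by simp)).1
      simp only [smul_zero, add_zero] at this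
      exact interior_subset this
    · obtain ⟨i, rfl⟩ := Nat.exists_eq_add_of_le h
      have := (t3 i (by omega) 0 (by simp)).1
      simp only [smul_zero, add_zero] at this
      rw [add_comm, Function.iterate_add_apply, s1]
      exact interior_subset this
  set E' : Finset ℂ := E ∪ (Finset.range (M + T')).image fun j => (henonMap a φ)^[j] p₀ 0 with hE'
  have hE'K : ↑E' ⊆ K := by
    intro z hz
    rcases Finset.mem_union.1 (Finset.mem_coe.1 hz) with h | h
    · exact hRK (mem_closedBall_zero_iff.2 ((hE z h).trans (by linarith)))
    · obtain ⟨j, hj, rfl⟩ := Finset.mem_image.1 h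
      exact hnode j (Finset.mem_range.1 hj)
  -- Interpolating at the nodes of the model orbit keeps the orbit of `p₀` exact, and `E` does the
  -- same for earlier orbit points. Half of `δ` is spent here; the other half is left as stability
  -- radius.
  obtain ⟨g, hg, hgφ, hgE, hg0, hg1⟩ := hφ.exists_interpolating hK E' hE'K
    (show 0 < R + 1 by linarith) hRK hf hφf (η := min (δ / 2) δ₀) (by positivity)
  have hφball : ∀ z : ℂ, ‖z‖ ≤ R + 1 → φ z = f z := fun z hz =>
    hφf z (mem_closedBall_zero_iff.2 hz)
  have hgorb : ∀ j ≤ M + T', (henonMap a g)^[j] p₀ = (henonMap a φ)^[j] p₀ :=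
    iterate_henonMap_congr (S := ↑E') (fun z hz => hgE z hz) fun j hj =>
      Finset.mem_coe.2 (Finset.mem_union_right _
        (Finset.mem_image.2 ⟨j, Finset.mem_range.2 hj, rfl⟩))
  have hφorb : ∀ j ≤ T, (henonMap a φ)^[j] p₀ = (henonMap a f)^[j] p₀ :=
    iterate_henonMap_congr (S := Metric.closedBall 0 (R + 1)) hφf fun j hj => by
      have := hin j hj 0 (by simp)
      rw [smul_zero, add_zero] at this
      exact mem_closedBall_zero_iff.2 (by linarith)
  have hMT : ∀ j, (henonMap a φ)^[M + j] p₀ = (henonMap a φ)^[j] x := fun j => by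
    rw [add_comm, Function.iterate_add_apply, s1]
  refine ⟨g, d, q', M, T', R', δ / 2, hd, hd3, hTM, hT', hRR', by positivity, hq', hC, hg, ?_, ?_,
    fun z hz => ?_, fun z hz => ?_, fun j hj => ?_, ?_, ?_, fun j hj => ?_, fun h hh => ?_⟩
  · rw [hg0, hφball 0 (by simp; linarith), h0]
  · rw [hg1, h1]
  · rw [← hφball z (by linarith)]
    exact (hgφ z (hRK (mem_closedBall_zero_iff.2 (by linarith)))).trans (min_le_right _ _)
  · rw [hgE z (Finset.mem_union_left _ hz), hφball z ((hE z hz).trans (by linarith))]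
  · rw [hgorb j (by omega), hφorb j hj]
  · rw [hgorb M (by omega), s1]; exact hx
  · rw [hgorb _ le_rfl, hMT, t1]; exact hpT
  · rw [hgorb j hj.le]; exact hKR _ (hnode j hj)
  · have hhφ : ∀ z ∈ K, ‖h z - φ z‖ ≤ δ := fun z hz => by
      have e1 := hh z (by linarith [hKR z hz])
      have e2 := (hgφ z hz).trans (min_le_left _ _)
      have e3 := norm_add_le (h z - g z) (g z - φ z)
      rw [sub_add_sub_cancel] at e3
      linarith
    refine ⟨fun j hj y hy => ?_, fun y hy => ?_, fun j hj y hy => ?_⟩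
    · rw [hgorb j (by omega)]
      exact hsh₂ h (fun z hz => (hhφ z hz).trans ((min_le_right _ _).trans (min_le_left _ _))) j
        (by omega) y (hmem.2 hy)
    · rw [hgorb M (by omega), s1, ← s2 y hy]
      exact hsh₁ h (fun z hz => (hhφ z hz).trans (min_le_left _ _)) y (hmem.2 hy) M le_rfl
    · rw [hgorb M (by omega), hgorb _ (by omega), hMT, s1]
      exact hsh₃ h (fun z hz => (hhφ z hz).trans ((min_le_right _ _).trans (min_le_right _ _))) j
        hj y (hmem.2 hy)

/-! ### Stages and the inductive step -/

theorem degProd_succ (d : ℕ → ℕ) (s : ℕ) : degProd d (s + 1) = d (s + 1) * degProd d s := by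
  rw [degProd, degProd, Finset.prod_Icc_succ_top (by omega), mul_comm]

theorem degProd_congr {d d' : ℕ → ℕ} {s : ℕ} (h : ∀ j ≤ s, d j = d' j) :
    degProd d s = degProd d' s :=
  Finset.prod_congr rfl fun j hj => h j (Finset.mem_Icc.1 hj).2

theorem fornaessMap_congr (a : ℝ) {d d' : ℕ → ℕ} {s : ℕ} (h : ∀ j ≤ s, d j = d' j) :
    fornaessMap a d s = fornaessMap a d' s := by
  funext p
  rw [fornaessMap, fornaessMap, degProd_congr h, h s le_rfl]

theorem three_le_degProd {d : ℕ → ℕ} {s : ℕ} (hs : 1 ≤ s) (h : ∀ j, 1 ≤ j → j ≤ s → 3 ≤ d j) :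
    3 ≤ degProd d s := by
  obtain ⟨t, rfl⟩ : ∃ t, s = t + 1 := ⟨s - 1, by omega⟩
  rw [degProd_succ]
  have h1 : 0 < degProd d t := Finset.prod_pos fun j hj => by
    have := Finset.mem_Icc.1 hj
    have := h j this.1 (by omega)
    omega
  exact (h (t + 1) hs le_rfl).trans (Nat.le_mul_of_pos_right _ h1)

/-- The data of a finite stage of the construction. -/
structure Stage where
  /-- the entire function -/
  f : ℂ → ℂ
  /-- the orbit, relevant up to time `N` -/
  P : ℕ → C2
  /-- the time of return near the origin -/
  n : ℕ
  /-- the time of exit -/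
  N : ℕ
  /-- the scale at time `n` is `a ^ (2 * q)` -/
  q : ℕ
  /-- the radius of the controlled disc -/
  R : ℝ
  /-- the stability radius -/
  δ : ℝ
  /-- the degrees chosen so far -/
  d : ℕ → ℕ

/-- The scale of a stage. -/
noncomputable def Stage.scale (a : ℝ) (S : Stage) : ℝ := a ^ (2 * S.q)

/-- The properties of the `k`-th stage that are used to construct the next one. -/
structure Stage.IsGood (a : ℝ) (k : ℕ) (S : Stage) : Prop where
  diff : Differentiable ℂ S.f
  zero : S.f 0 = 0
  deriv_zero : deriv S.f 0 = 1
  R_pos : 0 < S.R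
  δ_pos : 0 < S.δ
  n_le_N : S.n ≤ S.N
  orbit : ∀ m < S.N, henonMap a S.f (S.P m) = S.P (m + 1)
  bounded : ∀ m < S.N, ‖S.P m 0‖ + 1 < S.R
  exit : S.R + 3 < ‖S.P S.N 0‖
  scale_lt : S.scale a < 1 / ((k : ℝ) + 1)
  tail : ∀ j ≤ S.N - S.n, ∀ y : C2, ‖y‖ ≤ 1 →
    ‖(henonMap a S.f)^[j] (S.P S.n + (S.scale a : ℂ) • y) - S.P (S.n + j)‖ < 1 / ((k : ℝ) + 1)
  odd : Odd (degProd S.d k)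
  odd_d : ∀ j, 1 ≤ j → j ≤ k → Odd (S.d j) ∧ 3 ≤ S.d j

/-- The relation between the `k`-th stage and the following one. -/
structure Stage.IsNext (a : ℝ) (ε : (s : ℕ) → (Fin s → (C2 → C2)) → ℝ) (k : ℕ) (S S' : Stage) :
    Prop where
  P_eq : ∀ m ≤ S.N, S'.P m = S.P m
  d_eq : ∀ j ≤ k, S'.d j = S.d j
  N_lt_n : S.N < S'.n
  n_lt_N : S'.n < S'.N
  R_le : S.R + 1 ≤ S'.R
  close : ∀ z, ‖z‖ ≤ S.R → ‖S'.f z - S.f z‖ ≤ min ((1 / 2) ^ (k + 1)) (S.δ / 2)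
  δ_le : S'.δ ≤ S.δ / 2
  near : ‖S'.P S'.n‖ < 1 / ((k : ℝ) + 1)
  log_le : ((k : ℝ) + 1) * |Real.log (S'.scale a)| ≤ (degProd S'.d (k + 1) : ℝ)
  stable : ∀ h : ℂ → ℂ, (∀ z, ‖z‖ ≤ S'.R → ‖h z - S'.f z‖ < S'.δ) →
    (∀ j < S'.n - S.n, ∀ y : C2, ‖y‖ ≤ 1 →
      ‖(henonMap a h)^[j] (S.P S.n + (S.scale a : ℂ) • y) - S'.P (S.n + j)‖
        < 1 / ((k : ℝ) + 1)) ∧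
    ∀ y : C2, ‖y‖ ≤ 1 → ‖(henonMap a h)^[S'.n - S.n] (S.P S.n + (S.scale a : ℂ) • y)
      - (S'.P S'.n + (S'.scale a : ℂ) • fornaessMap a S'.d (k + 1) y)‖
      < S'.scale a * min (ε (k + 1) fun j => fornaessMap a S'.d ((j : ℕ) + 1))
        (a ^ degProd S'.d (k + 1))

theorem fornaessMap_admissible {a : ℝ} (ha : 0 < a) (ha1 : a ≤ 1 / 2) {d : ℕ → ℕ} {s : ℕ}
    (hs : 1 ≤ s) (h : ∀ j, 1 ≤ j → j ≤ s → 3 ≤ d j) :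
    IsHolAut (fornaessMap a d s) ∧ RelCompactIn (fornaessMap a d s '' Metric.ball (0 : C2) 1)
      (Metric.ball (0 : C2) 1) := by
  have hA := isHolAut_fornaessMap ha.ne' d s
  refine ⟨hA, relCompactIn_image_ball hA.1.continuous fun x hx => ?_⟩
  rw [mem_ball_zero_iff]
  have := norm_fornaessMap_le ha ha1 (h s hs le_rfl) (three_le_degProd hs h)
    (mem_closedBall_zero_iff.1 hx)
  linarith

theorem Stage.IsGood.iterate_eq {a : ℝ} {k : ℕ} {S : Stage} (hS : S.IsGood a k) :
    ∀ j ≤ S.N - S.n, (henonMap a S.f)^[j] (S.P S.n) = S.P (S.n + j) := by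
  intro j
  induction j with
  | zero => intro _; rfl
  | succ j ih =>
    intro hj
    rw [Function.iterate_succ_apply', ih (by omega), hS.orbit _ (by omega)]
    rfl

/-- This is `exists_return` applied from time `S.n`, with bound `1 / (k + 1)` before the new return
and `1 / (k + 2)` after it. The tolerance is a function of the new degree, since `ε` is evaluated on
a family containing the new map. -/
theorem Stage.IsGood.exists_next {a : ℝ} (ha : 0 < a) (ha1 : a ≤ 1 / 2)
    {ε : (s : ℕ) → (Fin s → (C2 → C2)) → ℝ}
    (hε : ∀ (s : ℕ) (G : Fin s → (C2 → C2)),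
      (∀ j, IsHolAut (G j) ∧
        RelCompactIn (G j '' Metric.ball (0 : C2) 1) (Metric.ball (0 : C2) 1)) → 0 < ε s G)
    {k : ℕ} {S : Stage} (hS : S.IsGood a k) :
    ∃ S' : Stage, S'.IsGood a (k + 1) ∧ S.IsNext a ε k S' := by
  classical
  have hk1 : (0 : ℝ) < (k : ℝ) + 1 := by positivity
  have hκ1 : 1 / ((k : ℝ) + 1) ≤ 1 := by
    rw [div_le_one hk1]; linarith [(Nat.cast_nonneg k : (0 : ℝ) ≤ k)]
  have hnN := hS.n_le_N
  have horb := hS.iterate_eq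
  let dd : ℕ → ℕ → ℕ := fun v => Function.update S.d (k + 1) v
  have hdd1 : ∀ v, dd v (k + 1) = v := fun v => by simp [dd]
  have hdd : ∀ v, ∀ j ≤ k, dd v j = S.d j := fun v j hj => by
    have : j ≠ k + 1 := by omega
    simp [dd, this]
  have hdeg : ∀ v, degProd (dd v) (k + 1) = v * degProd S.d k := fun v => by
    rw [degProd_succ, hdd1, degProd_congr (hdd v)]
  have hd3 : ∀ v, Odd v → 3 ≤ v → ∀ j, 1 ≤ j → j ≤ k + 1 → Odd (dd v j) ∧ 3 ≤ dd v j := by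
    intro v hv hv3 j hj hjk
    rcases Nat.lt_or_ge k j with h | h
    · obtain rfl : j = k + 1 := by omega
      rw [hdd1]; exact ⟨hv, hv3⟩
    · rw [hdd v j h]; exact hS.odd_d j hj h
  obtain ⟨g, v, q', M, T', R', δ, hv, hv3, hTM, hT', hRR', hδ, hq', hlog, hg, hg0, hg1, hgf, hgE,
    hgT, hgM, hgexit, hgR, hstab⟩ := exists_return ha ha1 hS.diff hS.zero hS.deriv_zero
    (κ := 1 / ((k : ℝ) + 1)) (κ' := 1 / (((k + 1 : ℕ) : ℝ) + 1)) hS.R_pos (by positivity) hκ1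
    (by positivity) (p₀ := S.P S.n) (T := S.N - S.n) (q := S.q) hS.scale_lt
    (by
      rw [horb _ le_rfl, Nat.add_sub_cancel' hnN]; exact hS.exit)
    (fun j hj y hy => by
      have e1 := hS.tail j hj.le y hy
      have e2 := C2.norm_apply_le ((henonMap a S.f)^[j] (S.P S.n + (S.scale a : ℂ) • y)
        - S.P (S.n + j)) 0
      rw [PiLp.sub_apply] at e2
      have e3 := norm_sub_norm_le ((henonMap a S.f)^[j] (S.P S.n + (S.scale a : ℂ) • y) 0)
        (S.P (S.n + j) 0)
      have e4 := hS.bounded (S.n + j) (by omega)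
      change ‖(henonMap a S.f)^[j] (S.P S.n + (S.scale a : ℂ) • y) 0‖ < S.R
      linarith)
    (fun j hj y hy => by
      rw [horb j hj]; exact hS.tail j hj y hy)
    hS.odd ((k : ℝ) + 1) ((Finset.range S.N).image fun m => S.P m 0)
    (fun z hz => by
      obtain ⟨m, hm, rfl⟩ := Finset.mem_image.1 hz
      linarith [hS.bounded m (Finset.mem_range.1 hm)])
    (δ₀ := min ((1 / 2) ^ (k + 1)) (S.δ / 2)) (lt_min (by positivity) (half_pos hS.δ_pos))
    (fun v => min (ε (k + 1) fun j => fornaessMap a (dd v) ((j : ℕ) + 1))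
      (a ^ degProd (dd v) (k + 1)))
    (fun v hv hv3 => lt_min (hε _ _ fun j => fornaessMap_admissible ha ha1 (by omega)
      fun i hi hij => (hd3 v hv hv3 i hi (by omega)).2) (by positivity))
  set P' : ℕ → C2 := fun m => if m ≤ S.N then S.P m else (henonMap a g)^[m - S.n] (S.P S.n) with hP'
  have hP'old : ∀ m ≤ S.N, P' m = S.P m := fun m hm => if_pos hm
  have hP'new : ∀ j, P' (S.n + j) = (henonMap a g)^[j] (S.P S.n) := by
    intro j
    by_cases h : S.n + j ≤ S.N
    · rw [hP'old _ h, hgT j (by omega), horb j (by omega)]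
    · simp only [hP']
      rw [if_neg h, Nat.add_sub_cancel_left]
  -- Halving the stability radius ensures that all later corrections together stay within the old
  -- one.
  refine ⟨⟨g, P', S.n + M, S.n + M + T', q', R', min δ (S.δ / 2), dd v⟩, ?_, ?_⟩
  · refine ⟨hg, hg0, hg1, by linarith [hS.R_pos], lt_min hδ (half_pos hS.δ_pos),
      Nat.le_add_right _ _, ?_, ?_, ?_, hq', ?_, ?_, hd3 v hv hv3⟩
    · intro m hm
      change henonMap a g (P' m) = P' (m + 1)
      rcases lt_or_ge m S.N with h | h
      · rw [hP'old m h.le, hP'old (m + 1) h, ← hS.orbit m h]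
        apply C2.ext
        · rw [henonMap_apply_zero, henonMap_apply_zero,
            hgE _ (Finset.mem_image.2 ⟨m, Finset.mem_range.2 h, rfl⟩)]
        · rfl
      · obtain ⟨j, rfl⟩ := Nat.exists_eq_add_of_le (hnN.trans h)
        rw [add_assoc, hP'new, hP'new, Function.iterate_succ_apply']
    · intro m hm
      change ‖P' m 0‖ + 1 < R'
      rcases lt_or_ge m S.n with h | h
      · rw [hP'old m (by omega)]
        linarith [hS.bounded m (by omega)]
      · obtain ⟨j, rfl⟩ := Nat.exists_eq_add_of_le h
        rw [hP'new]
        refine hgR j ?_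
        change S.n + j < S.n + M + T' at hm
        omega
    · change R' + 3 < ‖P' (S.n + M + T') 0‖
      rw [add_assoc, hP'new]; exact hgexit
    · intro j hj y hy
      have hj' : j ≤ T' := by
        change j ≤ S.n + M + T' - (S.n + M) at hj
        omega
      -- The tail estimate for `g` itself is stability with the trivial perturbation.
      obtain ⟨-, -, h3⟩ := hstab g fun z _ => by rw [sub_self, norm_zero]; exact hδ
      have := h3 j hj' y hy
      rw [← hP'new, ← hP'new, ← add_assoc] at this
      exact this
    · change Odd (degProd (dd v) (k + 1))
      rw [hdeg]; exact hv.mul hS.odd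
  · refine ⟨hP'old, hdd v, ?_, ?_, hRR', hgf, min_le_right _ _, ?_, ?_, ?_⟩
    · change S.N < S.n + M
      omega
    · change S.n + M < S.n + M + T'
      omega
    · change ‖P' (S.n + M)‖ < _
      rw [hP'new]; exact hgM
    · change ((k : ℝ) + 1) * |Real.log (a ^ (2 * q'))| ≤ (degProd (dd v) (k + 1) : ℝ)
      rw [hdeg]; exact hlog
    · intro h hh
      obtain ⟨h1, h2, -⟩ := hstab h fun z hz => (hh z hz).trans_le (min_le_left _ _)
      constructor
      · intro j hj y hy
        have hj' : j < M := by
          change j < S.n + M - S.n at hj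
          omega
        change ‖_ - P' (S.n + j)‖ < _
        rw [hP'new]
        exact h1 j hj' y hy
      · intro y hy
        have := h2 y hy
        rw [← hP'new] at this
        change ‖(henonMap a h)^[S.n + M - S.n] _ - (P' (S.n + M) + _)‖ < _
        rw [Nat.add_sub_cancel_left]
        have he : fornaessMap a (dd v) (k + 1) y = !₂[((a : ℂ) * y 0) ^ v
            + (a : ℂ) ^ (v * degProd S.d k) * y 1, (a : ℂ) ^ (v * degProd S.d k) * y 0] := by
          rw [fornaessMap, hdeg, hdd1]
        rw [he]
        exact this

/-- The stage before any return. -/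
noncomputable def Stage.initial : Stage :=
  ⟨fun z => z, fun _ => !₂[5, 0], 0, 0, 1, 1, 1, fun _ => 1⟩

theorem Stage.initial_isGood {a : ℝ} (ha : 0 < a) (ha1 : a ≤ 1 / 2) :
    Stage.initial.IsGood a 0 := by
  have hs : Stage.initial.scale a < 1 := by
    exact pow_lt_one₀ ha.le (by linarith) (show 2 * 1 ≠ 0 by norm_num)
  have hs0 : 0 < Stage.initial.scale a := by
    change 0 < a ^ (2 * 1)
    positivity
  refine ⟨differentiable_id, rfl, deriv_id 0, one_pos, one_pos, le_rfl,
    fun m hm => absurd hm (Nat.not_lt_zero m), fun m hm => absurd hm (Nat.not_lt_zero m), ?_, ?_,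
    fun j hj y hy => ?_, by simp [degProd], fun j h1 h2 => by omega⟩
  · change (1 : ℝ) + 3 < ‖(5 : ℂ)‖
    norm_num
  · simpa using hs
  · obtain rfl : j = 0 := Nat.le_zero.1 hj
    change ‖Stage.initial.P 0 + (Stage.initial.scale a : ℂ) • y - Stage.initial.P 0‖ < _
    rw [add_sub_cancel_left, norm_ofReal_smul hs0.le]
    simp only [Nat.cast_zero, zero_add, div_one]
    nlinarith [norm_nonneg y]

theorem exists_stages {a : ℝ} (ha : 0 < a) (ha1 : a ≤ 1 / 2)
    {ε : (s : ℕ) → (Fin s → (C2 → C2)) → ℝ}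
    (hε : ∀ (s : ℕ) (G : Fin s → (C2 → C2)),
      (∀ j, IsHolAut (G j) ∧
        RelCompactIn (G j '' Metric.ball (0 : C2) 1) (Metric.ball (0 : C2) 1)) → 0 < ε s G) :
    ∃ S : ℕ → Stage, S 0 = Stage.initial ∧ (∀ k, (S k).IsGood a k) ∧
      ∀ k, (S k).IsNext a ε k (S (k + 1)) := by
  have hex : ∀ k (S : {S : Stage // S.IsGood a k}),
      ∃ S' : {S : Stage // S.IsGood a (k + 1)}, S.1.IsNext a ε k S'.1 := fun k S => by
    obtain ⟨S', h1, h2⟩ := S.2.exists_next ha ha1 hε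
    exact ⟨⟨S', h1⟩, h2⟩
  choose nxt hnxt using hex
  let S : (k : ℕ) → {S : Stage // S.IsGood a k} := fun k =>
    Nat.rec ⟨Stage.initial, Stage.initial_isGood ha ha1⟩ (fun k S => nxt k S) k
  exact ⟨fun k => (S k).1, rfl, fun k => (S k).2, fun k => hnxt k (S k)⟩

/-! ### The sequence of stages: diagonal data, radii and nested balls -/

theorem exists_smul_of_mem_closedBall {p x : C2} {β : ℝ} (hβ : 0 < β)
    (hx : x ∈ Metric.closedBall p β) : ∃ y : C2, ‖y‖ ≤ 1 ∧ p + (β : ℂ) • y = x := by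
  refine ⟨scaleFrom p β x, ?_, scaleTo_scaleFrom p hβ.ne' x⟩
  rw [Metric.mem_closedBall, dist_eq_norm] at hx
  rw [scaleFrom, norm_smul, norm_inv, Complex.norm_of_nonneg hβ.le, inv_mul_le_iff₀ hβ]
  linarith

section StageSequence

variable {a : ℝ} {ε : (s : ℕ) → (Fin s → (C2 → C2)) → ℝ} {S : ℕ → Stage}

theorem Stage.strictMono_n (hG : ∀ k, (S k).IsGood a k) (hS : ∀ k, (S k).IsNext a ε k (S (k + 1))) :
    StrictMono fun k => (S k).n :=
  strictMono_nat_of_lt_succ fun k => ((hG k).n_le_N).trans_lt (hS k).N_lt_n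

theorem Stage.strictMono_N (hS : ∀ k, (S k).IsNext a ε k (S (k + 1))) :
    StrictMono fun k => (S k).N :=
  strictMono_nat_of_lt_succ fun k => (hS k).N_lt_n.trans (hS k).n_lt_N

theorem Stage.strictMono_R (hS : ∀ k, (S k).IsNext a ε k (S (k + 1))) :
    StrictMono fun k => (S k).R :=
  strictMono_nat_of_lt_succ fun k => by linarith [(hS k).R_le]

theorem Stage.P_stable (hS : ∀ k, (S k).IsNext a ε k (S (k + 1))) {i k : ℕ} (hik : i ≤ k) :
    ∀ m ≤ (S i).N, (S k).P m = (S i).P m := by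
  induction k, hik using Nat.le_induction with
  | base => exact fun m _ => rfl
  | succ k hk ih =>
    intro m hm
    rw [(hS k).P_eq m (hm.trans ((Stage.strictMono_N hS).monotone hk)), ih m hm]

/-- The orbit value at time `m` is final from stage `m` on, because `m ≤ (S m).N`; the limit orbit
can therefore be read off the diagonal. -/
theorem Stage.P_diag (hS : ∀ k, (S k).IsNext a ε k (S (k + 1))) {k m : ℕ} (hm : m ≤ (S k).N) :
    (S m).P m = (S k).P m := by
  rcases le_total k m with h | h
  · exact Stage.P_stable hS h m hm
  · exact (Stage.P_stable hS h m ((Stage.strictMono_N hS).id_le m)).symm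

theorem Stage.d_diag (hS : ∀ k, (S k).IsNext a ε k (S (k + 1))) {j k : ℕ} (hjk : j ≤ k) :
    (S j).d j = (S k).d j := by
  induction k, hjk using Nat.le_induction with
  | base => rfl
  | succ k hk ih => rw [ih, (hS k).d_eq j hk]

/-- The sum telescopes: each correction is at most `δ / 2`, which is at most the drop from one
stability radius to the next. -/
theorem Stage.norm_f_sub_le (hS : ∀ k, (S k).IsNext a ε k (S (k + 1))) {i k : ℕ} (hik : i ≤ k)
    {z : ℂ} (hz : ‖z‖ ≤ (S i).R) : ‖(S k).f z - (S i).f z‖ ≤ (S i).δ - (S k).δ := by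
  induction k, hik using Nat.le_induction with
  | base => simp
  | succ k hk ih =>
    have h1 := ((hS k).close z (hz.trans ((Stage.strictMono_R hS).monotone hk))).trans
      (min_le_right _ _)
    have h2 := norm_add_le ((S (k + 1)).f z - (S k).f z) ((S k).f z - (S i).f z)
    rw [sub_add_sub_cancel] at h2
    linarith [(hS k).δ_le]

theorem Stage.norm_f_sub_lt (hG : ∀ k, (S k).IsGood a k)
    (hS : ∀ k, (S k).IsNext a ε k (S (k + 1))) {i k : ℕ} (hik : i ≤ k)
    (z : ℂ) (hz : ‖z‖ ≤ (S i).R) : ‖(S k).f z - (S i).f z‖ < (S i).δ := by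
  linarith [Stage.norm_f_sub_le hS hik hz, (hG k).δ_pos]

/-- The index of the return interval containing the time `m`. -/
noncomputable def returnIndex (n : ℕ → ℕ) (m : ℕ) : ℕ := Nat.findGreatest (fun k => n k ≤ m) m

theorem returnIndex_eq {n : ℕ → ℕ} (hn : StrictMono n) {k m : ℕ} (h1 : n k ≤ m)
    (h2 : m < n (k + 1)) : returnIndex n m = k := by
  refine Nat.findGreatest_eq_iff.2 ⟨(hn.id_le k).trans h1, fun _ => h1, fun i hki _ hi => ?_⟩
  have := hn.monotone (show k + 1 ≤ i from hki)
  omega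

theorem le_returnIndex {n : ℕ → ℕ} (hn : StrictMono n) {k m : ℕ} (h : n k ≤ m) :
    k ≤ returnIndex n m :=
  Nat.le_findGreatest ((hn.id_le k).trans h) h

/-- The radii: `a ^ (2 * q)` at the return times, and `1 / (k + 1)` strictly after the `k`-th
return and before the next one. -/
noncomputable def returnRadius (a : ℝ) (S : ℕ → Stage) (m : ℕ) : ℝ :=
  if m = (S (returnIndex (fun k => (S k).n) m)).n
  then (S (returnIndex (fun k => (S k).n) m)).scale a
  else 1 / ((returnIndex (fun k => (S k).n) m : ℝ) + 1)

theorem returnRadius_n (hn : StrictMono fun k => (S k).n) (k : ℕ) :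
    returnRadius a S (S k).n = (S k).scale a := by
  have h : returnIndex (fun k => (S k).n) (S k).n = k :=
    returnIndex_eq (n := fun k => (S k).n) hn le_rfl (hn (Nat.lt_succ_self k))
  rw [returnRadius, h, if_pos rfl]

theorem returnRadius_of_lt (hn : StrictMono fun k => (S k).n) {k m : ℕ} (h1 : (S k).n < m)
    (h2 : m < (S (k + 1)).n) : returnRadius a S m = 1 / ((k : ℝ) + 1) := by
  have h : returnIndex (fun k => (S k).n) m = k :=
    returnIndex_eq (n := fun k => (S k).n) hn h1.le h2
  rw [returnRadius, h, if_neg h1.ne']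

theorem returnRadius_pos (ha : 0 < a) (m : ℕ) : 0 < returnRadius a S m := by
  unfold returnRadius Stage.scale
  split_ifs <;> positivity

theorem returnRadius_le (hG : ∀ k, (S k).IsGood a k) (m : ℕ) :
    returnRadius a S m ≤ 1 / ((returnIndex (fun k => (S k).n) m : ℝ) + 1) := by
  unfold returnRadius
  split_ifs
  · exact (hG _).scale_lt.le
  · exact le_rfl

theorem returnRadius_le_one (hG : ∀ k, (S k).IsGood a k) (m : ℕ) : returnRadius a S m ≤ 1 := by
  refine (returnRadius_le hG m).trans ?_
  rw [div_le_one (by positivity)]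
  linarith [(Nat.cast_nonneg (returnIndex (fun k => (S k).n) m) :
    (0 : ℝ) ≤ (returnIndex (fun k => (S k).n) m : ℝ))]

theorem tendsto_returnRadius (ha : 0 < a) (hG : ∀ k, (S k).IsGood a k)
    (hn : StrictMono fun k => (S k).n) : Tendsto (returnRadius a S) atTop (𝓝 0) := by
  have hidx : Tendsto (returnIndex fun k => (S k).n) atTop atTop :=
    tendsto_atTop.2 fun b => (eventually_ge_atTop (S b).n).mono fun m hm =>
      le_returnIndex (n := fun k => (S k).n) hn hm
  exact squeeze_zero (fun m => (returnRadius_pos ha m).le) (returnRadius_le hG)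
    (tendsto_one_div_add_atTop_nhds_zero_nat.comp hidx)

/-- In units of the new scale, the image of `H` has norm at most `3 / 8` and the error is less than
`1 / 2`, so the sum stays below `1`. -/
theorem Stage.IsNext.norm_return_lt (ha : 0 < a) (ha1 : a ≤ 1 / 2) {k : ℕ} {S S' : Stage}
    (hS' : S'.IsGood a (k + 1)) (hS : S.IsNext a ε k S')
    {h : ℂ → ℂ} (hh : ∀ z, ‖z‖ ≤ S'.R → ‖h z - S'.f z‖ < S'.δ) {y : C2} (hy : ‖y‖ ≤ 1) :
    ‖(henonMap a h)^[S'.n - S.n] (S.P S.n + (S.scale a : ℂ) • y) - S'.P S'.n‖ < S'.scale a := by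
  have h1 := (hS.stable h hh).2 y hy
  have hs : 0 < S'.scale a := by unfold Stage.scale; positivity
  have h3 : ∀ j, 1 ≤ j → j ≤ k + 1 → 3 ≤ S'.d j := fun j hj hjk => (hS'.odd_d j hj hjk).2
  have hD := three_le_degProd (show 1 ≤ k + 1 by omega) h3
  have hH := norm_fornaessMap_le ha ha1 (h3 (k + 1) (by omega) le_rfl) hD hy
  have hpow : a ^ degProd S'.d (k + 1) ≤ 1 / 2 := by
    calc a ^ degProd S'.d (k + 1) ≤ a ^ 1 :=
          pow_le_pow_of_le_one ha.le (by linarith) (by omega)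
      _ ≤ 1 / 2 := by rwa [pow_one]
  have h4 : S'.scale a * min (ε (k + 1) fun j => fornaessMap a S'.d ((j : ℕ) + 1))
      (a ^ degProd S'.d (k + 1)) ≤ S'.scale a * (1 / 2) :=
    mul_le_mul_of_nonneg_left ((min_le_right _ _).trans hpow) hs.le
  have h5 : ‖(S'.scale a : ℂ) • fornaessMap a S'.d (k + 1) y‖ ≤ S'.scale a * (3 / 8) := by
    rw [norm_ofReal_smul hs.le]
    exact mul_le_mul_of_nonneg_left hH hs.le
  set u := (henonMap a h)^[S'.n - S.n] (S.P S.n + (S.scale a : ℂ) • y)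
  set v := (S'.scale a : ℂ) • fornaessMap a S'.d (k + 1) y
  have h6 := norm_add_le (u - (S'.P S'.n + v)) v
  rw [show u - (S'.P S'.n + v) + v = u - S'.P S'.n by abel] at h6
  linarith

/-- Induction on the number `t` of returns still to come before stage `k`. Up to the next return the
block estimate applies; there the closed ball lands in the next small ball, and the induction
continues from it. With no return left, the tail estimate of the stage itself applies. -/
theorem Stage.mem_ball_of_mem_closedBall (ha : 0 < a) (ha1 : a ≤ 1 / 2)
    (hG : ∀ k, (S k).IsGood a k) (hS : ∀ k, (S k).IsNext a ε k (S (k + 1))) {k : ℕ} (t : ℕ) :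
    ∀ s, s + t = k → ∀ j, 1 ≤ j → j ≤ (S k).N - (S s).n →
      ∀ x ∈ Metric.closedBall ((S (S s).n).P (S s).n) (returnRadius a S (S s).n),
        (henonMap a (S k).f)^[j] x ∈ Metric.ball ((S ((S s).n + j)).P ((S s).n + j))
          (returnRadius a S ((S s).n + j)) := by
  have hn := Stage.strictMono_n hG hS
  have hN := (Stage.strictMono_N hS).monotone
  have hscale : ∀ k, 0 < (S k).scale a := fun k => by unfold Stage.scale; positivity
  have hPn : ∀ k, (S (S k).n).P (S k).n = (S k).P (S k).n := fun k =>
    Stage.P_diag hS (hG k).n_le_N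
  induction t with
  | zero =>
    rintro s rfl j hj hjN x hx
    have hnN := (hG s).n_le_N
    rw [hPn, returnRadius_n hn] at hx
    obtain ⟨y, hy, rfl⟩ := exists_smul_of_mem_closedBall (hscale s) hx
    rw [Metric.mem_ball, dist_eq_norm, Stage.P_diag hS (show (S s).n + j ≤ (S s).N by
        simp only [add_zero] at hjN; omega),
      returnRadius_of_lt hn (show (S s).n < (S s).n + j by omega) (by
        have := (hS s).N_lt_n
        simp only [add_zero] at hjN
        omega)]
    exact (hG s).tail j hjN y hy
  | succ t ih =>
    intro s hst j hj hjN x hx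
    have hsk : s + 1 ≤ k := by omega
    have hnN := (hG s).n_le_N
    have hlt := (hS s).N_lt_n
    have hnN' := (hG (s + 1)).n_le_N
    have hNk := hN hsk
    have hh := Stage.norm_f_sub_lt hG hS hsk
    have hblock := (hS s).stable (S k).f hh
    have hret : ∀ x ∈ Metric.closedBall ((S (S s).n).P (S s).n) (returnRadius a S (S s).n),
        (henonMap a (S k).f)^[(S (s + 1)).n - (S s).n] x ∈
          Metric.ball ((S (S (s + 1)).n).P (S (s + 1)).n) (returnRadius a S (S (s + 1)).n) := by
      intro x hx
      rw [hPn, returnRadius_n hn] at hx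
      obtain ⟨y, hy, rfl⟩ := exists_smul_of_mem_closedBall (hscale s) hx
      rw [Metric.mem_ball, dist_eq_norm, hPn, returnRadius_n hn]
      exact (hS s).norm_return_lt ha ha1 (hG (s + 1)) hh hy
    rcases lt_trichotomy j ((S (s + 1)).n - (S s).n) with h | h | h
    · rw [hPn, returnRadius_n hn] at hx
      obtain ⟨y, hy, rfl⟩ := exists_smul_of_mem_closedBall (hscale s) hx
      rw [Metric.mem_ball, dist_eq_norm,
        Stage.P_diag hS (show (S s).n + j ≤ (S (s + 1)).N by omega),
        returnRadius_of_lt hn (show (S s).n < (S s).n + j by omega) (by omega)]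
      exact hblock.1 j h y hy
    · have h' : (S s).n + j = (S (s + 1)).n := by omega
      rw [h', h]
      exact hret x hx
    · obtain ⟨i, rfl⟩ := Nat.exists_eq_add_of_lt h
      have h' : (S s).n + ((S (s + 1)).n - (S s).n + i + 1) = (S (s + 1)).n + (i + 1) := by omega
      have h'' : (S (s + 1)).n - (S s).n + i + 1 = (i + 1) + ((S (s + 1)).n - (S s).n) := by omega
      have hi : i + 1 ≤ (S k).N - (S (s + 1)).n := by omega
      have := ih (s + 1) (by omega) (i + 1) (by omega) hi _
        (Metric.ball_subset_closedBall (hret x hx))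
      rw [h', h'', Function.iterate_add_apply]
      exact this

end StageSequence

/-! ### Assembly -/

theorem proposition3p1
    (a : ℝ) (ha : a = 1 / 2)
    -- a positive number for each finite family of automorphisms mapping the unit ball
    -- relatively compactly into itself
    (ε : (s : ℕ) → (Fin s → (C2 → C2)) → ℝ)
    (hε : ∀ (s : ℕ) (G : Fin s → (C2 → C2)),
      (∀ j, IsHolAut (G j) ∧
        RelCompactIn (G j '' Metric.ball (0 : C2) 1) (Metric.ball (0 : C2) 1)) → 0 < ε s G) :
    ∃ (F : ℕ → C2 → C2) (f : ℕ → ℂ → ℂ) (P : ℕ → C2) (β R : ℕ → ℝ) (n N d : ℕ → ℕ),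
      (∀ k : ℕ, IsHolAut (F k) ∧ F k = henonMap a (f k) ∧ Differentiable ℂ (f k) ∧
        (fun z : ℂ => f k z - z) =O[𝓝 0] (fun z : ℂ => z ^ 2)) ∧
      (∀ m : ℕ, 0 < β m) ∧ Tendsto β atTop (𝓝 0) ∧
      (∀ k : ℕ, 0 < R k) ∧ StrictMono R ∧ Tendsto R atTop atTop ∧
      StrictMono n ∧ StrictMono N ∧
      (∀ k : ℕ, n k ≤ N k) ∧ (∀ k : ℕ, 1 ≤ k → N (k - 1) ≤ n k) ∧
      (∀ k : ℕ, 1 ≤ k → Odd (d k) ∧ 2 ≤ d k) ∧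
      -- (a)
      (∀ k : ℕ, 1 ≤ k →
        supNormOn {p : C2 | ‖p 0‖ < R (k - 1)} (fun p => F k p - F (k - 1) p)
          ≤ ENNReal.ofReal ((1 / 2 : ℝ) ^ k)) ∧
      -- (b)
      (∀ k m : ℕ, m < N k → F k (P m) = P (m + 1)) ∧
      -- (c)
      (∀ k : ℕ, 1 ≤ k → ‖P (n k)‖ ≤ 1 / (k : ℝ)) ∧
      -- (d)
      (∀ k : ℕ, R k + 3 < ‖P (N k) 0‖ ∧ ∀ m, m < N k → ‖P m 0‖ + β m < R k) ∧
      -- (e)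
      (∀ k : ℕ, 1 ≤ k →
        (∀ m : ℕ, N (k - 1) < m → m < n k → β m = 1 / (k : ℝ)) ∧
        (∀ m : ℕ, n k < m → m ≤ N k → β m = 1 / ((k : ℝ) + 1)) ∧
        β (n k) < 1 / ((k : ℝ) + 1) ∧ ∃ q : ℤ, β (n k) = a ^ (2 * q)) ∧
      -- (f)
      (∀ k : ℕ, 1 ≤ k → (k : ℝ) * |Real.log (β (n k))| ≤ (degProd d k : ℝ)) ∧
      -- (g)
      (∀ k s : ℕ, s ≤ k → ∀ j, 1 ≤ j → j ≤ N k - n s →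
        RelCompactIn ((F k)^[j] '' Metric.ball (P (n s)) (β (n s)))
          (Metric.ball (P (n s + j)) (β (n s + j)))) ∧
      -- (h)
      (∀ k s : ℕ, 1 ≤ s → s ≤ k →
        supNormOn (Metric.closedBall (0 : C2) 1)
          (fun p =>
            scaleFrom (P (n s)) (β (n s))
              ((F k)^[n s - n (s - 1)] (scaleTo (P (n (s - 1))) (β (n (s - 1))) p))
            - fornaessMap a d s p)
          < ENNReal.ofReal
              (min (ε s (fun j : Fin s => fornaessMap a d ((j : ℕ) + 1))) (a ^ degProd d s))) := by
  have ha0 : 0 < a := by rw [ha]; norm_num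
  have ha1 : a ≤ 1 / 2 := ha.le
  obtain ⟨S, hS0, hG, hS⟩ := exists_stages ha0 ha1 hε
  have hn := Stage.strictMono_n hG hS
  have hN := Stage.strictMono_N hS
  have hR := Stage.strictMono_R hS
  have hd : ∀ k, ∀ j ≤ k, (S j).d j = (S k).d j := fun k j hj => Stage.d_diag hS hj
  have hPn : ∀ k, (S (S k).n).P (S k).n = (S k).P (S k).n := fun k =>
    Stage.P_diag hS (hG k).n_le_N
  have hscale : ∀ k, 0 < (S k).scale a := fun k => by unfold Stage.scale; positivity
  refine ⟨fun k => henonMap a (S k).f, fun k => (S k).f, fun m => (S m).P m, returnRadius a S,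
    fun k => (S k).R, fun k => (S k).n, fun k => (S k).N, fun j => (S j).d j,
    fun k => ⟨isHolAut_henonMap ha0.ne' (hG k).diff, rfl, (hG k).diff,
      isBigO_sub_id_sq (hG k).diff (hG k).zero (hG k).deriv_zero⟩,
    returnRadius_pos ha0, tendsto_returnRadius ha0 hG hn, fun k => (hG k).R_pos, hR, ?_, hn, hN,
    fun k => (hG k).n_le_N, fun k hk => ?_, fun k hk => ?_, fun k hk => ?_, fun k m hm => ?_,
    fun k hk => ?_, fun k => ⟨?_, fun m hm => ?_⟩, fun k hk => ?_, fun k hk => ?_,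
    fun k s hsk j hj hjN => ?_, fun k s hs hsk => ?_⟩
  · have hle : ∀ k : ℕ, (k : ℝ) ≤ (S k).R := by
      intro k
      induction k with
      | zero => simpa using (hG 0).R_pos.le
      | succ k ih => push_cast; linarith [(hS k).R_le]
    exact tendsto_atTop_mono hle tendsto_natCast_atTop_atTop
  · obtain ⟨t, rfl⟩ : ∃ t, k = t + 1 := ⟨k - 1, by omega⟩
    exact (hS t).N_lt_n.le
  · obtain ⟨h1, h2⟩ := (hG k).odd_d k hk le_rfl
    exact ⟨h1, le_trans (by norm_num) h2⟩
  · obtain ⟨t, rfl⟩ : ∃ t, k = t + 1 := ⟨k - 1, by omega⟩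
    refine iSup₂_le fun p hp => ENNReal.ofReal_le_ofReal ?_
    rw [norm_henonMap_sub]
    exact ((hS t).close _ (le_of_lt hp)).trans (min_le_left _ _)
  · change henonMap a (S k).f ((S m).P m) = (S (m + 1)).P (m + 1)
    rw [Stage.P_diag hS hm.le, Stage.P_diag hS (k := k) (m := m + 1) hm]
    exact (hG k).orbit m hm
  · obtain ⟨t, rfl⟩ : ∃ t, k = t + 1 := ⟨k - 1, by omega⟩
    change ‖(S (S (t + 1)).n).P (S (t + 1)).n‖ ≤ _
    rw [hPn]
    push_cast
    exact (hS t).near.le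
  · change (S k).R + 3 < ‖(S (S k).N).P (S k).N 0‖
    rw [Stage.P_diag hS (le_refl (S k).N)]
    exact (hG k).exit
  · change ‖(S m).P m 0‖ + returnRadius a S m < (S k).R
    rw [Stage.P_diag hS hm.le]
    -- The unit margin kept in `bounded` absorbs the radius, which is at most `1`.
    linarith [(hG k).bounded m hm, returnRadius_le_one hG m]
  · obtain ⟨t, rfl⟩ : ∃ t, k = t + 1 := ⟨k - 1, by omega⟩
    refine ⟨fun m h1 h2 => ?_, fun m h1 h2 => ?_, ?_, ⟨(S (t + 1)).q, ?_⟩⟩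
    · rw [returnRadius_of_lt hn (k := t) ((hG t).n_le_N.trans_lt h1) h2]
      push_cast
      rfl
    · exact returnRadius_of_lt hn h1 (h2.trans_lt (hS (t + 1)).N_lt_n)
    · change returnRadius a S (S (t + 1)).n < _
      rw [returnRadius_n hn]
      exact (hG (t + 1)).scale_lt
    · change returnRadius a S (S (t + 1)).n = _
      rw [returnRadius_n hn, Stage.scale]
      exact_mod_cast (zpow_natCast a (2 * (S (t + 1)).q)).symm
  · obtain ⟨t, rfl⟩ : ∃ t, k = t + 1 := ⟨k - 1, by omega⟩
    change ((t + 1 : ℕ) : ℝ) * |Real.log (returnRadius a S (S (t + 1)).n)| ≤ _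
    rw [returnRadius_n hn, degProd_congr (hd (t + 1))]
    push_cast
    exact (hS t).log_le
  · obtain ⟨t, rfl⟩ := Nat.exists_eq_add_of_le hsk
    exact relCompactIn_image_ball ((differentiable_henonMap a (hG _).diff).iterate j).continuous
      (Stage.mem_ball_of_mem_closedBall ha0 ha1 hG hS t s rfl j hj hjN)
  · obtain ⟨t, rfl⟩ : ∃ t, s = t + 1 := ⟨s - 1, by omega⟩
    have hd3 : ∀ j, 1 ≤ j → j ≤ t + 1 → 3 ≤ (S (t + 1)).d j := fun j h1 h2 =>
      ((hG (t + 1)).odd_d j h1 h2).2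
    have hfam : (fun j : Fin (t + 1) => fornaessMap a (fun j => (S j).d j) ((j : ℕ) + 1))
        = fun j : Fin (t + 1) => fornaessMap a (S (t + 1)).d ((j : ℕ) + 1) :=
      funext fun j => fornaessMap_congr a fun i hi => hd (t + 1) i (by omega)
    have hH : fornaessMap a (fun j => (S j).d j) (t + 1) = fornaessMap a (S (t + 1)).d (t + 1) :=
      fornaessMap_congr a (hd (t + 1))
    rw [hfam, hH, degProd_congr (hd (t + 1))]
    refine supNormOn_lt_of_forall (isCompact_closedBall _ _) ?_ ?_ fun p hp => ?_
    · have h1 : Continuous (henonMap a (S k).f)^[(S (t + 1)).n - (S t).n] :=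
        ((differentiable_henonMap a (hG k).diff).iterate _).continuous
      have h2 : Continuous (fornaessMap a (S (t + 1)).d (t + 1)) :=
        (isHolAut_fornaessMap ha0.ne' _ _).1.continuous
      simp only [scaleFrom, scaleTo, Nat.add_sub_cancel]
      fun_prop
    · exact lt_min (hε _ _ fun j => fornaessMap_admissible ha0 ha1 (by omega)
        fun i h1 h2 => hd3 i h1 (by omega)) (by positivity)
    · have h1 := ((hS t).stable (S k).f (Stage.norm_f_sub_lt hG hS hsk)).2 p
        (mem_closedBall_zero_iff.1 hp)
      have hc : ((S (t + 1)).scale a : ℂ) ≠ 0 := by exact_mod_cast (hscale (t + 1)).ne'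
      simp only [Nat.add_sub_cancel, hPn, returnRadius_n hn, scaleFrom, scaleTo]
      set u := (henonMap a (S k).f)^[(S (t + 1)).n - (S t).n]
        ((S t).P (S t).n + ((S t).scale a : ℂ) • p)
      -- Rescaling divides the error by the scale at the return time, which is why the stability
      -- estimate carries that scale as a factor.
      rw [show ((S (t + 1)).scale a : ℂ)⁻¹ • (u - (S (t + 1)).P (S (t + 1)).n)
          - fornaessMap a (S (t + 1)).d (t + 1) p
          = ((S (t + 1)).scale a : ℂ)⁻¹ • (u - ((S (t + 1)).P (S (t + 1)).n
            + ((S (t + 1)).scale a : ℂ) • fornaessMap a (S (t + 1)).d (t + 1) p)) by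
        rw [← sub_sub, smul_sub _ (u - _), inv_smul_smul₀ hc], norm_smul, norm_inv,
        Complex.norm_of_nonneg (hscale (t + 1)).le, inv_mul_lt_iff₀ (hscale (t + 1))]
      exact h1
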